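/- For $\lambda=(\lambda_1,\dots,\lambda_n)\in\mathbb R^n$ let $\sigma_j(\lambda)=\sum_{1\le i_1<\cdots<i_j\le n}\lambda_{i_1}\cdots\lambda_{i_j}$ be the $j$-th elementary symmetric function, let $\sigma_k^{pp}=\partial\sigma_k/\partial\lambda_p$ and $\sigma_k^{pp,qq}=\partial^2\sigma_k/\partial\lambda_p\partial\lambda_q$ (evaluated at $\lambda$), and let $\Gamma_k=\{\lambda\in\mathbb R^n:\sigma_j(\lambda)>0\text{ for } j=1,\dots,k\}$ be the Gårding cone. **Lemma 1.4.** Let $k\ge 1$. There are constants $\delta_0>0$ and $K_0>0$, depending only on $k$, such that for every $n\ge k$, every $A>0$ and all $0<m\le M$ there is a constant $C>0$, depending only on $n,k,A,m,M$, with the following property. If $\lambda\in\Gamma_k$ satisfies $\lambda_1\ge\lambda_2\ge\cdots\ge\lambda_n$, $\lambda_n>-A$, $m\le\sigma_k(\lambda)\le M$ and $\lambda_1\ge C$, then for every $K\ge K_0$ and every $\xi=(\xi_1,\dots,\xi_n)\in\mathbb R^n$ $$-\sum_{p\ne q}\frac{\sigma_k^{pp,qq}\xi_p\xi_q}{\sigma_k}+K\frac{\left(\sum_i\sigma_k^{ii}\xi_i\right)^2}{\sigma_k^2}+2\sum_{i>1}\frac{\sigma_k^{ii}\xi_i^2}{(\lambda_1+A+1)\sigma_k}\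 \ge\ (1+\delta_0)\frac{\sigma_k^{11}\xi_1^2}{\lambda_1\sigma_k},$$ where the first sum runs over all ordered pairs $(p,q)$ with $p\neq q$. -/

import Mathlib

open scoped BigOperators

/-- The `k`-th elementary symmetric function `σ_k(λ)` of `λ ∈ ℝⁿ`. -/
noncomputable def sigma {n : ℕ} (k : ℕ) (lam : Fin n → ℝ) : ℝ :=
  MvPolynomial.eval lam (MvPolynomial.esymm (Fin n) ℝ k)

/-- The first partial derivative `σ_k^{pp} = ∂σ_k/∂λ_p` at `λ`. -/
noncomputable def sigmaD {n : ℕ} (k : ℕ) (p : Fin n) (lam : Fin n → ℝ) : ℝ :=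
  MvPolynomial.eval lam (MvPolynomial.pderiv p (MvPolynomial.esymm (Fin n) ℝ k))

/-- The second partial derivative `σ_k^{pp,qq} = ∂²σ_k/∂λ_p∂λ_q` at `λ`. -/
noncomputable def sigmaDD {n : ℕ} (k : ℕ) (p q : Fin n) (lam : Fin n → ℝ) : ℝ :=
  MvPolynomial.eval lam
    (MvPolynomial.pderiv p (MvPolynomial.pderiv q (MvPolynomial.esymm (Fin n) ℝ k)))

/-- The Gårding cone `Γ_k = {λ ∈ ℝⁿ : σ_j(λ) > 0 for j = 1, …, k}`. -/
def gardingCone (n k : ℕ) : Set (Fin n → ℝ) :=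
  {lam | ∀ j : ℕ, 1 ≤ j → j ≤ k → 0 < sigma j lam}

/-! Scale to x = λ/λ₁, so that the largest entry is 1. Since σ_k stays bounded while λ₁ is large and
every entry exceeds -A/λ₁, the k-th entry of x must be tiny. Along a decreasing sequence of
thresholds depending only on n and k there is therefore a gap: for some l < k, the first l entries
(the cluster L) are at least ρ, and all others (the small cluster) are at most ε in absolute value,
where ε is as small as needed in terms of ρ.

Put j = k - l and work to second order along the line x + Xξ. Splitting off L gives e_k = Λ(P + E Z
+ tail), where Λ is the product of the entries in L, E is the sum of their inverses, and P, Z are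
e_j and e_{j+1} of the small cluster. The tail is negligible by the weight bounds of
`exists_weight_bound`, but the ratio H = Z/P is not: it is almost nonpositive and may descend to
about -1/E.

Suppose first H = 0. With a_i = ξ_i/x_i on L, α = ∑ a_i and b = P'/P, concavity of e_j^(1/j)
(`esum_line_garding`) bounds the left side below by ∑ a_i² + b²/j - (α + b)² + K(α + b)². A large K
forces α + b ≈ 0, and Cauchy–Schwarz, with total weight (l - 1) + j = k - 1 for the directions other
than a₁, turns ∑ a_i² + b²/j into a₁² times 1 plus a gain of order 1/k. This gain is the source of
δ₀.

For H < 0 the argument only carries the weight g0 ≈ 1 + EH, which may degenerate. The missing weight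
β = -EH is recovered from two sources: quantitative concavity of e_{j+1}/e_j on the small cluster
(`coeff_two_quotLine_le`) and the term 2∑σ_k^{ii}ξ_i² over the small indices. The combined quadratic
form with weights g0 and β is treated in `main_quadratic`. `scalar_core` shows that all errors fit
into the remaining slack, `exists_normalized_inequality` converts this into a statement about the
two clusters, and the final theorem finds the gap and undoes the scaling. -/

/-! ### Elementary symmetric sums over a finite index set, and their recursions. -/

section ElementarySymmetric

variable {ι R : Type*} [CommRing R]

/-- The `m`-th elementary symmetric polynomial in the entries of `x` indexed by `S`. -/
def esum (x : ι → R) (S : Finset ι) (m : ℕ) : R :=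
  ∑ t ∈ S.powersetCard m, ∏ i ∈ t, x i

@[simp] theorem esum_zero (x : ι → R) (S : Finset ι) : esum x S 0 = 1 := by
  simp [esum]

theorem esum_eq_zero (x : ι → R) {S : Finset ι} {m : ℕ} (h : S.card < m) : esum x S m = 0 := by
  simp [esum, Finset.powersetCard_eq_empty.2 h]

@[simp] theorem esum_empty_succ (x : ι → R) (m : ℕ) : esum x ∅ (m + 1) = 0 :=
  esum_eq_zero x (Nat.succ_pos m)

theorem esum_one (x : ι → R) (S : Finset ι) : esum x S 1 = ∑ i ∈ S, x i := by
  simp [esum, Finset.powersetCard_one]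

theorem esum_smul (c : R) (x : ι → R) (S : Finset ι) (m : ℕ) :
    esum (fun i => c * x i) S m = c ^ m * esum x S m := by
  unfold esum
  rw [Finset.mul_sum]
  refine Finset.sum_congr rfl fun t ht => ?_
  rw [Finset.prod_mul_distrib, Finset.prod_const, (Finset.mem_powersetCard.1 ht).2]

theorem esum_congr {x x' : ι → R} {S : Finset ι} (h : ∀ i ∈ S, x i = x' i) (m : ℕ) :
    esum x S m = esum x' S m := by
  unfold esum
  refine Finset.sum_congr rfl fun t ht => Finset.prod_congr rfl fun i hi => ?_
  exact h i ((Finset.mem_powersetCard.1 ht).1 hi)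

theorem map_esum {R' : Type*} [CommRing R'] (f : R →+* R') (x : ι → R) (S : Finset ι) (m : ℕ) :
    f (esum x S m) = esum (fun i => f (x i)) S m := by
  simp [esum, map_sum, map_prod]

variable [DecidableEq ι]

theorem esum_insert (x : ι → R) {S : Finset ι} {a : ι} (ha : a ∉ S) (m : ℕ) :
    esum x (insert a S) (m + 1) = x a * esum x S m + esum x S (m + 1) := by
  unfold esum
  rw [Finset.powersetCard_succ_insert ha, Finset.sum_union, add_comm, Finset.mul_sum]
  · congr 1
    rw [Finset.sum_image]
    · refine Finset.sum_congr rfl fun t ht => ?_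
      rw [Finset.prod_insert]
      exact fun h => ha ((Finset.mem_powersetCard.1 ht).1 h)
    · intro s hs t ht h
      have hs' : a ∉ s := fun h => ha ((Finset.mem_powersetCard.1 hs).1 h)
      have ht' : a ∉ t := fun h => ha ((Finset.mem_powersetCard.1 ht).1 h)
      rw [← Finset.erase_insert hs', ← Finset.erase_insert ht', h]
  · rw [Finset.disjoint_left]
    intro s hs hs'
    obtain ⟨t, -, rfl⟩ := Finset.mem_image.1 hs'
    exact ha ((Finset.mem_powersetCard.1 hs).1 (Finset.mem_insert_self a t))

theorem esum_erase (x : ι → R) {S : Finset ι} {a : ι} (ha : a ∈ S) (m : ℕ) :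
    esum x S (m + 1) = x a * esum x (S.erase a) m + esum x (S.erase a) (m + 1) := by
  conv_lhs => rw [← Finset.insert_erase ha]
  exact esum_insert x (Finset.notMem_erase a S) m

theorem sum_mul_esum_erase (x : ι → R) (S : Finset ι) (m : ℕ) :
    ∑ i ∈ S, x i * esum x (S.erase i) m = (m + 1 : R) * esum x S (m + 1) := by
  induction S using Finset.induction_on generalizing m with
  | empty => simp
  | insert a S ha ih =>
    rw [Finset.sum_insert ha, Finset.erase_insert ha, esum_insert x ha]
    cases m with
    | zero => 
      have h0 := ih 0
      simp only [esum_zero, mul_one, Nat.cast_zero, zero_add, one_mul] at h0 ⊢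
      rw [h0]
    | succ m =>
      have : ∀ i ∈ S, x i * esum x ((insert a S).erase i) (m + 1) =
          x a * (x i * esum x (S.erase i) m) + x i * esum x (S.erase i) (m + 1) := by
        intro i hi
        have hia : a ≠ i := fun h => ha (h ▸ hi)
        rw [Finset.erase_insert_of_ne hia, esum_insert]
        · ring
        · exact fun h => ha (Finset.mem_of_mem_erase h)
      rw [Finset.sum_congr rfl this, Finset.sum_add_distrib, ← Finset.mul_sum, ih, ih]
      push_cast
      ring

theorem sum_esum_erase (x : ι → R) (S : Finset ι) (m : ℕ) :
    ∑ i ∈ S, esum x (S.erase i) m = (S.card - m : R) * esum x S m := by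
  cases m with
  | zero => simp
  | succ m =>
    have : ∀ i ∈ S, esum x (S.erase i) (m + 1) =
        esum x S (m + 1) - x i * esum x (S.erase i) m := by
      intro i hi
      rw [esum_erase x hi]; ring
    rw [Finset.sum_congr rfl this, Finset.sum_sub_distrib, sum_mul_esum_erase]
    simp; ring

/-- Divided by e_{m+1}, this expresses e_{m+2}/e_{m+1} through the terms x_i²/(e_{m+1}(S)/e_m(S \
i)). Both the concavity of the quotient and the moment bounds rest on it. -/
theorem sum_sq_mul_esum_erase (x : ι → R) (S : Finset ι) (m : ℕ) :
    ∑ i ∈ S, x i ^ 2 * esum x (S.erase i) m =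
      esum x S 1 * esum x S (m + 1) - (m + 2 : R) * esum x S (m + 2) := by
  have : ∀ i ∈ S, x i ^ 2 * esum x (S.erase i) m =
      x i * esum x S (m + 1) - x i * esum x (S.erase i) (m + 1) := by
    intro i hi
    rw [esum_erase x hi]; ring
  rw [Finset.sum_congr rfl this, Finset.sum_sub_distrib, sum_mul_esum_erase, ← Finset.sum_mul,
    esum_one]
  push_cast
  ring

theorem sum_sum_mul_esum_erase (x : ι → R) (S : Finset ι) (m : ℕ) :
    ∑ p ∈ S, ∑ q ∈ S.erase p, x p * x q * esum x ((S.erase p).erase q) m =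
      (m + 2 : R) * (m + 1) * esum x S (m + 2) := by
  have : ∀ p ∈ S, ∑ q ∈ S.erase p, x p * x q * esum x ((S.erase p).erase q) m =
      (m + 1 : R) * (x p * esum x (S.erase p) (m + 1)) := by
    intro p _
    simp_rw [mul_assoc]
    rw [← Finset.mul_sum, sum_mul_esum_erase]; ring
  rw [Finset.sum_congr rfl this, ← Finset.mul_sum, sum_mul_esum_erase]
  push_cast
  ring

/-- Kept general so as to serve both d/dX on power series along a line and the partial derivatives
of `MvPolynomial`. -/
theorem derivation_esum {A : Type*} [CommRing A] [Algebra A R] (D : Derivation A R R)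
    (x : ι → R) (S : Finset ι) (m : ℕ) :
    D (esum x S (m + 1)) = ∑ i ∈ S, D (x i) * esum x (S.erase i) m := by
  induction S using Finset.induction_on generalizing m with
  | empty => simp
  | insert a S ha ih =>
    rw [Finset.sum_insert ha, Finset.erase_insert ha, esum_insert x ha, map_add, Derivation.leibniz,
      ih]
    cases m with
    | zero => simp
    | succ m =>
      have : ∀ i ∈ S, D (x i) * esum x ((insert a S).erase i) (m + 1) =
          x a * (D (x i) * esum x (S.erase i) m) + D (x i) * esum x (S.erase i) (m + 1) := by
        intro i hi
        have hia : a ≠ i := fun h => ha (h ▸ hi)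
        rw [Finset.erase_insert_of_ne hia, esum_insert]
        · ring
        · exact fun h => ha (Finset.mem_of_mem_erase h)
      rw [Finset.sum_congr rfl this, Finset.sum_add_distrib, ← Finset.mul_sum, ih]
      simp only [smul_eq_mul]
      ring

/-- Splitting off the variables in `L`, all of them invertible. -/
theorem esum_union_of_inverse (x y : ι → R) (L M : Finset ι) (hLM : Disjoint L M)
    (hxy : ∀ i ∈ L, x i * y i = 1) (j : ℕ) :
    esum x (L ∪ M) (L.card + j) =
      (∏ i ∈ L, x i) * ∑ r ∈ Finset.range (L.card + 1), esum y L r * esum x M (j + r) := by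
  induction L using Finset.induction_on generalizing j with
  | empty => simp
  | insert a L ha ih =>
    have hd : Disjoint L M := hLM.mono_left (Finset.subset_insert a L)
    have haM : a ∉ M := Finset.disjoint_left.1 hLM (Finset.mem_insert_self a L)
    have haU : a ∉ L ∪ M := by simp [ha, haM]
    have hy : ∀ i ∈ L, x i * y i = 1 := fun i hi => hxy i (Finset.mem_insert_of_mem hi)
    have hya : x a * y a = 1 := hxy a (Finset.mem_insert_self a L)
    rw [Finset.insert_union, Finset.card_insert_of_notMem ha,
      show L.card + 1 + j = (L.card + j) + 1 by ring, esum_insert x haU, ih hd hy,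
      show L.card + j + 1 = L.card + (j + 1) by ring, ih hd hy, Finset.prod_insert ha]
    have h1 : ∑ r ∈ Finset.range (L.card + 1 + 1), esum y (insert a L) r * esum x M (j + r) =
        ∑ r ∈ Finset.range (L.card + 1), esum y L r * esum x M (j + r) +
        y a * ∑ r ∈ Finset.range (L.card + 1), esum y L r * esum x M (j + 1 + r) := by
      rw [Finset.sum_range_succ', Finset.mul_sum]
      have h2 : ∀ r, esum y (insert a L) (r + 1) * esum x M (j + (r + 1)) =
          y a * (esum y L r * esum x M (j + 1 + r)) + esum y L (r + 1) * esum x M (j + (r + 1)) := by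
        intro r
        rw [esum_insert y ha, show j + (r + 1) = j + 1 + r by ring]; ring
      simp_rw [h2]
      rw [Finset.sum_add_distrib]
      have h3 := Finset.sum_range_succ' (fun r => esum y L r * esum x M (j + r)) (L.card + 1)
      rw [Finset.sum_range_succ, esum_eq_zero y (Nat.lt_succ_self L.card)] at h3
      simp only [zero_mul, add_zero, esum_zero] at h3 ⊢
      rw [h3]
      ring
    rw [h1]
    linear_combination (-(∏ i ∈ L, x i) *
      ∑ r ∈ Finset.range (L.card + 1), esum y L r * esum x M (j + 1 + r)) * hya

end ElementarySymmetric

/-! ### Newton's inequality and the Gårding cones. -/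

section Newton

open Polynomial

/-- Rolle: passing to the derivative loses at most one root counted with multiplicity. -/
theorem Polynomial.Splits.derivative_real {f : ℝ[X]} (hf : f.Splits) : (derivative f).Splits := by
  rw [splits_iff_card_roots] at hf ⊢
  refine le_antisymm (card_roots' _) ?_
  have h1 := card_roots_le_derivative f
  have h2 := natDegree_derivative_le f
  omega

theorem Polynomial.Splits.iterate_derivative_real {f : ℝ[X]} (hf : f.Splits) (k : ℕ) :
    (derivative^[k] f).Splits := by
  induction k with
  | zero => simpa using hf
  | succ k ih =>
    rw [Function.iterate_succ_apply']
    exact ih.derivative_real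

/-- Multiplying g by X - a changes the discrepancy f₁² - 2f₀f₂ into g₀² + a²(g₁² - 2g₀g₂), so
nonnegativity propagates over the linear factors. -/
theorem Polynomial.Splits.two_mul_coeff_le {f : ℝ[X]} (hf : f.Splits) :
    2 * f.coeff 0 * f.coeff 2 ≤ f.coeff 1 ^ 2 := by
  have key : ∀ s : Multiset ℝ, 2 * ((s.map fun r => X - C r).prod).coeff 0 *
      ((s.map fun r => X - C r).prod).coeff 2 ≤ ((s.map fun r => X - C r).prod).coeff 1 ^ 2 := by
    intro s
    induction s using Multiset.induction_on with
    | empty => simp [coeff_one]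
    | cons a s ih =>
      rw [Multiset.map_cons, Multiset.prod_cons]
      generalize (s.map fun r => X - C r).prod = g at ih ⊢
      have h0 : ((X - C a) * g).coeff 0 = -a * g.coeff 0 := by simp [sub_mul]
      have h1 : ((X - C a) * g).coeff 1 = g.coeff 0 - a * g.coeff 1 := by
        simp [sub_mul, coeff_X_mul]
      have h2 : ((X - C a) * g).coeff 2 = g.coeff 1 - a * g.coeff 2 := by
        simp [sub_mul, coeff_X_mul]
      rw [h0, h1, h2]
      nlinarith [mul_le_mul_of_nonneg_left ih (sq_nonneg a), sq_nonneg (g.coeff 0)]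
  rw [hf.eq_prod_roots]
  simp only [coeff_C_mul]
  nlinarith [mul_le_mul_of_nonneg_left (key f.roots) (sq_nonneg f.leadingCoeff)]

variable {ι : Type*}

/-- The entries of `x` indexed by `S` form a vector in the cone `Γ_k`. -/
def IsGarding (x : ι → ℝ) (S : Finset ι) (k : ℕ) : Prop :=
  ∀ m, m ≤ k → 0 < esum x S m

theorem IsGarding.mono {x : ι → ℝ} {S : Finset ι} {k k' : ℕ} (h : IsGarding x S k) (hk : k' ≤ k) :
    IsGarding x S k' := fun m hm => h m (hm.trans hk)

theorem IsGarding.zero (x : ι → ℝ) (S : Finset ι) : IsGarding x S 0 := by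
  intro m hm
  obtain rfl : m = 0 := by omega
  simp

theorem IsGarding.succ {x : ι → ℝ} {S : Finset ι} {k : ℕ} (h : IsGarding x S k)
    (h' : 0 < esum x S (k + 1)) : IsGarding x S (k + 1) := by
  intro m hm
  rcases Nat.lt_or_ge k m with hk | hk
  · obtain rfl : m = k + 1 := by omega
    exact h'
  · exact h m hk

variable [DecidableEq ι]


theorem coeff_prod_one_add_mul_X (x : ι → ℝ) (S : Finset ι) (m : ℕ) :
    (∏ i ∈ S, (1 + C (x i) * X)).coeff m = esum x S m := by
  induction S using Finset.induction_on generalizing m with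
  | empty => cases m <;> simp [coeff_one]
  | insert a S ha ih =>
    rw [Finset.prod_insert ha, add_mul, one_mul, mul_assoc, coeff_add, coeff_C_mul, ih]
    cases m with
    | zero => simp
    | succ m => rw [coeff_X_mul, ih, esum_insert x ha]; ring

/-- Newton's inequality, for arbitrary real numbers. -/
theorem esum_newton (x : ι → ℝ) (S : Finset ι) (m : ℕ) :
    (m + 2 : ℝ) * (esum x S m * esum x S (m + 2)) ≤ (m + 1 : ℝ) * esum x S (m + 1) ^ 2 := by
  have hs : (∏ i ∈ S, (1 + C (x i) * X)).Splits := by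
    refine Splits.prod fun i _ => Splits.of_natDegree_le_one ?_
    compute_degree
  -- The m-th derivative of ∏(1 + x_i X) is still real-rooted, and its lowest three coefficients are
  -- e_m, e_{m+1}, e_{m+2} up to factorials.
  have h := (hs.iterate_derivative_real m).two_mul_coeff_le
  simp only [coeff_iterate_derivative, coeff_prod_one_add_mul_X, zero_add, nsmul_eq_mul,
    add_comm 1 m, add_comm 2 m] at h
  have f0 : (m.descFactorial m : ℝ) = m.factorial := by simp [Nat.descFactorial_self]
  have f1 : ((m + 1).descFactorial m : ℝ) = (m + 1) * m.factorial := by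
    have := Nat.factorial_mul_descFactorial (Nat.le_succ m)
    simp at this
    rw [this, Nat.factorial_succ]; push_cast; ring
  have f2 : 2 * ((m + 2).descFactorial m : ℝ) = (m + 2) * ((m + 1) * m.factorial) := by
    have := Nat.factorial_mul_descFactorial (show m ≤ m + 2 by omega)
    simp at this
    have h2 : (2 : ℝ) * ((m + 2).descFactorial m : ℝ) = ((m + 2).factorial : ℝ) := by
      exact_mod_cast this
    rw [h2, Nat.factorial_succ, Nat.factorial_succ]; push_cast; ring
  rw [f0, f1] at h
  have hpos : (0 : ℝ) < m.factorial ^ 2 * (m + 1) := by positivity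
  refine le_of_mul_le_mul_left ?_ hpos
  calc _ = (m.factorial * esum x S m) * ((m + 2) * ((m + 1) * m.factorial) * esum x S (m + 2)) := by
        ring
    _ = 2 * (m.factorial * esum x S m) * ((m + 2).descFactorial m * esum x S (m + 2)) := by
        rw [← f2]; ring
    _ ≤ _ := h
    _ = _ := by ring

/-- Let a, b, c be three consecutive sums of the erased set with a > 0. If b ≤ 0, positivity of x_i
a + b and x_i b + c forces x_i > 0, c > 0 and b² ≤ ac, against Newton. -/
theorem IsGarding.erase {x : ι → ℝ} {S : Finset ι} {k : ℕ} (h : IsGarding x S (k + 1)) {i : ι}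
    (hi : i ∈ S) : IsGarding x (S.erase i) k := by
  induction k with
  | zero => exact IsGarding.zero _ _
  | succ k ih =>
    have h' := ih (h.mono (Nat.le_succ _))
    refine h'.succ ?_
    by_contra hneg
    push Not at hneg
    have e1 := h (k + 1) (by omega)
    have e2 := h (k + 2) (by omega)
    rw [esum_erase x hi] at e1 e2
    have p0 := h' k le_rfl
    have hN := esum_newton x (S.erase i) k
    set a := esum x (S.erase i) k
    set b := esum x (S.erase i) (k + 1)
    set c := esum x (S.erase i) (k + 2)
    have hx : 0 < x i := by
      by_contra hx
      push Not at hx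
      nlinarith
    have hc : 0 < c := by nlinarith
    have hac : 0 < a * c := mul_pos p0 hc
    have h1 : b ^ 2 ≤ a * c := by
      have : -b * (-b) ≤ (x i * a) * (-b) := by nlinarith
      have : x i * (-b) ≤ c := by linarith
      nlinarith
    have hk : (0 : ℝ) ≤ k := Nat.cast_nonneg k
    nlinarith

end Newton

/-! ### Second-order jets along a line; concavity of quotients of elementary symmetric sums. -/

section Jets

open PowerSeries

theorem PowerSeries.coeff_one_mul' (f g : ℝ⟦X⟧) :
    coeff 1 (f * g) = coeff 0 f * coeff 1 g + coeff 1 f * coeff 0 g := by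
  rw [coeff_mul, Finset.Nat.sum_antidiagonal_eq_sum_range_succ_mk]
  simp [Finset.sum_range_succ]

theorem PowerSeries.coeff_two_mul (f g : ℝ⟦X⟧) :
    coeff 2 (f * g) = coeff 0 f * coeff 2 g + coeff 1 f * coeff 1 g + coeff 2 f * coeff 0 g := by
  rw [coeff_mul, Finset.Nat.sum_antidiagonal_eq_sum_range_succ_mk]
  simp [Finset.sum_range_succ]

theorem PowerSeries.coeff_zero_mul' (f g : ℝ⟦X⟧) :
    coeff 0 (f * g) = coeff 0 f * coeff 0 g := by
  simp

theorem PowerSeries.natCast_add_two_eq_C (m : ℕ) : ((m : ℝ⟦X⟧) + 2) = C ((m : ℝ) + 2) := by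
  rw [map_add, map_natCast, map_ofNat]

/-- First coefficient of `x ^ 2 / y` for a line `x`. -/
theorem PowerSeries.coeff_one_sq_div {x y r : ℝ⟦X⟧} (h : r * y = x ^ 2) (hy : 0 < coeff 0 y) :
    coeff 1 r = (1 / coeff 0 y) * (2 * coeff 0 x * coeff 1 x -
      coeff 0 x ^ 2 * (coeff 1 y / coeff 0 y)) := by
  have h0 := congrArg (coeff 0) h
  have h1 := congrArg (coeff 1) h
  rw [pow_two, coeff_zero_mul', coeff_zero_mul'] at h0
  rw [pow_two, coeff_one_mul', coeff_one_mul'] at h1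
  have e0 : coeff 0 r = coeff 0 x ^ 2 / coeff 0 y := by
    rw [eq_div_iff hy.ne', h0]; ring
  rw [e0] at h1
  field_simp at h1 ⊢
  linarith

/-- Second coefficient of `x ^ 2 / y` for a line `x`. -/
theorem PowerSeries.coeff_two_sq_div {x y r : ℝ⟦X⟧} (h : r * y = x ^ 2) (hy : 0 < coeff 0 y)
    (hx : coeff 2 x = 0) :
    coeff 2 r = (1 / coeff 0 y) * (coeff 1 x - coeff 0 x * (coeff 1 y / coeff 0 y)) ^ 2 -
      coeff 0 x ^ 2 * coeff 2 y / coeff 0 y ^ 2 := by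
  have h0 := congrArg (coeff 0) h
  have h1 := coeff_one_sq_div h hy
  have h2 := congrArg (coeff 2) h
  rw [pow_two, coeff_zero_mul', coeff_zero_mul'] at h0
  rw [pow_two, coeff_two_mul, coeff_two_mul, hx] at h2
  have e0 : coeff 0 r = coeff 0 x ^ 2 / coeff 0 y := by
    rw [eq_div_iff hy.ne', h0]; ring
  rw [e0, h1] at h2
  have e2 : coeff 2 r = (coeff 1 x ^ 2 - coeff 0 x ^ 2 / coeff 0 y * coeff 2 y -
      (1 / coeff 0 y) * (2 * coeff 0 x * coeff 1 x -
      coeff 0 x ^ 2 * (coeff 1 y / coeff 0 y)) * coeff 1 y) / coeff 0 y := by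
    rw [eq_div_iff hy.ne']; linarith
  rw [e2]
  field_simp
  ring

variable {ι : Type*}

/-- The line through `x` in direction `ξ`. -/
noncomputable def line (x ξ : ι → ℝ) (i : ι) : ℝ⟦X⟧ := C (x i) + C (ξ i) * X

@[simp] theorem coeff_zero_line (x ξ : ι → ℝ) (i : ι) : coeff 0 (line x ξ i) = x i := by
  simp [line]

@[simp] theorem coeff_one_line (x ξ : ι → ℝ) (i : ι) : coeff 1 (line x ξ i) = ξ i := by
  simp [line, coeff_C]

@[simp] theorem coeff_two_line (x ξ : ι → ℝ) (i : ι) : coeff 2 (line x ξ i) = 0 := by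
  simp [line]

@[simp] theorem coeff_zero_esum_line (x ξ : ι → ℝ) (S : Finset ι) (m : ℕ) :
    coeff 0 (esum (line x ξ) S m) = esum x S m := by
  rw [coeff_zero_eq_constantCoeff, map_esum]
  congr 1
  funext i
  rw [← coeff_zero_eq_constantCoeff, coeff_zero_line]

theorem derivative_line (x ξ : ι → ℝ) (i : ι) : PowerSeries.derivative ℝ (line x ξ i) = C (ξ i) := by
  simp [line, Derivation.leibniz]

theorem coeff_two_esum_line_one (x ξ : ι → ℝ) (S : Finset ι) :
    coeff 2 (esum (line x ξ) S 1) = 0 := by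
  simp [esum_one, map_sum]

/-- The quotient `e_{m+1} / e_m` along a line. -/
noncomputable def quotLine (x ξ : ι → ℝ) (S : Finset ι) (m : ℕ) : ℝ⟦X⟧ :=
  esum (line x ξ) S (m + 1) * (esum (line x ξ) S m)⁻¹

theorem esum_line_mul_inv {x ξ : ι → ℝ} {S : Finset ι} {m : ℕ} (h : 0 < esum x S m) :
    esum (line x ξ) S m * (esum (line x ξ) S m)⁻¹ = 1 := by
  refine PowerSeries.mul_inv_cancel _ ?_
  rw [← coeff_zero_eq_constantCoeff, coeff_zero_esum_line]
  exact h.ne'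

theorem coeff_zero_inv_esum_line (x ξ : ι → ℝ) (S : Finset ι) (m : ℕ) :
    coeff 0 (esum (line x ξ) S m)⁻¹ = (esum x S m)⁻¹ := by
  rw [coeff_zero_eq_constantCoeff, constantCoeff_inv, ← coeff_zero_eq_constantCoeff,
    coeff_zero_esum_line]

variable [DecidableEq ι]

theorem coeff_one_esum_line (x ξ : ι → ℝ) (S : Finset ι) (m : ℕ) :
    coeff 1 (esum (line x ξ) S (m + 1)) = ∑ i ∈ S, ξ i * esum x (S.erase i) m := by
  have h := coeff_derivative (R := ℝ) (esum (line x ξ) S (m + 1)) 0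
  rw [derivation_esum] at h
  simp only [derivative_line, map_sum, coeff_C_mul, coeff_zero_esum_line] at h
  simpa using h.symm

theorem coeff_two_esum_line (x ξ : ι → ℝ) (S : Finset ι) (m : ℕ) :
    2 * coeff 2 (esum (line x ξ) S (m + 2)) =
      ∑ p ∈ S, ∑ q ∈ S.erase p, ξ p * ξ q * esum x ((S.erase p).erase q) m := by
  have h := coeff_derivative (R := ℝ) (esum (line x ξ) S (m + 2)) 1
  rw [show m + 2 = (m + 1) + 1 by ring, derivation_esum] at h
  simp only [derivative_line, map_sum, coeff_C_mul, coeff_one_esum_line] at h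
  rw [show m + 2 = (m + 1) + 1 by ring, mul_comm]
  simp only [Finset.mul_sum, ← mul_assoc] at h
  rw [h]
  norm_num

/-- `e_{m+1}(S) / e_m(S \ i)` along a line. -/
noncomputable def quotErase (x ξ : ι → ℝ) (S : Finset ι) (m : ℕ) (i : ι) : ℝ⟦X⟧ :=
  esum (line x ξ) S (m + 1) * (esum (line x ξ) (S.erase i) m)⁻¹

theorem coeff_zero_quotErase (x ξ : ι → ℝ) (S : Finset ι) (m : ℕ) (i : ι) :
    coeff 0 (quotErase x ξ S m i) = esum x S (m + 1) / esum x (S.erase i) m := by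
  rw [quotErase, coeff_zero_mul', coeff_zero_esum_line, coeff_zero_inv_esum_line, div_eq_mul_inv]

theorem quotErase_eq {x ξ : ι → ℝ} {S : Finset ι} {m : ℕ} {i : ι} (hi : i ∈ S)
    (h : 0 < esum x (S.erase i) m) :
    quotErase x ξ S m i = line x ξ i + quotLine x ξ (S.erase i) m := by
  unfold quotErase quotLine
  rw [esum_erase _ hi, add_mul, mul_assoc, esum_line_mul_inv h, mul_one]

/-- The quotient is linear minus a sum of terms x_i²/y_i, where by `quotErase_eq` y_i is x_i plus
the quotient one degree lower. As x²/y is convex in x and decreasing in y > 0, concavity passes from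
degree m to m + 1. -/
theorem quotLine_average {x ξ : ι → ℝ} {S : Finset ι} {m : ℕ} (h : 0 < esum x S (m + 1)) :
    (m + 2 : ℝ⟦X⟧) * quotLine x ξ S (m + 1) = ∑ i ∈ S, line x ξ i -
      ∑ i ∈ S, line x ξ i ^ 2 *
        (esum (line x ξ) (S.erase i) m * (esum (line x ξ) S (m + 1))⁻¹) := by
  have h1 := sum_sq_mul_esum_erase (line x ξ) S m
  have h2 := esum_line_mul_inv (ξ := ξ) h
  simp_rw [← mul_assoc]
  rw [← Finset.sum_mul, h1, quotLine, ← esum_one]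
  linear_combination (esum (line x ξ) S 1) * h2

/-- The logarithmic derivative of `e_{m+1}(S) / e_m(S \ i)`. -/
noncomputable def logQuotErase (x ξ : ι → ℝ) (S : Finset ι) (m : ℕ) (i : ι) : ℝ :=
  coeff 1 (quotErase x ξ S m i) / coeff 0 (quotErase x ξ S m i)

theorem coeff_one_quotLine {x ξ : ι → ℝ} {S : Finset ι} {m : ℕ} (h : IsGarding x S (m + 1)) :
    (m + 2 : ℝ) * coeff 1 (quotLine x ξ S (m + 1)) = ∑ i ∈ S, ξ i -
      ∑ i ∈ S, (esum x (S.erase i) m / esum x S (m + 1)) *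
        (2 * x i * ξ i - x i ^ 2 * logQuotErase x ξ S m i) := by
  have h0 := h _ le_rfl
  have h1 := congrArg (coeff 1) (quotLine_average (ξ := ξ) h0)
  rw [natCast_add_two_eq_C, coeff_C_mul, map_sub, map_sum, map_sum] at h1
  rw [h1]
  simp only [coeff_one_line]
  congr 1
  refine Finset.sum_congr rfl fun i hi => ?_
  have hw := (h.erase hi) _ le_rfl
  have hy : 0 < coeff 0 (quotErase x ξ S m i) := by
    rw [coeff_zero_quotErase]; positivity
  rw [coeff_one_sq_div (x := line x ξ i) (y := quotErase x ξ S m i) _ hy, coeff_zero_line,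
    coeff_one_line, coeff_zero_quotErase, logQuotErase, coeff_zero_quotErase, one_div_div]
  unfold quotErase
  linear_combination (line x ξ i ^ 2) * (esum (line x ξ) (S.erase i) m *
    (esum (line x ξ) (S.erase i) m)⁻¹) * esum_line_mul_inv (ξ := ξ) h0 +
    (line x ξ i ^ 2) * esum_line_mul_inv (ξ := ξ) hw

theorem coeff_two_quotLine_eq {x ξ : ι → ℝ} {S : Finset ι} {m : ℕ} (h : IsGarding x S (m + 1)) :
    (m + 2 : ℝ) * coeff 2 (quotLine x ξ S (m + 1)) =
      - ∑ i ∈ S, ((esum x (S.erase i) m / esum x S (m + 1)) *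
        (ξ i - x i * logQuotErase x ξ S m i) ^ 2 -
        x i ^ 2 * coeff 2 (quotLine x ξ (S.erase i) m) *
          (esum x (S.erase i) m / esum x S (m + 1)) ^ 2) := by
  have h0 := h _ le_rfl
  have h1 := congrArg (coeff 2) (quotLine_average (ξ := ξ) h0)
  rw [natCast_add_two_eq_C, coeff_C_mul, map_sub, map_sum, map_sum] at h1
  rw [h1]
  simp only [coeff_two_line, Finset.sum_const_zero, zero_sub]
  congr 1
  refine Finset.sum_congr rfl fun i hi => ?_
  have hw := (h.erase hi) _ le_rfl
  have hy : 0 < coeff 0 (quotErase x ξ S m i) := by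
    rw [coeff_zero_quotErase]; positivity
  rw [coeff_two_sq_div (x := line x ξ i) (y := quotErase x ξ S m i) _ hy (coeff_two_line x ξ i),
    coeff_zero_line, coeff_one_line, coeff_zero_quotErase, logQuotErase, coeff_zero_quotErase,
    one_div_div]
  · have h2 : coeff 2 (quotErase x ξ S m i) = coeff 2 (quotLine x ξ (S.erase i) m) := by
      rw [quotErase_eq hi hw, map_add, coeff_two_line, zero_add]
    rw [h2]
    congr 1
    field_simp
  · unfold quotErase
    linear_combination (line x ξ i ^ 2) * (esum (line x ξ) (S.erase i) m *
      (esum (line x ξ) (S.erase i) m)⁻¹) * esum_line_mul_inv (ξ := ξ) h0 +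
      (line x ξ i ^ 2) * esum_line_mul_inv (ξ := ξ) hw

/-- The quotient `e_{m+1} / e_m` is concave on `Γ_m`. -/
theorem coeff_two_quotLine_nonpos {x ξ : ι → ℝ} {S : Finset ι} {m : ℕ} (h : IsGarding x S m) :
    coeff 2 (quotLine x ξ S m) ≤ 0 := by
  induction m generalizing S with
  | zero =>
    rw [quotLine, zero_add, esum_zero, coeff_two_mul, coeff_two_esum_line_one]
    simp [coeff_one]
  | succ m ih =>
    have h1 := coeff_two_quotLine_eq (ξ := ξ) h
    have h2 : 0 ≤ ∑ i ∈ S, ((esum x (S.erase i) m / esum x S (m + 1)) *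
        (ξ i - x i * logQuotErase x ξ S m i) ^ 2 -
        x i ^ 2 * coeff 2 (quotLine x ξ (S.erase i) m) *
          (esum x (S.erase i) m / esum x S (m + 1)) ^ 2) := by
      refine Finset.sum_nonneg fun i hi => ?_
      have hi' := h.erase hi
      have hw := hi' _ le_rfl
      have h0 := h _ le_rfl
      have := ih hi'
      have t1 : 0 ≤ x i ^ 2 * (-coeff 2 (quotLine x ξ (S.erase i) m)) *
          (esum x (S.erase i) m / esum x S (m + 1)) ^ 2 := by
        have : 0 ≤ -coeff 2 (quotLine x ξ (S.erase i) m) := by linarith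
        positivity
      have t2 : 0 ≤ (esum x (S.erase i) m / esum x S (m + 1)) *
        (ξ i - x i * logQuotErase x ξ S m i) ^ 2 := by positivity
      linarith
    have : (0 : ℝ) < m + 2 := by positivity
    nlinarith

/-- Only the contributions of the lower quotients are discarded. The squares that remain are the
defect D, later spent on compensating a degenerate leading weight. -/
theorem coeff_two_quotLine_le {x ξ : ι → ℝ} {S : Finset ι} {m : ℕ} (h : IsGarding x S (m + 1)) :
    (m + 2 : ℝ) * coeff 2 (quotLine x ξ S (m + 1)) ≤
      - ∑ i ∈ S, (esum x (S.erase i) m / esum x S (m + 1)) *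
        (ξ i - x i * logQuotErase x ξ S m i) ^ 2 := by
  rw [coeff_two_quotLine_eq h]
  refine neg_le_neg (Finset.sum_le_sum fun i hi => ?_)
  have := coeff_two_quotLine_nonpos (ξ := ξ) (h.erase hi)
  have t1 : 0 ≤ x i ^ 2 * (-coeff 2 (quotLine x ξ (S.erase i) m)) *
      (esum x (S.erase i) m / esum x S (m + 1)) ^ 2 := by
    have : 0 ≤ -coeff 2 (quotLine x ξ (S.erase i) m) := by linarith
    positivity
  linarith

/-- Concavity of `e_j ^ (1 / j)` on `Γ_j`, along a line. -/
theorem esum_line_garding {x ξ : ι → ℝ} {S : Finset ι} {j : ℕ} (h : IsGarding x S (j + 1)) :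
    2 * (j + 1 : ℝ) * (esum x S (j + 1) * coeff 2 (esum (line x ξ) S (j + 1))) ≤
      (j : ℝ) * coeff 1 (esum (line x ξ) S (j + 1)) ^ 2 := by
  induction j with
  | zero => simp [coeff_two_esum_line_one]
  | succ j ih =>
    have ih := ih (h.mono (Nat.le_succ _))
    have hp := h (j + 1) (by omega)
    have hp' := h (j + 1 + 1) le_rfl
    have hq := coeff_two_quotLine_nonpos (ξ := ξ) (h.mono (Nat.le_succ (j + 1)))
    have hf : quotLine x ξ S (j + 1) * esum (line x ξ) S (j + 1) =
        esum (line x ξ) S (j + 1 + 1) := by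
      rw [quotLine, mul_assoc, mul_comm _ (esum (line x ξ) S (j + 1)), esum_line_mul_inv hp,
        mul_one]
    rw [← hf, coeff_one_mul', coeff_two_mul]
    have h0 := congrArg (coeff 0) hf
    rw [coeff_zero_mul', coeff_zero_esum_line, coeff_zero_esum_line] at h0
    rw [← h0] at hp' ⊢
    simp only [coeff_zero_esum_line]
    set q0 := coeff 0 (quotLine x ξ S (j + 1))
    set q1 := coeff 1 (quotLine x ξ S (j + 1))
    set q2 := coeff 2 (quotLine x ξ S (j + 1))
    set g0 := esum x S (j + 1)
    set g1 := coeff 1 (esum (line x ξ) S (j + 1))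
    set g2 := coeff 2 (esum (line x ξ) S (j + 1))
    have hq0 : 0 < q0 := by
      by_contra hc
      push Not at hc
      nlinarith
    have hj : (0 : ℝ) ≤ j := Nat.cast_nonneg j
    push_cast
    have e1 : q0 * q2 * g0 ^ 2 ≤ 0 := by
      have := mul_nonneg hq0.le (sq_nonneg g0)
      nlinarith
    have e2 := mul_le_mul_of_nonneg_left ih (mul_nonneg (by positivity : (0:ℝ) ≤ (j + 2) / (j + 1))
      (sq_nonneg q0))
    have e3 : (j + 2) / (j + 1) * q0 ^ 2 * (2 * (j + 1 : ℝ) * (g0 * g2)) =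
        2 * (j + 2) * q0 ^ 2 * (g0 * g2) := by field_simp
    rw [e3] at e2
    -- With e_{j+2} = q g, concavity of q and the induction hypothesis for g leave exactly this
    -- square as the remaining gap.
    have e4 : (0 : ℝ) ≤ ((j + 1) * q1 * g0 - q0 * g1) ^ 2 / (j + 1) := by positivity
    have e5 : ((j + 1) * q1 * g0 - q0 * g1) ^ 2 / (j + 1) = (j + 1) * (q0 * g1 + q1 * g0) ^ 2 -
        2 * (j + 2) * (q0 * g0 * (q1 * g1)) - (j + 2) / (j + 1) * q0 ^ 2 * (j * g1 ^ 2) := by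
      field_simp
      ring
    nlinarith

end Jets

/-! ### Control of higher symmetric sums by the weights e_d(S \ i). -/

section Bounds

variable {ι : Type*}

theorem abs_esum_le {x : ι → ℝ} {S : Finset ι} {κ : ℝ} (hκ : 0 ≤ κ)
    (hx : ∀ i ∈ S, |x i| ≤ κ) (m : ℕ) : |esum x S m| ≤ 2 ^ S.card * κ ^ m := by
  unfold esum
  calc |∑ t ∈ S.powersetCard m, ∏ i ∈ t, x i| ≤ ∑ t ∈ S.powersetCard m, |∏ i ∈ t, x i| :=
        Finset.abs_sum_le_sum_abs _ _
    _ ≤ ∑ t ∈ S.powersetCard m, κ ^ m := by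
        refine Finset.sum_le_sum fun t ht => ?_
        obtain ⟨h1, h2⟩ := Finset.mem_powersetCard.1 ht
        rw [Finset.abs_prod, ← h2, ← Finset.prod_const]
        exact Finset.prod_le_prod (fun i _ => abs_nonneg _) fun i hi => hx i (h1 hi)
    _ = (S.card.choose m : ℝ) * κ ^ m := by simp
    _ ≤ 2 ^ S.card * κ ^ m := by
        refine mul_le_mul_of_nonneg_right ?_ (pow_nonneg hκ m)
        exact_mod_cast Nat.choose_le_two_pow S.card m

variable [DecidableEq ι]

theorem abs_sum_sum_erase_le {S : Finset ι} {u v w : ι → ℝ} {c : ι → ι → ℝ} {C : ℝ}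
    (hw : ∀ i ∈ S, 0 ≤ w i) (hC : 0 ≤ C)
    (hc : ∀ p ∈ S, ∀ q ∈ S.erase p, |c p q| ≤ C * (√(w p) * √(w q))) :
    |∑ p ∈ S, ∑ q ∈ S.erase p, u p * v q * c p q| ≤
      C * S.card * (√(∑ i ∈ S, w i * u i ^ 2) * √(∑ i ∈ S, w i * v i ^ 2)) := by
  have cs : ∀ u : ι → ℝ, ∑ p ∈ S, |u p| * √(w p) ≤ √S.card * √(∑ i ∈ S, w i * u i ^ 2) := by
    intro u
    rw [← Real.sqrt_mul (Nat.cast_nonneg _)]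
    refine Real.le_sqrt_of_sq_le ?_
    have := Finset.sum_mul_sq_le_sq_mul_sq S (fun _ => (1 : ℝ)) (fun p => |u p| * √(w p))
    simp only [one_mul, one_pow, Finset.sum_const, nsmul_eq_mul, mul_one] at this
    refine this.trans_eq ?_
    congr 1
    refine Finset.sum_congr rfl fun i hi => ?_
    rw [mul_pow, Real.sq_sqrt (hw i hi), sq_abs, mul_comm]
  calc |∑ p ∈ S, ∑ q ∈ S.erase p, u p * v q * c p q|
      ≤ ∑ p ∈ S, ∑ q ∈ S.erase p, |u p * v q * c p q| := by
        refine (Finset.abs_sum_le_sum_abs _ _).trans (Finset.sum_le_sum fun p _ => ?_)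
        exact Finset.abs_sum_le_sum_abs _ _
    _ ≤ ∑ p ∈ S, ∑ q ∈ S.erase p, C * ((|u p| * √(w p)) * (|v q| * √(w q))) := by
        refine Finset.sum_le_sum fun p hp => Finset.sum_le_sum fun q hq => ?_
        rw [abs_mul, abs_mul]
        calc |u p| * |v q| * |c p q| ≤ |u p| * |v q| * (C * (√(w p) * √(w q))) :=
              mul_le_mul_of_nonneg_left (hc p hp q hq) (by positivity)
          _ = _ := by ring
    _ ≤ ∑ p ∈ S, ∑ q ∈ S, C * ((|u p| * √(w p)) * (|v q| * √(w q))) := by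
        refine Finset.sum_le_sum fun p hp => ?_
        exact Finset.sum_le_sum_of_subset_of_nonneg (Finset.erase_subset _ _)
          fun q _ _ => by positivity
    _ = C * ((∑ p ∈ S, |u p| * √(w p)) * ∑ q ∈ S, |v q| * √(w q)) := by
        rw [Finset.sum_mul_sum, Finset.mul_sum]
        simp_rw [Finset.mul_sum]
    _ ≤ C * ((√S.card * √(∑ i ∈ S, w i * u i ^ 2)) * (√S.card * √(∑ i ∈ S, w i * v i ^ 2))) := by
        refine mul_le_mul_of_nonneg_left (mul_le_mul (cs u) (cs v) ?_ (by positivity)) hC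
        exact Finset.sum_nonneg fun i _ => by positivity
    _ = C * (√S.card * √S.card) * (√(∑ i ∈ S, w i * u i ^ 2) * √(∑ i ∈ S, w i * v i ^ 2)) := by
        ring
    _ = _ := by rw [Real.mul_self_sqrt (Nat.cast_nonneg _)]

/-- In e_{d+1}(S) = x_i e_d(S \ i) + e_{d+1}(S \ i), the last term matters only when positive. Then
S \ i lies in Γ_{d+1}, and Euler's identity bounds it by a multiple of κ e_d(S \ i). -/
theorem IsGarding.esum_le_weight {x : ι → ℝ} {S : Finset ι} {κ : ℝ} {d : ℕ}
    (h : IsGarding x S (d + 1)) (hκ : 0 ≤ κ) (hx : ∀ i ∈ S, |x i| ≤ κ) {i : ι} (hi : i ∈ S) :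
    esum x S (d + 1) ≤ (S.card + 1) * κ * esum x (S.erase i) d := by
  have hw := h.erase hi _ le_rfl
  have h1 : x i * esum x (S.erase i) d ≤ κ * esum x (S.erase i) d :=
    mul_le_mul_of_nonneg_right ((le_abs_self _).trans (hx i hi)) hw.le
  rw [esum_erase x hi]
  have hS : (0 : ℝ) ≤ S.card := Nat.cast_nonneg _
  have hk : 0 ≤ S.card * κ * esum x (S.erase i) d := by positivity
  rcases le_or_gt (esum x (S.erase i) (d + 1)) 0 with h2 | h2
  · nlinarith
  · have h3 := (h.erase hi).succ h2
    have h4 := sum_mul_esum_erase x (S.erase i) d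
    have h5 : ∑ p ∈ S.erase i, x p * esum x ((S.erase i).erase p) d ≤
        κ * ∑ p ∈ S.erase i, esum x ((S.erase i).erase p) d := by
      rw [Finset.mul_sum]
      refine Finset.sum_le_sum fun p hp => ?_
      exact mul_le_mul_of_nonneg_right
        ((le_abs_self _).trans (hx p (Finset.mem_of_mem_erase hp))) (h3.erase hp _ le_rfl).le
    rw [h4, sum_esum_erase] at h5
    have hc : ((S.erase i).card : ℝ) ≤ S.card := by
      exact_mod_cast Finset.card_le_card (Finset.erase_subset _ _)
    have hd : (0 : ℝ) ≤ d := Nat.cast_nonneg d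
    have h6 : κ * (((S.erase i).card - d) * esum x (S.erase i) d) ≤
        S.card * κ * esum x (S.erase i) d := by
      have : κ * (((S.erase i).card - d) * esum x (S.erase i) d) =
        ((S.erase i).card - d) * (κ * esum x (S.erase i) d) := by ring
      rw [this, mul_assoc]
      exact mul_le_mul_of_nonneg_right (by linarith) (by positivity)
    nlinarith

/-- With A, B, D the consecutive sums after erasing p and q, the product of the two weights is A
e(S) + B² - AD. The first term is positive, and Newton bounds AD by a fraction of B² below 1. -/
theorem IsGarding.sq_esum_erase_erase_le {x : ι → ℝ} {S : Finset ι} {d : ℕ}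
    (h : IsGarding x S (d + 1)) {p q : ι} (hp : p ∈ S) (hq : q ∈ S.erase p) :
    esum x ((S.erase p).erase q) d ^ 2 ≤
      (d + 1) * (esum x (S.erase p) d * esum x (S.erase q) d) := by
  cases d with
  | zero => simp
  | succ d =>
    have hqS := Finset.mem_of_mem_erase hq
    have hpq : p ∈ S.erase q := by
      rw [Finset.mem_erase] at hq ⊢
      exact ⟨fun h => hq.1 h.symm, hp⟩
    have hA := (h.erase hp).erase hq _ le_rfl
    have hN := esum_newton x ((S.erase p).erase q) d
    have hs := h _ le_rfl
    rw [esum_erase x hp, esum_erase x hq, esum_erase x hq] at hs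
    rw [esum_erase x hq, esum_erase x hpq,
      Finset.erase_right_comm (a := q) (b := p)]
    rw [show d + 1 + 1 = d + 2 by ring] at hs
    set A := esum x ((S.erase p).erase q) d
    set B := esum x ((S.erase p).erase q) (d + 1)
    set D := esum x ((S.erase p).erase q) (d + 2)
    have hd : (0 : ℝ) ≤ d := Nat.cast_nonneg d
    push_cast
    have h1 := mul_pos hA hs
    have : (d + 2 : ℝ) * ((x q * A + B) * (x p * A + B)) =
      (d + 2) * (A * (x p * (x q * A + B) + (x q * B + D))) + (d + 2) * B ^ 2 -
        (d + 2) * (A * D) := by ring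
    nlinarith [mul_pos (by linarith : (0 : ℝ) < d + 2) h1]

theorem IsGarding.sum_sq_mul_weight_le {x : ι → ℝ} {S : Finset ι} {κ : ℝ} {d : ℕ}
    (h : IsGarding x S (d + 2)) (hx : ∀ i ∈ S, |x i| ≤ κ) {i : ι} (hi : i ∈ S) :
    ∑ p ∈ S.erase i, esum x ((S.erase i).erase p) d * x p ^ 2 ≤
      (S.card + d + 2) * κ * esum x (S.erase i) (d + 1) := by
  have hw := h.erase hi _ le_rfl
  have hs := h _ le_rfl
  have h1 := sum_sq_mul_esum_erase x (S.erase i) d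
  have hκ : 0 ≤ κ := (abs_nonneg _).trans (hx i hi)
  simp_rw [mul_comm (esum x _ d)]
  rw [h1]
  rw [esum_erase x hi] at hs
  have h2 : esum x (S.erase i) 1 ≤ S.card * κ := by
    rw [esum_one]
    calc ∑ p ∈ S.erase i, x p ≤ ∑ p ∈ S.erase i, κ := Finset.sum_le_sum fun p hp =>
          (le_abs_self _).trans (hx p (Finset.mem_of_mem_erase hp))
      _ = (S.erase i).card * κ := by simp
      _ ≤ S.card * κ := by
        refine mul_le_mul_of_nonneg_right ?_ hκ
        exact_mod_cast Finset.card_le_card (Finset.erase_subset _ _)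
  have h3 : x i * esum x (S.erase i) (d + 1) ≤ κ * esum x (S.erase i) (d + 1) :=
    mul_le_mul_of_nonneg_right ((le_abs_self _).trans (hx i hi)) hw.le
  have hd : (0 : ℝ) ≤ d := Nat.cast_nonneg d
  have h4 := mul_le_mul_of_nonneg_right h2 hw.le
  rw [show d + 1 + 1 = d + 2 by ring] at hs
  have h5 : (d + 2 : ℝ) * (-esum x (S.erase i) (d + 2)) ≤
      (d + 2) * (κ * esum x (S.erase i) (d + 1)) :=
    mul_le_mul_of_nonneg_left (by linarith) (by linarith)
  linarith

/-- The recursion in x_q transfers a bound from one erased index to two, by induction on r. The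
result holds for p and for q, so it may be used at the smaller weight, which is at most the
geometric mean of the two. -/
theorem abs_esum_erase_erase_of_erase {x : ι → ℝ} {S : Finset ι} {κ C : ℝ} {d N : ℕ}
    (hκ : 0 ≤ κ) (hC : 1 ≤ C) (h : IsGarding x S (d + 1)) (hx : ∀ i ∈ S, |x i| ≤ κ)
    (hA : ∀ r ≤ N, ∀ i ∈ S, |esum x (S.erase i) (d + r)| ≤ C * κ ^ r * esum x (S.erase i) d)
    (r : ℕ) (hr : r ≤ N) {p q : ι} (hp : p ∈ S) (hq : q ∈ S.erase p) :
    |esum x ((S.erase p).erase q) (d + r)| ≤ (C * (r + 1)) * (d + 2) * κ ^ r *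
      (√(esum x (S.erase p) d) * √(esum x (S.erase q) d)) := by
  have hqS := Finset.mem_of_mem_erase hq
  have hpq : p ∈ S.erase q := by
    rw [Finset.mem_erase] at hq ⊢
    exact ⟨fun h => hq.1 h.symm, hp⟩
  have key : ∀ r ≤ N, ∀ p ∈ S, ∀ q ∈ S.erase p, |esum x ((S.erase p).erase q) (d + r)| ≤
      C * (r + 1) * κ ^ r * (esum x (S.erase p) d + |esum x ((S.erase p).erase q) d|) := by
    intro r hr p hp q hq
    have hw := h.erase hp _ le_rfl
    induction r with
    | zero =>
      simp only [add_zero, Nat.cast_zero, zero_add, mul_one, pow_zero]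
      nlinarith [abs_nonneg (esum x ((S.erase p).erase q) d)]
    | succ r ih =>
      have ih := ih (by omega)
      have h1 := hA (r + 1) hr p hp
      rw [← add_assoc, esum_erase x hq] at h1
      have h2 : |x q * esum x ((S.erase p).erase q) (d + r)| ≤ κ * (C * (r + 1) * κ ^ r *
          (esum x (S.erase p) d + |esum x ((S.erase p).erase q) d|)) := by
        rw [abs_mul]
        exact mul_le_mul (hx q (Finset.mem_of_mem_erase hq)) ih (abs_nonneg _) hκ
      have h3 : |esum x ((S.erase p).erase q) (d + r + 1)| ≤
          |x q * esum x ((S.erase p).erase q) (d + r) +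
            esum x ((S.erase p).erase q) (d + r + 1)| +
          |x q * esum x ((S.erase p).erase q) (d + r)| := by
        have := abs_sub (x q * esum x ((S.erase p).erase q) (d + r) +
            esum x ((S.erase p).erase q) (d + r + 1)) (x q * esum x ((S.erase p).erase q) (d + r))
        simpa using this
      rw [← add_assoc]
      push_cast
      have h4 : 0 ≤ C * κ ^ (r + 1) * |esum x ((S.erase p).erase q) d| := by positivity
      rw [pow_succ] at *
      nlinarith
  have hwp := h.erase hp _ le_rfl
  have hwq := h.erase hqS _ le_rfl
  have h1 := key r hr p hp q hq
  have h2 := key r hr q hqS p hpq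
  rw [Finset.erase_right_comm (a := q)] at h2
  have h3 := h.sq_esum_erase_erase_le hp hq
  set W := √(esum x (S.erase p) d) * √(esum x (S.erase q) d)
  have hW : 0 ≤ W := by positivity
  have hd : (0 : ℝ) ≤ d := Nat.cast_nonneg d
  have hW2 : W ^ 2 = esum x (S.erase p) d * esum x (S.erase q) d := by
    simp only [W]
    rw [mul_pow, Real.sq_sqrt hwp.le, Real.sq_sqrt hwq.le]
  have hb : |esum x ((S.erase p).erase q) d| ≤ (d + 1) * W := by
    refine abs_le_of_sq_le_sq ?_ (by positivity)
    rw [mul_pow, hW2]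
    nlinarith [mul_pos hwp hwq]
  have hCr : 0 ≤ C * (r + 1) * κ ^ r := by positivity
  rcases le_total (esum x (S.erase p) d) (esum x (S.erase q) d) with hle | hle
  · have hm : esum x (S.erase p) d ≤ W := abs_le_of_sq_le_sq' (by nlinarith) hW |>.2
    calc _ ≤ _ := h1
      _ ≤ C * (r + 1) * κ ^ r * ((d + 2) * W) := mul_le_mul_of_nonneg_left (by linarith) hCr
      _ = _ := by ring
  · have hm : esum x (S.erase q) d ≤ W := abs_le_of_sq_le_sq' (by nlinarith) hW |>.2
    calc _ ≤ _ := h2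
      _ ≤ C * (r + 1) * κ ^ r * ((d + 2) * W) := mul_le_mul_of_nonneg_left (by linarith) hCr
      _ = _ := by ring

variable (ι) in
/-- On `Γ_{d+1}`, the higher elementary symmetric functions of the remaining variables are
controlled by the weights `e_d(S \ i)`. -/
theorem exists_weight_bound (d N : ℕ) : ∃ C : ℝ, 1 ≤ C ∧ ∀ (x : ι → ℝ) (S : Finset ι) (κ : ℝ),
    S.card ≤ N → 0 ≤ κ → (∀ i ∈ S, |x i| ≤ κ) → IsGarding x S (d + 1) → ∀ r ≤ N,
      (∀ i ∈ S, |esum x (S.erase i) (d + r)| ≤ C * κ ^ r * esum x (S.erase i) d) ∧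
      (∀ p ∈ S, ∀ q ∈ S.erase p, |esum x ((S.erase p).erase q) (d + r)| ≤
        C * κ ^ r * (√(esum x (S.erase p) d) * √(esum x (S.erase q) d))) := by
  suffices hA : ∃ C : ℝ, 1 ≤ C ∧ ∀ (x : ι → ℝ) (S : Finset ι) (κ : ℝ),
      S.card ≤ N → 0 ≤ κ → (∀ i ∈ S, |x i| ≤ κ) → IsGarding x S (d + 1) → ∀ r ≤ N,
      ∀ i ∈ S, |esum x (S.erase i) (d + r)| ≤ C * κ ^ r * esum x (S.erase i) d by
    obtain ⟨C, hC, hA⟩ := hA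
    refine ⟨C * (N + 1) * (d + 2), ?_, fun x S κ hS hκ hx h r hr => ⟨fun i hi => ?_,
      fun p hp q hq => ?_⟩⟩
    · have hN : (0 : ℝ) ≤ N := Nat.cast_nonneg N
      have hd : (0 : ℝ) ≤ d := Nat.cast_nonneg d
      have : 1 ≤ C * (N + 1) := by nlinarith
      nlinarith
    · refine (hA x S κ hS hκ hx h r hr i hi).trans ?_
      have hw := h.erase hi _ le_rfl
      refine mul_le_mul_of_nonneg_right (mul_le_mul_of_nonneg_right ?_ (by positivity)) hw.le
      have hN : (0 : ℝ) ≤ N := Nat.cast_nonneg N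
      have hd : (0 : ℝ) ≤ d := Nat.cast_nonneg d
      have : C ≤ C * (N + 1) := by nlinarith
      nlinarith
    · refine (abs_esum_erase_erase_of_erase hκ hC h hx (fun r hr => hA x S κ hS hκ hx h r hr)
        r hr hp hq).trans ?_
      refine mul_le_mul_of_nonneg_right (mul_le_mul_of_nonneg_right ?_ (by positivity))
        (by positivity)
      have hr' : (r : ℝ) ≤ N := by exact_mod_cast hr
      have hd : (0 : ℝ) ≤ d := Nat.cast_nonneg d
      have hC0 : 0 ≤ C := by linarith
      gcongr
  induction d with
  | zero =>
    refine ⟨2 ^ N, one_le_pow₀ (by norm_num), fun x S κ hS hκ hx h r hr i hi => ?_⟩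
    rw [zero_add, esum_zero, mul_one]
    refine (abs_esum_le hκ (fun p hp => hx p (Finset.mem_of_mem_erase hp)) r).trans ?_
    refine mul_le_mul_of_nonneg_right ?_ (by positivity)
    refine pow_le_pow_right₀ (by norm_num) ?_
    exact (Finset.card_le_card (Finset.erase_subset _ _)).trans hS
  | succ d ih =>
    obtain ⟨C, hC, hA⟩ := ih
    refine ⟨C * (N + 1) * (d + 2) * N * (N + d + 2) + 1, ?_, fun x S κ hS hκ hx h r hr i hi => ?_⟩
    · have hC0 : 0 ≤ C := by linarith
      have : 0 ≤ C * (N + 1) * (d + 2) * N * (N + d + 2) := by positivity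
      linarith
    · have hC0 : 0 ≤ C := by linarith
      have hw := h.erase hi _ le_rfl
      cases r with
      | zero =>
        have h0 : 0 ≤ C * (N + 1) * (d + 2) * N * (N + d + 2) := by positivity
        rw [add_zero, pow_zero, mul_one, abs_of_pos hw]
        nlinarith
      | succ r =>
        have hS' : (S.erase i).card ≤ N := (Finset.card_le_card (Finset.erase_subset _ _)).trans hS
        have hx' : ∀ p ∈ S.erase i, |x p| ≤ κ := fun p hp => hx p (Finset.mem_of_mem_erase hp)
        have h' := h.erase hi
        have hB : ∀ p ∈ S.erase i, ∀ q ∈ (S.erase i).erase p,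
            |esum x (((S.erase i).erase p).erase q) (d + r)| ≤ C * (N + 1) * (d + 2) * κ ^ r *
            (√(esum x ((S.erase i).erase p) d) * √(esum x ((S.erase i).erase q) d)) := by
          intro p hp q hq
          refine (abs_esum_erase_erase_of_erase hκ hC h' hx'
            (fun r hr => hA x _ κ hS' hκ hx' h' r hr) r (by omega) hp hq).trans ?_
          refine mul_le_mul_of_nonneg_right (mul_le_mul_of_nonneg_right ?_ (by positivity))
            (by positivity)
          have hr' : (r : ℝ) ≤ N := by exact_mod_cast (by omega : r ≤ N)
          gcongr
        -- Up to a factor at least 1, e_{d+r+2}(S \ i) is a double sum over pairs. The twice-erased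
        -- bound of degree d applies to S \ i, Cauchy–Schwarz reduces to the second moment, and that
        -- moment supplies the missing power of κ.
        have h1 := sum_sum_mul_esum_erase x (S.erase i) (d + r)
        have h2 := abs_sum_sum_erase_le (S := S.erase i) (u := x) (v := x)
          (fun p hp => (h'.erase hp _ le_rfl).le) (by positivity) hB
        rw [h1] at h2
        have h3 := h.sum_sq_mul_weight_le hx hi
        have h4 : 0 ≤ ∑ p ∈ S.erase i, esum x ((S.erase i).erase p) d * x p ^ 2 :=
          Finset.sum_nonneg fun p hp => mul_nonneg (h'.erase hp _ le_rfl).le (sq_nonneg _)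
        rw [Real.mul_self_sqrt h4, abs_mul] at h2
        have h5 : |esum x (S.erase i) (d + r + 2)| ≤
            |((d + r : ℕ) + 2 : ℝ) * ((d + r : ℕ) + 1)| * |esum x (S.erase i) (d + r + 2)| := by
          refine le_mul_of_one_le_left (abs_nonneg _) ?_
          rw [abs_of_nonneg (by positivity)]
          have : (0 : ℝ) ≤ (d + r : ℕ) := Nat.cast_nonneg _
          nlinarith
        rw [show d + 1 + (r + 1) = d + r + 2 by ring]
        have hSc : (S.card : ℝ) ≤ N := by exact_mod_cast hS
        have hSc' : ((S.erase i).card : ℝ) ≤ N := by exact_mod_cast hS'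
        have h6 : ∑ p ∈ S.erase i, esum x ((S.erase i).erase p) d * x p ^ 2 ≤
            (N + d + 2) * κ * esum x (S.erase i) (d + 1) := by
          refine h3.trans ?_
          gcongr
        calc _ ≤ _ := h5
          _ ≤ _ := h2
          _ ≤ C * (N + 1) * (d + 2) * κ ^ r * N *
              ((N + d + 2) * κ * esum x (S.erase i) (d + 1)) := by
            gcongr
          _ = C * (N + 1) * (d + 2) * N * (N + d + 2) * κ ^ (r + 1) *
              esum x (S.erase i) (d + 1) := by ring
          _ ≤ _ := by
            have : 0 ≤ κ ^ (r + 1) * esum x (S.erase i) (d + 1) := by positivity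
            nlinarith

/-- Bounds for the higher elementary symmetric functions along a line. -/
theorem abs_coeff_esum_line_le {x ξ : ι → ℝ} {S : Finset ι} {d r : ℕ} {B : ℝ}
    (h : IsGarding x S (d + 1)) (hB : 0 ≤ B)
    (hb : ∀ p ∈ S, ∀ q ∈ S.erase p, |esum x ((S.erase p).erase q) (d + r)| ≤
        B * (√(esum x (S.erase p) d) * √(esum x (S.erase q) d))) :
    |esum x S (d + r + 2)| ≤ B * S.card * ∑ i ∈ S, esum x (S.erase i) d * x i ^ 2 ∧
    |PowerSeries.coeff 1 (esum (line x ξ) S (d + r + 2))| ≤ B * S.card *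
      (√(∑ i ∈ S, esum x (S.erase i) d * x i ^ 2) *
        √(∑ i ∈ S, esum x (S.erase i) d * ξ i ^ 2)) ∧
    |PowerSeries.coeff 2 (esum (line x ξ) S (d + r + 2))| ≤
      B * S.card * ∑ i ∈ S, esum x (S.erase i) d * ξ i ^ 2 := by
  have hw : ∀ i ∈ S, 0 ≤ esum x (S.erase i) d := fun i hi => (h.erase hi _ le_rfl).le
  have hV : 0 ≤ ∑ i ∈ S, esum x (S.erase i) d * x i ^ 2 :=
    Finset.sum_nonneg fun i hi => mul_nonneg (hw i hi) (sq_nonneg _)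
  have hN : 0 ≤ ∑ i ∈ S, esum x (S.erase i) d * ξ i ^ 2 :=
    Finset.sum_nonneg fun i hi => mul_nonneg (hw i hi) (sq_nonneg _)
  have hm : (0 : ℝ) ≤ (d + r : ℕ) := Nat.cast_nonneg _
  refine ⟨?_, ?_, ?_⟩
  · have h2 := abs_sum_sum_erase_le (u := x) (v := x) hw hB hb
    rw [sum_sum_mul_esum_erase, Real.mul_self_sqrt hV, abs_mul] at h2
    refine le_trans (le_mul_of_one_le_left (abs_nonneg _) ?_) h2
    rw [abs_of_nonneg (by positivity)]
    nlinarith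
  · have h2 := abs_sum_sum_erase_le (u := ξ) (v := x) hw hB hb
    have h3 : ∑ p ∈ S, ∑ q ∈ S.erase p, ξ p * x q * esum x ((S.erase p).erase q) (d + r) =
        ((d + r : ℕ) + 1 : ℝ) * PowerSeries.coeff 1 (esum (line x ξ) S (d + r + 2)) := by
      rw [show d + r + 2 = (d + r + 1) + 1 by ring, coeff_one_esum_line, Finset.mul_sum]
      refine Finset.sum_congr rfl fun p _ => ?_
      simp_rw [mul_assoc]
      rw [← Finset.mul_sum, sum_mul_esum_erase]
      ring
    rw [h3, abs_mul, mul_comm (√_)] at h2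
    refine le_trans (le_mul_of_one_le_left (abs_nonneg _) ?_) h2
    rw [abs_of_nonneg (by positivity)]
    linarith
  · have h2 := abs_sum_sum_erase_le (u := ξ) (v := ξ) hw hB hb
    rw [← coeff_two_esum_line, Real.mul_self_sqrt hN, abs_mul] at h2
    refine le_trans (le_mul_of_one_le_left (abs_nonneg _) ?_) h2
    norm_num

end Bounds

/-! ### The limiting quadratic inequality. -/

section Quadratic

/-- Cauchy–Schwarz with one further term b of weight j adjoined. -/
theorem sq_add_le_of_sq_le {s b F G j : ℝ} (hF : 0 ≤ F) (hG : 0 ≤ G) (hj : 0 < j)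
    (h : s ^ 2 ≤ F * G) : (s + b) ^ 2 ≤ (F + j) * (G + b ^ 2 / j) := by
  have h1 : 2 * (s * b) ≤ j * G + F * (b ^ 2 / j) := by
    have h2 : |2 * (s * b)| ≤ j * G + F * (b ^ 2 / j) := by
      refine abs_le_of_sq_le_sq ?_ (by positivity)
      have e : (j * G + F * (b ^ 2 / j)) ^ 2 =
          (j * G - F * (b ^ 2 / j)) ^ 2 + 4 * ((F * G) * b ^ 2) := by
        field_simp; ring
      rw [e]
      nlinarith [sq_nonneg (j * G - F * (b ^ 2 / j)), mul_le_mul_of_nonneg_right h (sq_nonneg b)]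
    exact (le_abs_self _).trans h2
  have e : (F + j) * (G + b ^ 2 / j) = F * G + F * (b ^ 2 / j) + j * G + b ^ 2 := by
    field_simp
    ring
  rw [e]
  nlinarith

theorem quadratic_aux {p a m q A : ℝ} (hp : 0 ≤ p) (hp' : p ≤ 1) (hm : 0 ≤ m)
    (hq : q ^ 2 ≤ (1 - p) * m) (hA : p * A * p ≤ p * m) :
    p * a ^ 2 * (9 / 8) + p ^ 2 / 4 * A ≤ 2 * (p * a ^ 2 + m) -
      2 * (p * a + q) * q - a ^ 2 * (51 / 100 * p ^ 2 + 27 / 100 * p) := by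
  have h2 : (a * q) ^ 2 ≤ a ^ 2 * ((1 - p) * m) := by
    rw [mul_pow]; exact mul_le_mul_of_nonneg_left hq (sq_nonneg _)
  -- The weight 7/4 leaves exactly pm/4 of the available 2pm, which pays for the slack p²A/4, while
  -- the coefficient of a² stays positive.
  have h3 : 2 * (a * q) ≤ 7 / 4 * m + 4 / 7 * ((1 - p) * a ^ 2) := by
    refine (le_abs_self _).trans (abs_le_of_sq_le_sq ?_ ?_)
    · linarith [sq_nonneg (7 / 4 * m - 4 / 7 * ((1 - p) * a ^ 2))]
    · have : 0 ≤ (1 - p) * a ^ 2 := mul_nonneg (by linarith) (sq_nonneg _)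
      linarith
  have h4 := mul_le_mul_of_nonneg_left h3 hp
  have h5 := mul_nonneg hp (sq_nonneg a)
  have h6 := mul_nonneg (mul_nonneg hp hp) (sq_nonneg a)
  linarith

variable {ι : Type*}

/-- The coefficients of g and of β are estimated separately. The g part is the Cauchy–Schwarz gain;
the β part survives the loss 51/100 p1² + 27/100 p1 caused by completing squares in the small
variables. Here `L` omits the distinguished index, and p1 is the smallest weight because that entry
is the largest. -/
theorem main_quadratic (L : Finset ι) (a p : ι → ℝ) {a1 p1 b g β j k : ℝ} (hj : 1 ≤ j)
    (hk : k = L.card + 1 + j) (hp1 : 0 < p1) (hp : ∀ i ∈ L, p1 ≤ p i)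
    (hsum : p1 + ∑ i ∈ L, p i = 1) (hg : 0 ≤ g) (hβ : 0 ≤ β) :
    g * (a1 ^ 2 * (1 + 1 / (k + 1))) + β * (p1 * a1 ^ 2 * (9 / 8)) +
        p1 ^ 2 / 4 * (g + β) * ∑ i ∈ L, a i ^ 2 ≤
      g * (1 / 2 * (a1 + (∑ i ∈ L, (1 - p i) * a i + b)) ^ 2 + b ^ 2 / j + a1 ^ 2 +
          ∑ i ∈ L, a i ^ 2 - (∑ i ∈ L, p i * a i) ^ 2) +
        β * (2 * (p1 * a1 ^ 2 + ∑ i ∈ L, p i * a i ^ 2) -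
          2 * (p1 * a1 + ∑ i ∈ L, p i * a i) * ∑ i ∈ L, p i * a i -
          a1 ^ 2 * (51 / 100 * p1 ^ 2 + 27 / 100 * p1)) := by
  have hp0 : ∀ i ∈ L, 0 ≤ p i := fun i hi => hp1.le.trans (hp i hi)
  have hple : ∀ i ∈ L, p i ≤ 1 := fun i hi => by
    have := Finset.single_le_sum hp0 hi
    linarith
  have hp1' : p1 ≤ 1 := by
    have := Finset.sum_nonneg hp0
    linarith
  have hq : (∑ i ∈ L, p i * a i) ^ 2 ≤ (1 - p1) * ∑ i ∈ L, p i * a i ^ 2 := by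
    have := Finset.sum_sq_le_sum_mul_sum_of_sq_le_mul L (r := fun i => p i * a i) (f := p)
      (g := fun i => p i * a i ^ 2) hp0 (fun i hi => mul_nonneg (hp0 i hi) (sq_nonneg _))
      (fun i _ => le_of_eq (by ring))
    rwa [show ∑ i ∈ L, p i = 1 - p1 by linarith] at this
  have hs1 : (∑ i ∈ L, (1 - p i) * a i) ^ 2 ≤
      (∑ i ∈ L, (1 - p i)) * ∑ i ∈ L, (1 - p i) * a i ^ 2 :=
    Finset.sum_sq_le_sum_mul_sum_of_sq_le_mul L (fun i hi => by linarith [hple i hi])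
      (fun i hi => mul_nonneg (by linarith [hple i hi]) (sq_nonneg _))
      (fun i _ => le_of_eq (by ring))
  have hF0 : 0 ≤ ∑ i ∈ L, (1 - p i) := Finset.sum_nonneg fun i hi => by linarith [hple i hi]
  have hG0 : 0 ≤ ∑ i ∈ L, (1 - p i) * a i ^ 2 :=
    Finset.sum_nonneg fun i hi => mul_nonneg (by linarith [hple i hi]) (sq_nonneg _)
  have hY := sq_add_le_of_sq_le (b := b) hF0 hG0 (by linarith : 0 < j) hs1
  have hFj : ∑ i ∈ L, (1 - p i) + j ≤ k - 1 := by
    rw [Finset.sum_sub_distrib]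
    simp
    linarith
  have hGe : ∑ i ∈ L, (1 - p i) * a i ^ 2 = ∑ i ∈ L, a i ^ 2 - ∑ i ∈ L, p i * a i ^ 2 := by
    rw [← Finset.sum_sub_distrib]
    exact Finset.sum_congr rfl fun i _ => by ring
  have hpa : p1 * ∑ i ∈ L, a i ^ 2 ≤ ∑ i ∈ L, p i * a i ^ 2 := by
    rw [Finset.mul_sum]
    exact Finset.sum_le_sum fun i hi => mul_le_mul_of_nonneg_right (hp i hi) (sq_nonneg _)
  have hA0 : 0 ≤ ∑ i ∈ L, a i ^ 2 := Finset.sum_nonneg fun i _ => sq_nonneg _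
  rw [hGe] at hY hG0
  set Y := ∑ i ∈ L, (1 - p i) * a i + b
  set q := ∑ i ∈ L, p i * a i
  set A := ∑ i ∈ L, a i ^ 2
  set m := ∑ i ∈ L, p i * a i ^ 2
  have hbj : 0 ≤ b ^ 2 / j := by positivity
  have hY' : Y ^ 2 ≤ (k - 1) * (A - m + b ^ 2 / j) :=
    hY.trans (mul_le_mul_of_nonneg_right hFj (by linarith))
  have hk2 : 0 < k - 1 := by
    have : (0 : ℝ) ≤ L.card := Nat.cast_nonneg _
    linarith
  have hk1 : 0 < k + 1 := by linarith
  have hY'' : Y ^ 2 / (k - 1) ≤ A - m + b ^ 2 / j := by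
    rw [div_le_iff₀ hk2]; linarith
  -- The minimum over Y is a1²/(2 + (k - 1)). Only half of the square is used; the other half is
  -- kept for the cross term with τ.
  have hsq : a1 ^ 2 / (k + 1) ≤ 1 / 2 * (a1 + Y) ^ 2 + Y ^ 2 / (k - 1) := by
    have e : 1 / 2 * (a1 + Y) ^ 2 + Y ^ 2 / (k - 1) - a1 ^ 2 / (k + 1) =
        ((k - 1) * (a1 + Y) + 2 * Y) ^ 2 / (2 * (k - 1) * (k + 1)) := by
      field_simp
      ring
    have : 0 ≤ ((k - 1) * (a1 + Y) + 2 * Y) ^ 2 / (2 * (k - 1) * (k + 1)) := by positivity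
    linarith
  have hm : p1 * A * p1 ≤ p1 * m := by nlinarith
  have part1 : a1 ^ 2 * (1 + 1 / (k + 1)) + p1 ^ 2 / 4 * A ≤
      1 / 2 * (a1 + Y) ^ 2 + b ^ 2 / j + a1 ^ 2 + A - q ^ 2 := by
    have e : a1 ^ 2 * (1 + 1 / (k + 1)) = a1 ^ 2 + a1 ^ 2 / (k + 1) := by ring
    rw [e]
    nlinarith [mul_nonneg (sq_nonneg p1) hA0]
  have part2 : p1 * a1 ^ 2 * (9 / 8) + p1 ^ 2 / 4 * A ≤ 2 * (p1 * a1 ^ 2 + m) -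
      2 * (p1 * a1 + q) * q - a1 ^ 2 * (51 / 100 * p1 ^ 2 + 27 / 100 * p1) := by
    have hm0 : 0 ≤ m := by nlinarith
    exact quadratic_aux hp1.le hp1' hm0 hq hm
  have t1 := mul_le_mul_of_nonneg_left part1 hg
  have t2 := mul_le_mul_of_nonneg_left part2 hβ
  linarith

end Quadratic

/-! ### Scalar form of the inequality: reduction, error terms, slack. -/

section ScalarCore

/-- Completing the squares in the small variables. -/
theorem scalar_reduction {a1 p1 abar m2 A2 α b g0 g1 g2 τ ν ω K E H H1 H2 ζ1 ζ2 π2 r0 r1 r2 n v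
    Sη Wη Wd D iJ ij cd cv1 cv2 : ℝ} (hE : E * p1 = 1) (hν : 0 ≤ 1 - ν)
    (hg0 : g0 = 1 + E * H + r0) (hg1 : g1 = b + E * ζ1 - E * abar * H + r1)
    (hg2 : g2 = π2 + E * ζ2 - E * abar * ζ1 + E * m2 * H + r2)
    (hζ1 : ζ1 = H1 + H * b) (hζ2 : ζ2 = H2 + H1 * b + H * π2) (hτ : τ = g1 + α * g0)
    (hγ : 0 ≤ 1 + (1 - ν) * (E * H)) (hC1 : 2 * π2 ≤ (1 - ij) * b ^ 2)
    (hH2 : H2 ≤ -(iJ * D)) (hH1 : H1 = iJ * (Sη - Wη - Wd)) (hE0 : 0 ≤ E)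
    (hcd : cd = 2 * (1 - ν) * E * iJ)
    (h3 : 0 ≤ cd * D - 2 * (a1 * iJ) * Wd + a1 ^ 2 * cv1 * v)
    (h4 : 0 ≤ 19 / 10 * n - 2 * (a1 * iJ) * Wη + a1 ^ 2 * cv2 * v) :
    (g0 * ((α + b) ^ 2 + ij * b ^ 2 + A2 - 2 * (α + b) * (abar - p1 * a1)) +
        (-(E * H)) * (2 * m2 - 2 * abar * (abar - p1 * a1)) +
        2 * τ * (abar - p1 * a1 - (α + b)) + K * (τ ^ 2 / g0)) +
      (-(ν * (-(E * H)) - r0) * (1 - ij) * b ^ 2 +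
        2 * (b * r0 - r1) * (abar - p1 * a1 - b) +
        2 * ν * (τ - (α + b) * g0 + b * r0 + abar * (E * H) - r1) * b +
        2 * a1 * iJ * Sη - 2 * ν * (E * ζ2) - 2 * r2 + (1 / 10 - ω) * n -
        a1 ^ 2 * (cv1 + cv2) * v) ≤
      -2 * g2 - 2 * α * g1 - (α ^ 2 - A2) * g0 + K * (τ ^ 2 / g0) + (2 - ω) * n := by
  have t1 : 0 ≤ (1 + (1 - ν) * (E * H)) * ((1 - ij) * b ^ 2 - 2 * π2) :=
    mul_nonneg hγ (by linarith)
  have t2 : 0 ≤ 2 * (1 - ν) * E * (-(iJ * D) - H2) :=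
    mul_nonneg (by positivity) (by linarith)
  -- The gap is an exact sum of four nonnegative terms: the concavity defects of e_j^(1/j) and of
  -- the quotient, and two completed squares.
  have key : -2 * g2 - 2 * α * g1 - (α ^ 2 - A2) * g0 + K * (τ ^ 2 / g0) + (2 - ω) * n -
      ((g0 * ((α + b) ^ 2 + ij * b ^ 2 + A2 - 2 * (α + b) * (abar - p1 * a1)) +
        (-(E * H)) * (2 * m2 - 2 * abar * (abar - p1 * a1)) +
        2 * τ * (abar - p1 * a1 - (α + b)) + K * (τ ^ 2 / g0)) +
      (-(ν * (-(E * H)) - r0) * (1 - ij) * b ^ 2 +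
        2 * (b * r0 - r1) * (abar - p1 * a1 - b) +
        2 * ν * (τ - (α + b) * g0 + b * r0 + abar * (E * H) - r1) * b +
        2 * a1 * iJ * Sη - 2 * ν * (E * ζ2) - 2 * r2 + (1 / 10 - ω) * n -
        a1 ^ 2 * (cv1 + cv2) * v)) =
      (1 + (1 - ν) * (E * H)) * ((1 - ij) * b ^ 2 - 2 * π2) +
      2 * (1 - ν) * E * (-(iJ * D) - H2) +
      (cd * D - 2 * (a1 * iJ) * Wd + a1 ^ 2 * cv1 * v) +
      (19 / 10 * n - 2 * (a1 * iJ) * Wη + a1 ^ 2 * cv2 * v) := by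
    generalize τ ^ 2 / g0 = Q
    subst hτ hcd hH1 hζ2 hζ1 hg2 hg1 hg0
    linear_combination (2 * a1 * (iJ * (Sη - Wη - Wd))) * hE
  linarith

theorem sq_add_five_le (a b c d e : ℝ) :
    (a - b + c + d - e) ^ 2 ≤ 5 * (a ^ 2 + b ^ 2 + c ^ 2 + d ^ 2 + e ^ 2) := by
  nlinarith [sq_nonneg (a + b), sq_nonneg (a - c), sq_nonneg (a - d), sq_nonneg (a + e),
    sq_nonneg (b + c), sq_nonneg (b + d), sq_nonneg (b - e), sq_nonneg (c - d), sq_nonneg (c + e),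
    sq_nonneg (d + e)]

/-- Ω controls α + b only with weight g0. If g0 is not small this bounds b directly; if g0 < 1/4
then EH ≤ -1/2, and b is recovered from EHb = Eζ1 - h. -/
theorem scalar_direction_bound {α b g0 τ E H ζ1 abar q A2 n r0 r1 ω Bd h Ω : ℝ}
    (hg0 : 0 < g0) (hg0e : g0 = 1 + E * H + r0) (hEH : E * H ≤ 1 / 10) (hBd : 1 ≤ Bd)
    (hE0 : 0 ≤ E) (hE : E ≤ Bd)
    (hω : ω ^ 2 * Bd ^ 3 ≤ 1 / 1000000) (hω0 : 0 ≤ ω) (hω1 : ω ≤ 1 / 1000)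
    (hr0 : |r0| ≤ ω) (hr1 : r1 ^ 2 ≤ ω ^ 2 * (n + A2)) (hn : 0 ≤ n) (hA : 0 ≤ A2)
    (hα : α ^ 2 ≤ Bd * A2) (habar : abar ^ 2 ≤ A2) (hq : q ^ 2 ≤ A2) (hζ : ζ1 ^ 2 ≤ Bd * n)
    (hh : h = τ - (α + b) * g0 + b * r0 + abar * (E * H) - r1) (hζh : E * ζ1 = h + E * H * b)
    (hΩ : Ω = τ ^ 2 / g0 + g0 * (α + b - q) ^ 2 + n + A2) :
    b ^ 2 ≤ 2000 * Bd ^ 3 * Ω ∧ h ^ 2 ≤ 200 * Bd ^ 3 * Ω := by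
  obtain ⟨hr0a, hr0b⟩ := abs_le.1 hr0
  have hg2 : g0 ≤ 2 := by linarith
  have hτ0 : 0 ≤ τ ^ 2 / g0 := by positivity
  have hz0 : 0 ≤ g0 * (α + b - q) ^ 2 := by positivity
  have hΩ0 : 0 ≤ Ω := by rw [hΩ]; positivity
  have hB2 : 1 ≤ Bd ^ 2 := one_le_pow₀ hBd
  have hB3 : Bd ≤ Bd ^ 3 := le_self_pow₀ hBd (by norm_num)
  have hτ : τ ^ 2 ≤ 2 * Ω := by
    have : τ ^ 2 = g0 * (τ ^ 2 / g0) := by field_simp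
    rw [this]
    exact mul_le_mul hg2 (by linarith) hτ0 (by norm_num)
  have hz : g0 * (α + b) ^ 2 ≤ 6 * Ω := by
    have h1 : (α + b) ^ 2 ≤ 2 * (α + b - q) ^ 2 + 2 * q ^ 2 := by
      nlinarith [sq_nonneg (α + b - q - q)]
    have h2 := mul_le_mul_of_nonneg_left h1 hg0.le
    have h3 : g0 * q ^ 2 ≤ 2 * A2 := mul_le_mul hg2 hq (sq_nonneg _) (by norm_num)
    linarith
  have hzg : ((α + b) * g0) ^ 2 ≤ 12 * Ω := by
    have : ((α + b) * g0) ^ 2 = g0 * (g0 * (α + b) ^ 2) := by ring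
    rw [this]
    have h3 : 0 ≤ g0 * (α + b) ^ 2 := by positivity
    have h4 := mul_le_mul hg2 hz h3 (by norm_num)
    linarith
  have hab : (abar * (E * H)) ^ 2 ≤ 4 * Ω := by
    have h1 : (E * H) ^ 2 ≤ 2 ^ 2 := sq_le_sq' (by linarith) (by linarith)
    rw [mul_pow]
    have := mul_le_mul habar h1 (sq_nonneg _) hA
    linarith
  have hω2 : ω ^ 2 ≤ (1 / 1000) ^ 2 := pow_le_pow_left₀ hω0 hω1 2
  have hr0s : r0 ^ 2 ≤ ω ^ 2 := sq_le_sq' hr0a hr0b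
  have hbr : (b * r0) ^ 2 ≤ ω ^ 2 * b ^ 2 := by
    rw [mul_pow, mul_comm]
    exact mul_le_mul_of_nonneg_right hr0s (sq_nonneg _)
  have hr1s : r1 ^ 2 ≤ Ω := by
    have h3 : ω ^ 2 * (n + A2) ≤ 1 * (n + A2) :=
      mul_le_mul_of_nonneg_right (by linarith) (by linarith)
    linarith
  have hh2 : h ^ 2 ≤ 100 * Ω + 5 * (ω ^ 2 * b ^ 2) := by
    have := sq_add_five_le τ ((α + b) * g0) (b * r0) (abar * (E * H)) r1
    rw [← hh] at this
    linarith
  have hBΩ : Ω ≤ Bd ^ 3 * Ω := le_mul_of_one_le_left hΩ0 (hBd.trans hB3)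
  have hb : b ^ 2 ≤ 2000 * Bd ^ 3 * Ω := by
    rcases le_or_gt (1 / 4) g0 with hc | hc
    · have h1 : (α + b) ^ 2 ≤ 24 * Ω := by
        have := mul_le_mul_of_nonneg_right hc (sq_nonneg (α + b))
        linarith
      have h2 : b ^ 2 ≤ 2 * (α + b) ^ 2 + 2 * α ^ 2 := by nlinarith [sq_nonneg (α + b + α)]
      have h3 : Bd * A2 ≤ Bd ^ 3 * Ω := mul_le_mul hB3 (by linarith) hA (by positivity)
      linarith
    · have h1 : E * H ≤ -1 / 2 := by linarith
      have h2 : b ^ 2 ≤ 4 * (E * H * b) ^ 2 := by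
        have : (1 / 2) ^ 2 ≤ (-(E * H)) ^ 2 := pow_le_pow_left₀ (by norm_num) (by linarith) 2
        have := mul_le_mul_of_nonneg_right this (sq_nonneg b)
        linarith
      have h3 : (E * H * b) ^ 2 ≤ 2 * h ^ 2 + 2 * (E * ζ1) ^ 2 := by
        have : E * H * b = E * ζ1 - h := by linarith
        rw [this]
        linarith [sq_nonneg (E * ζ1 + h)]
      have h4 : (E * ζ1) ^ 2 ≤ Bd ^ 3 * Ω := by
        rw [mul_pow]
        have h5 : E ^ 2 ≤ Bd ^ 2 := pow_le_pow_left₀ hE0 hE 2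
        have h6 : ζ1 ^ 2 ≤ Bd * Ω := hζ.trans (mul_le_mul_of_nonneg_left (by linarith) (by linarith))
        calc E ^ 2 * ζ1 ^ 2 ≤ Bd ^ 2 * (Bd * Ω) := mul_le_mul h5 h6 (sq_nonneg _) (by positivity)
          _ = _ := by ring
      have h6 := mul_le_mul_of_nonneg_right hω2 (sq_nonneg b)
      linarith [sq_nonneg b]
  refine ⟨hb, ?_⟩
  have h7 : ω ^ 2 * b ^ 2 ≤ ω ^ 2 * (2000 * Bd ^ 3 * Ω) := mul_le_mul_of_nonneg_left hb (sq_nonneg _)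
  have h8 : ω ^ 2 * (2000 * Bd ^ 3 * Ω) = 2000 * ((ω ^ 2 * Bd ^ 3) * Ω) := by ring
  have h9 : (ω ^ 2 * Bd ^ 3) * Ω ≤ 1 / 1000000 * Ω := mul_le_mul_of_nonneg_right hω hΩ0
  linarith

/-- The error terms are dominated by `Ω`. -/
theorem scalar_error_bound {a1 α b g0 τ E H ζ2 abar q A2 n r0 r1 r2 ω Bd h Ω ij iJ Sη : ℝ}
    (hBd : 1 ≤ Bd) (hE0 : 0 ≤ E) (hE : E ≤ Bd) (hω0 : 0 < ω)
    (hEHa : -2 ≤ E * H)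
    (hr0 : |r0| ≤ ω) (hr1 : r1 ^ 2 ≤ ω ^ 2 * (n + A2)) (hr2 : |r2| ≤ ω * (n + A2))
    (hn : 0 ≤ n) (hA : 0 ≤ A2) (hq : q ^ 2 ≤ A2) (ha : a1 ^ 2 ≤ A2)
    (hζ : |ζ2| ≤ Bd * n) (hS : Sη ^ 2 ≤ ω ^ 2 * n) (hij0 : 0 ≤ ij) (hij : ij ≤ 1)
    (hiJ0 : 0 ≤ iJ) (hiJ : iJ ≤ 1)
    (hh : h = τ - (α + b) * g0 + b * r0 + abar * (E * H) - r1)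
    (hb2 : b ^ 2 ≤ 2000 * Bd ^ 3 * Ω) (hh2 : h ^ 2 ≤ 200 * Bd ^ 3 * Ω)
    (hnΩ : n + A2 ≤ Ω) :
    -(30000 * Bd ^ 3 * ω * Ω) + n / 10 ≤
      -(ω * (-(E * H)) - r0) * (1 - ij) * b ^ 2 + 2 * (b * r0 - r1) * (q - b) +
        2 * ω * (τ - (α + b) * g0 + b * r0 + abar * (E * H) - r1) * b +
        2 * a1 * iJ * Sη - 2 * ω * (E * ζ2) - 2 * r2 + (1 / 10 - ω) * n := by
  rw [← hh]
  obtain ⟨hr0a, hr0b⟩ := abs_le.1 hr0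
  have e1 : -(3 * (ω * b ^ 2)) ≤ -(ω * (-(E * H)) - r0) * (1 - ij) * b ^ 2 := by
    have h1 : -(3 * ω) ≤ -(ω * (-(E * H)) - r0) * (1 - ij) := by
      have h2 : -(3 * ω) ≤ -(ω * (-(E * H)) - r0) := by
        have := mul_le_mul_of_nonneg_left hEHa hω0.le
        linarith
      have h3 : (-(ω * (-(E * H)) - r0) + 3 * ω) * (1 - ij) ≥ 0 :=
        mul_nonneg (by linarith) (by linarith)
      have h4 : 0 ≤ ω * ij := by positivity
      linarith
    have := mul_le_mul_of_nonneg_right h1 (sq_nonneg b)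
    linarith
  have hqb : (q - b) ^ 2 ≤ 2 * A2 + 2 * b ^ 2 := by nlinarith [sq_nonneg (q + b)]
  have e2 : -(ω * (b ^ 2 + (q - b) ^ 2)) ≤ 2 * (b * r0) * (q - b) := by
    have h1 : |2 * (b * (q - b))| ≤ b ^ 2 + (q - b) ^ 2 := by
      rw [abs_le]
      constructor <;> linarith [sq_nonneg (b + (q - b)), sq_nonneg (b - (q - b))]
    have h2 : |2 * (b * r0) * (q - b)| ≤ ω * (b ^ 2 + (q - b) ^ 2) := by
      rw [show 2 * (b * r0) * (q - b) = r0 * (2 * (b * (q - b))) by ring, abs_mul]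
      exact mul_le_mul hr0 h1 (abs_nonneg _) hω0.le
    exact (abs_le.1 h2).1
  have e3 : -(ω * (n + A2) + ω * (q - b) ^ 2) ≤ -(2 * r1 * (q - b)) := by
    -- Young's inequality with weight ω suits r1, whose square carries a factor ω².
    have h1 : 0 ≤ (r1 - ω * (q - b)) ^ 2 / ω := by positivity
    have h2 : (r1 - ω * (q - b)) ^ 2 / ω = r1 ^ 2 / ω - 2 * r1 * (q - b) + ω * (q - b) ^ 2 := by
      field_simp; ring
    have h3 : r1 ^ 2 / ω ≤ ω * (n + A2) := by
      rw [div_le_iff₀ hω0]; linarith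
    linarith
  have e4 : -(ω * (h ^ 2 + b ^ 2)) ≤ 2 * ω * h * b := by
    linarith [mul_nonneg hω0.le (sq_nonneg (h + b))]
  have e5 : -(ω * A2 + ω * n) ≤ 2 * a1 * iJ * Sη := by
    have h1 : 0 ≤ (Sη + ω * (a1 * iJ)) ^ 2 / ω := by positivity
    have h2 : (Sη + ω * (a1 * iJ)) ^ 2 / ω = Sη ^ 2 / ω + 2 * a1 * iJ * Sη + ω * (a1 * iJ) ^ 2 := by
      field_simp; ring
    have h3 : Sη ^ 2 / ω ≤ ω * n := by
      rw [div_le_iff₀ hω0]; linarith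
    have h4 : (a1 * iJ) ^ 2 ≤ A2 := by
      rw [mul_pow]
      have := mul_le_mul_of_nonneg_left (pow_le_one₀ hiJ0 hiJ : iJ ^ 2 ≤ 1) (sq_nonneg a1)
      linarith
    have h5 := mul_le_mul_of_nonneg_left h4 hω0.le
    linarith
  have e6 : -(2 * ω * (Bd ^ 2 * n)) ≤ -(2 * ω * (E * ζ2)) := by
    have h1 : E * ζ2 ≤ Bd * (Bd * n) :=
      (mul_le_mul_of_nonneg_left ((le_abs_self _).trans hζ) hE0).trans
        (mul_le_mul_of_nonneg_right hE (by positivity))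
    have h2 := mul_le_mul_of_nonneg_left h1 (by positivity : 0 ≤ 2 * ω)
    linarith
  have e7 : -(2 * (ω * (n + A2))) ≤ -2 * r2 := by
    have := (le_abs_self r2).trans hr2
    linarith
  have hB3 : (1 : ℝ) ≤ Bd ^ 3 := one_le_pow₀ hBd
  have hB23 : Bd ^ 2 ≤ Bd ^ 3 := pow_le_pow_right₀ hBd (by norm_num)
  have hΩ0 : 0 ≤ Ω := by linarith
  have f1 : ω * b ^ 2 ≤ 2000 * (Bd ^ 3 * ω * Ω) := by
    have := mul_le_mul_of_nonneg_left hb2 hω0.le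
    linarith
  have f2 : ω * h ^ 2 ≤ 200 * (Bd ^ 3 * ω * Ω) := by
    have := mul_le_mul_of_nonneg_left hh2 hω0.le
    linarith
  have f3 : ω * (n + A2) ≤ Bd ^ 3 * ω * Ω := by
    have h1 : ω * (n + A2) ≤ ω * Ω := mul_le_mul_of_nonneg_left hnΩ hω0.le
    have h2 : ω * Ω ≤ Bd ^ 3 * (ω * Ω) := le_mul_of_one_le_left (by positivity) hB3
    linarith
  have f4 : ω * (Bd ^ 2 * n) ≤ Bd ^ 3 * ω * Ω := by
    have h1 : Bd ^ 2 * n ≤ Bd ^ 3 * Ω := mul_le_mul hB23 (by linarith) hn (by positivity)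
    have := mul_le_mul_of_nonneg_left h1 hω0.le
    linarith
  have f5 := mul_le_mul_of_nonneg_left hqb hω0.le
  have f6 : 0 ≤ ω * n := by positivity
  have f7 : 0 ≤ ω * A2 := by positivity
  linarith

variable {ι : Type*}

theorem sq_sum_mul_le_sum_sq (L : Finset ι) (a p : ι → ℝ) (hp : ∀ i ∈ L, 0 ≤ p i)
    (hs : ∑ i ∈ L, p i ≤ 1) : (∑ i ∈ L, p i * a i) ^ 2 ≤ ∑ i ∈ L, a i ^ 2 := by
  have h1 := Finset.sum_mul_sq_le_sq_mul_sq L p a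
  have h2 : ∑ i ∈ L, p i ^ 2 ≤ 1 := by
    refine le_trans (Finset.sum_le_sum fun i hi => ?_) hs
    have : p i ≤ 1 := (Finset.single_le_sum hp hi).trans hs
    have := mul_le_mul_of_nonneg_left this (hp i hi)
    linarith
  have h3 := mul_le_mul_of_nonneg_right h2 (Finset.sum_nonneg fun i (_ : i ∈ L) => sq_nonneg (a i))
  linarith

/-- The quadratic form at the large indices bounds the target plus a definite slack. -/
theorem main_lower_bound (L : Finset ι) (a p : ι → ℝ) {a1 p1 b g0 β τ K j k A2 q u X : ℝ}
    (hj : 1 ≤ j) (hk : k = L.card + 1 + j) (hp1 : 0 < p1) (hp : ∀ i ∈ L, p1 ≤ p i)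
    (hsum : p1 + ∑ i ∈ L, p i = 1) (hg : 0 < g0) (hβ : 0 ≤ β) (hK : 4 ≤ K) (hgβ : 1 / 2 ≤ g0 + β)
    (hA : A2 = a1 ^ 2 + ∑ i ∈ L, a i ^ 2) (hq : q = ∑ i ∈ L, p i * a i)
    (hu : u = a1 + ∑ i ∈ L, a i + b - q)
    (hX : X = 2 * (p1 * a1 ^ 2 + ∑ i ∈ L, p i * a i ^ 2) - 2 * (p1 * a1 + q) * q) :
    (1 + 1 / (8 * (k + 1))) * a1 ^ 2 * (g0 + β * p1) + p1 ^ 2 / (32 * (k + 1)) * A2 +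
        τ ^ 2 / g0 + 1 / 6 * (g0 * u ^ 2) ≤
      g0 * (u ^ 2 + 1 / j * b ^ 2 + A2 - q ^ 2) + β * X -
        β * (a1 ^ 2 * (51 / 100 * p1 ^ 2 + 27 / 100 * p1)) - 2 * τ * u + K * (τ ^ 2 / g0) := by
  have hmain := main_quadratic L a p (a1 := a1) (b := b) hj hk hp1 hp hsum hg.le hβ
  have hp1' : p1 ≤ 1 := by
    have := Finset.sum_nonneg fun i hi => hp1.le.trans (hp i hi)
    linarith
  have hu' : u = a1 + (∑ i ∈ L, (1 - p i) * a i + b) := by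
    rw [hu, hq]
    simp only [sub_mul, one_mul, Finset.sum_sub_distrib]
    ring
  rw [← hu', ← hq] at hmain
  have hk3 : 3 ≤ k + 1 := by
    have : (0 : ℝ) ≤ L.card := by positivity
    linarith
  -- This is where K ≥ 4 comes from: three copies of τ²/g0 absorb the cross term and one is kept. Of
  -- g0u², a third goes here and a half to `main_quadratic`, which leaves a sixth.
  have hτ : 2 * τ * u ≤ 3 * (τ ^ 2 / g0) + 1 / 3 * (g0 * u ^ 2) := by
    have h1 : 0 ≤ (3 * τ - g0 * u) ^ 2 / (3 * g0) := by positivity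
    have h2 : (3 * τ - g0 * u) ^ 2 / (3 * g0) =
        3 * (τ ^ 2 / g0) - 2 * τ * u + 1 / 3 * (g0 * u ^ 2) := by
      field_simp; ring
    linarith
  have hKτ : 4 * (τ ^ 2 / g0) ≤ K * (τ ^ 2 / g0) :=
    mul_le_mul_of_nonneg_right hK (by positivity)
  have hS : 0 ≤ ∑ i ∈ L, a i ^ 2 := Finset.sum_nonneg fun i _ => sq_nonneg (a i)
  set S := ∑ i ∈ L, a i ^ 2
  set c := 1 / (k + 1) with hc
  have hc0 : 0 < c := by positivity
  have hc3 : c ≤ 1 / 3 := one_div_le_one_div_of_le (by norm_num) hk3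
  have e1 : 1 / (8 * (k + 1)) = c / 8 := by rw [hc]; field_simp
  have e2 : p1 ^ 2 / (32 * (k + 1)) = p1 ^ 2 * c / 32 := by rw [hc]; field_simp
  rw [e1, e2]
  have hps : p1 ^ 2 ≤ p1 := by
    have := mul_le_mul_of_nonneg_left hp1' hp1.le
    linarith
  have hpc : p1 ^ 2 * c ≤ p1 * c := mul_le_mul_of_nonneg_right hps hc0.le
  have hpc2 : p1 * c ≤ p1 * (1 / 3) := mul_le_mul_of_nonneg_left hc3 hp1.le
  have hpc3 : p1 * c ≤ 1 * c := mul_le_mul_of_nonneg_right hp1' hc0.le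
  have hA0 : 0 ≤ A2 := by rw [hA]; positivity
  have s1 : p1 ^ 2 * c / 32 * A2 ≤ p1 ^ 2 * c / 16 * ((g0 + β) * A2) := by
    have h1 := mul_le_mul_of_nonneg_right hgβ hA0
    have h2 := mul_le_mul_of_nonneg_left h1 (by positivity : 0 ≤ p1 ^ 2 * c / 16)
    linarith
  have s2 : p1 ^ 2 * c / 16 * (g0 * a1 ^ 2) ≤ 7 / 8 * c * (g0 * a1 ^ 2) :=
    mul_le_mul_of_nonneg_right (by linarith) (by positivity)
  have s3 : p1 ^ 2 * c / 16 * (β * a1 ^ 2) ≤ (1 / 8 - c / 8) * p1 * (β * a1 ^ 2) := by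
    apply mul_le_mul_of_nonneg_right _ (by positivity)
    linarith
  have s4 : p1 ^ 2 * c / 16 * ((g0 + β) * S) ≤ p1 ^ 2 / 4 * ((g0 + β) * S) := by
    apply mul_le_mul_of_nonneg_right _ (by positivity)
    have := mul_le_mul_of_nonneg_left hc3 (sq_nonneg p1)
    linarith [sq_nonneg p1]
  have ex : β * X = β * (2 * (p1 * a1 ^ 2 + ∑ i ∈ L, p i * a i ^ 2) - 2 * (p1 * a1 + q) * q) := by
    rw [hX]
  have e3 : b ^ 2 / j = 1 / j * b ^ 2 := by ring
  rw [e3] at hmain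
  rw [ex]
  rw [hA] at s1 ⊢
  linarith

/-- The moment v is essentially Jβp1, so the price a1²(iJ²/cd + iJ²/(19/10))v of the two completed
squares is proportional to β, up to ω. The first part gives p1²/2, enlarged to 51/100, and the
second, using J ≥ 2, at most 27/100 p1. -/
theorem defect_bound {a1 p1 β v s1 ω E J iJ cd : ℝ} (hE : E * p1 = 1) (hp1 : 0 < p1)
    (hp1' : p1 ≤ 1) (hω : 0 ≤ ω) (hω1 : ω ≤ 1 / 100) (hJ : 2 ≤ J) (hiJ : iJ = 1 / J)
    (hs1 : |s1| ≤ ω) (hv : v = s1 + J * β * p1) (hv0 : 0 ≤ v)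
    (hcd : cd = 2 * (1 - ω) * E * iJ) :
    a1 ^ 2 * (iJ ^ 2 / cd + iJ ^ 2 / (19 / 10)) * v ≤
      max β 0 * (a1 ^ 2 * (51 / 100 * p1 ^ 2 + 27 / 100 * p1)) + ω * a1 ^ 2 := by
  have hE' : E = 1 / p1 := by field_simp; exact hE
  have hJ0 : 0 < J := by linarith
  have h1ω : 0 < 1 - ω := by linarith
  have hcv1 : iJ ^ 2 / cd = p1 / (2 * (1 - ω) * J) := by
    rw [hcd, hE', hiJ]; field_simp
  have hi1 : 1 / (2 * (1 - ω)) ≤ 51 / 100 := by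
    rw [div_le_div_iff₀ (by linarith) (by norm_num)]; linarith
  have hiJ2 : iJ ≤ 1 / 2 := by rw [hiJ]; exact one_div_le_one_div_of_le (by norm_num) hJ
  have hiJ0 : 0 < iJ := by rw [hiJ]; positivity
  have hJi : J * iJ = 1 := by rw [hiJ]; field_simp
  have hβ := le_max_left β 0
  have hβ0 := le_max_right β 0
  set B := max β 0
  have hs := (abs_le.1 hs1).2
  have hcv1' : iJ ^ 2 / cd ≤ 51 / 100 * (p1 * iJ) := by
    have : iJ ^ 2 / cd = 1 / (2 * (1 - ω)) * (p1 * iJ) := by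
      rw [hcv1, hiJ]; field_simp
    rw [this]
    exact mul_le_mul_of_nonneg_right hi1 (by positivity)
  have hcv2 : iJ ^ 2 / (19 / 10) ≤ 27 / 100 * iJ := by
    have := mul_le_mul_of_nonneg_left hiJ2 hiJ0.le
    linarith
  have hsum : iJ ^ 2 / cd + iJ ^ 2 / (19 / 10) ≤ (51 / 100 * p1 + 27 / 100) * iJ := by linarith
  have hvB : v ≤ ω + J * B * p1 := by
    have : J * β * p1 ≤ J * B * p1 :=
      mul_le_mul_of_nonneg_right (mul_le_mul_of_nonneg_left hβ hJ0.le) hp1.le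
    linarith
  have h1 : (iJ ^ 2 / cd + iJ ^ 2 / (19 / 10)) * v ≤
      (51 / 100 * p1 + 27 / 100) * iJ * (ω + J * B * p1) :=
    mul_le_mul hsum hvB hv0 (by positivity)
  have h2 : (51 / 100 * p1 + 27 / 100) * iJ * (ω + J * B * p1) =
      (51 / 100 * p1 + 27 / 100) * iJ * ω + (51 / 100 * p1 + 27 / 100) * B * p1 := by
    linear_combination (51 / 100 * p1 + 27 / 100) * B * p1 * hJi
  have h3 : (51 / 100 * p1 + 27 / 100) * iJ * ω ≤ 1 * ω := by
    apply mul_le_mul_of_nonneg_right _ hω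
    have h4 : 51 / 100 * p1 + 27 / 100 ≤ 1 := by linarith
    have := mul_le_mul h4 hiJ2 hiJ0.le (by norm_num)
    linarith
  have h5 : (iJ ^ 2 / cd + iJ ^ 2 / (19 / 10)) * v ≤ ω + (51 / 100 * p1 + 27 / 100) * B * p1 := by
    linarith
  have := mul_le_mul_of_nonneg_left h5 (sq_nonneg a1)
  linarith

theorem small_parameter_bounds {ω Bd k : ℝ} (hω : 0 < ω) (hBd : 1 ≤ Bd) (hk : 0 ≤ k)
    (h : ω * (10000000 * (k + 1) * Bd ^ 6) ≤ 1) :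
    ω ≤ 1 / 10000000 ∧ ω * Bd ≤ 1 / 10000000 ∧ ω ^ 2 * Bd ^ 3 ≤ 1 / 1000000 ∧
      40000 * Bd ^ 3 * ω ≤ 1 / Bd ^ 2 / (32 * (k + 1)) := by
  have hB0 : 0 < Bd := by linarith
  have h1 : ω * Bd ^ 6 * (k + 1) ≤ 1 / 10000000 := by linarith
  have hB6 : ∀ m ≤ 6, Bd ^ m ≤ Bd ^ 6 := fun m hm => pow_le_pow_right₀ hBd hm
  have h2 : ω * Bd ^ 6 ≤ 1 / 10000000 := by
    have : ω * Bd ^ 6 ≤ ω * Bd ^ 6 * (k + 1) := le_mul_of_one_le_right (by positivity) (by linarith)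
    linarith
  have h3 : ∀ m ≤ 6, ω * Bd ^ m ≤ 1 / 10000000 := fun m hm =>
    (mul_le_mul_of_nonneg_left (hB6 m hm) hω.le).trans h2
  have hw := h3 0 (by norm_num)
  have hw1 := h3 1 (by norm_num)
  simp only [pow_zero, mul_one, pow_one] at hw hw1
  refine ⟨hw, hw1, ?_, ?_⟩
  · have h4 := h3 3 (by norm_num)
    have h5 : ω * (ω * Bd ^ 3) ≤ 1 * (1 / 10000000) :=
      mul_le_mul (by linarith) h4 (by positivity) (by norm_num)
    have h6 : ω ^ 2 * Bd ^ 3 = ω * (ω * Bd ^ 3) := by ring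
    rw [h6]; linarith
  · rw [div_div, le_div_iff₀ (by positivity)]
    have h4 : ω * (Bd ^ 5 * (k + 1)) ≤ ω * (Bd ^ 6 * (k + 1)) := by
      apply mul_le_mul_of_nonneg_left _ hω.le
      exact mul_le_mul_of_nonneg_right (hB6 5 (by norm_num)) (by linarith)
    have h5 : 40000 * Bd ^ 3 * ω * (Bd ^ 2 * (32 * (k + 1))) = 1280000 * (ω * (Bd ^ 5 * (k + 1))) := by
      ring
    rw [h5]
    linarith

set_option maxHeartbeats 1600000 in
-- After division by ΛP: g0, g1, g2 are the jet of the bracket P + EZ + tail, τ is the first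
-- derivative of e_k, H, H1, H2 that of the quotient Z/P, r0, r1, r2 that of the tail, and n, v are
-- the weighted second moments of ξ and x on the small cluster. The target weight 1 + (E - 1)H
-- equals g0 + βp1 up to ω, with β = -EH.
theorem scalar_core (L : Finset ι) (a p : ι → ℝ)
    {a1 p1 abar q m2 A2 α b g0 g1 g2 τ ω K E H H1 H2 ζ1 ζ2 π2 r0 r1 r2 rh n v s1
      Sη Wη Wd D j k Bd : ℝ}
    (hj : 1 ≤ j) (hk : k = L.card + 1 + j) (hp1 : 0 < p1) (hp : ∀ i ∈ L, p1 ≤ p i)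
    (hsum : p1 + ∑ i ∈ L, p i = 1) (hK : 4 ≤ K)
    (hA : A2 = a1 ^ 2 + ∑ i ∈ L, a i ^ 2) (hq : q = ∑ i ∈ L, p i * a i)
    (habar : abar = p1 * a1 + q) (hm2 : m2 = p1 * a1 ^ 2 + ∑ i ∈ L, p i * a i ^ 2)
    (hα : α = a1 + ∑ i ∈ L, a i) (hE : E * p1 = 1) (hEB : E ≤ Bd) (hLB : (L.card : ℝ) + 1 ≤ Bd)
    (hω : 0 < ω) (hωB : ω * (10000000 * (k + 1) * Bd ^ 6) ≤ 1)
    (hg0p : 0 < g0)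
    (hg0 : g0 = 1 + E * H + r0) (hg1 : g1 = b + E * ζ1 - E * abar * H + r1)
    (hg2 : g2 = π2 + E * ζ2 - E * abar * ζ1 + E * m2 * H + r2)
    (hζ1 : ζ1 = H1 + H * b) (hζ2 : ζ2 = H2 + H1 * b + H * π2) (hτ : τ = g1 + α * g0)
    (hC1 : 2 * π2 ≤ (1 - 1 / j) * b ^ 2)
    (hH : (j + 1) * H = s1 - v) (hH1 : (j + 1) * H1 = Sη - Wη - Wd) (hH2 : (j + 1) * H2 ≤ -D)
    (hv : 0 ≤ v) (hn : 0 ≤ n) (hs1 : |s1| ≤ ω)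
    (hr0 : |r0| ≤ ω) (hr1 : r1 ^ 2 ≤ ω ^ 2 * (n + A2)) (hr2 : |r2| ≤ ω * (n + A2)) (hrh : |rh| ≤ ω)
    (hζ1b : ζ1 ^ 2 ≤ Bd * n) (hζ2b : |ζ2| ≤ Bd * n) (hS : Sη ^ 2 ≤ ω ^ 2 * n)
    (hWd : ∀ t : ℝ, 0 ≤ D + 2 * t * Wd + t ^ 2 * v)
    (hWη : ∀ t : ℝ, 0 ≤ n + 2 * t * Wη + t ^ 2 * v) :
    (1 + 1 / (8 * (k + 1))) * a1 ^ 2 * (1 + (E - 1) * H + rh) ≤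
      -2 * g2 - 2 * α * g1 - (α ^ 2 - A2) * g0 + K * (τ ^ 2 / g0) + (2 - ω) * n := by
  have hL0 : (0 : ℝ) ≤ L.card := by positivity
  have hBd : 1 ≤ Bd := by linarith
  have hk0 : 0 ≤ k := by rw [hk]; linarith
  obtain ⟨hω1, hωBd, hωB3, hslack⟩ := small_parameter_bounds hω hBd hk0 hωB
  have hp0 : ∀ i ∈ L, 0 ≤ p i := fun i hi => hp1.le.trans (hp i hi)
  have hps : ∑ i ∈ L, p i ≤ 1 := by linarith
  have hp1' : p1 ≤ 1 := by linarith [Finset.sum_nonneg hp0]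
  have hS0 : 0 ≤ ∑ i ∈ L, a i ^ 2 := Finset.sum_nonneg fun i _ => sq_nonneg (a i)
  have ha1 : a1 ^ 2 ≤ A2 := by linarith
  have hA0 : 0 ≤ A2 := (sq_nonneg a1).trans ha1
  have hE0 : 0 < E := by
    by_contra h
    have := mul_nonpos_of_nonpos_of_nonneg (not_lt.1 h) hp1.le
    linarith
  have hE1 : 1 ≤ E := by
    have := mul_le_mul_of_nonneg_left hp1' hE0.le
    linarith
  have hq2 : q ^ 2 ≤ A2 := by
    have := sq_sum_mul_le_sum_sq L a p hp0 hps
    rw [← hq] at this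
    linarith [sq_nonneg a1]
  have hqm : q ^ 2 ≤ m2 - p1 * a1 ^ 2 := by
    have h1 := Finset.sum_sq_le_sum_mul_sum_of_sq_le_mul L (r := fun i => p i * a i) (f := p)
        (g := fun i => p i * a i ^ 2) hp0 (fun i hi => mul_nonneg (hp0 i hi) (sq_nonneg _))
        (fun i _ => by ring_nf; rfl)
    have h2 := mul_le_mul_of_nonneg_right hps
      (Finset.sum_nonneg fun i hi => mul_nonneg (hp0 i hi) (sq_nonneg (a i)))
    rw [← hq] at h1
    linarith
  have hmA : m2 ≤ A2 := by
    have h1 : ∑ i ∈ L, p i * a i ^ 2 ≤ ∑ i ∈ L, a i ^ 2 := by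
      refine Finset.sum_le_sum fun i hi => ?_
      have : p i ≤ 1 := (Finset.single_le_sum hp0 hi).trans hps
      have := mul_le_mul_of_nonneg_right this (sq_nonneg (a i))
      linarith
    have := mul_le_mul_of_nonneg_right hp1' (sq_nonneg a1)
    linarith
  have habar2 : abar ^ 2 ≤ A2 := by
    have h1 : abar ^ 2 ≤ p1 * a1 ^ 2 + (m2 - p1 * a1 ^ 2) := by
      have h2 : q ^ 2 ≤ (1 - p1) * (m2 - p1 * a1 ^ 2) := by
        have h1 := Finset.sum_sq_le_sum_mul_sum_of_sq_le_mul L (r := fun i => p i * a i) (f := p)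
          (g := fun i => p i * a i ^ 2) hp0 (fun i hi => mul_nonneg (hp0 i hi) (sq_nonneg _))
          (fun i _ => by ring_nf; rfl)
        rw [← hq] at h1
        have e1 : ∑ i ∈ L, p i = 1 - p1 := by linarith
        have e2 : ∑ i ∈ L, p i * a i ^ 2 = m2 - p1 * a1 ^ 2 := by linarith
        rwa [e1, e2] at h1
      have h3 : 0 ≤ m2 - p1 * a1 ^ 2 := (sq_nonneg q).trans hqm
      have h4 : (p1 * a1) ^ 2 = p1 * (p1 * a1 ^ 2) := by ring
      have h5 := sq_add_le_of_sq_le (s := q) (b := p1 * a1) (j := p1) (by linarith) h3 hp1 h2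
      have h6 : (p1 * a1) ^ 2 / p1 = p1 * a1 ^ 2 := by field_simp
      rw [h6] at h5
      rw [habar]
      calc (p1 * a1 + q) ^ 2 = (q + p1 * a1) ^ 2 := by ring
        _ ≤ _ := h5
        _ = _ := by ring
    linarith
  have hαB : α ^ 2 ≤ Bd * A2 := by
    have h1 : (∑ i ∈ L, a i) ^ 2 ≤ L.card * ∑ i ∈ L, a i ^ 2 := sq_sum_le_card_mul_sum_sq
    have h2 := sq_add_le_of_sq_le (s := ∑ i ∈ L, a i) (b := a1) (j := 1) hL0 hS0 one_pos h1
    have h3 : α ^ 2 ≤ (L.card + 1) * A2 := by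
      rw [hα, hA]
      calc (a1 + ∑ i ∈ L, a i) ^ 2 = (∑ i ∈ L, a i + a1) ^ 2 := by ring
        _ ≤ _ := h2
        _ = _ := by ring
    exact h3.trans (mul_le_mul_of_nonneg_right hLB hA0)
  obtain ⟨hr0a, hr0b⟩ := abs_le.1 hr0
  obtain ⟨hrha, hrhb⟩ := abs_le.1 hrh
  have hEH1 : -1 - ω ≤ E * H := by linarith
  have hJ0 : 0 < j + 1 := by linarith
  set iJ := 1 / (j + 1) with hiJ
  have hJi : (j + 1) * iJ = 1 := by rw [hiJ]; field_simp
  have hiJ0 : 0 < iJ := by positivity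
  have hiJ1 : iJ ≤ 1 := by rw [hiJ, div_le_one hJ0]; linarith
  have hHs : H ≤ ω := by
    have h1 : H = iJ * (s1 - v) := by rw [← hH, ← mul_assoc, mul_comm iJ, hJi, one_mul]
    have h2 : iJ * (s1 - v) ≤ iJ * ω := mul_le_mul_of_nonneg_left
      (by linarith [(abs_le.1 hs1).2]) hiJ0.le
    have h3 : iJ * ω ≤ 1 * ω := mul_le_mul_of_nonneg_right hiJ1 hω.le
    linarith
  have hEH2 : E * H ≤ ω * Bd := by
    have h1 := mul_le_mul_of_nonneg_left hHs hE0.le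
    have h2 := mul_le_mul_of_nonneg_right hEB hω.le
    linarith
  have hH1' : H1 = iJ * (Sη - Wη - Wd) := by rw [← hH1, ← mul_assoc, mul_comm iJ, hJi, one_mul]
  have hH2' : H2 ≤ -(iJ * D) := by
    have := mul_le_mul_of_nonneg_left hH2 hiJ0.le
    rw [← mul_assoc, mul_comm iJ, hJi, one_mul] at this
    linarith
  set cd := 2 * (1 - ω) * E * iJ with hcd
  have hcd0 : 0 < cd := mul_pos (mul_pos (mul_pos two_pos (by linarith)) hE0) hiJ0
  have h3 : 0 ≤ cd * D - 2 * (a1 * iJ) * Wd + a1 ^ 2 * (iJ ^ 2 / cd) * v := by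
    have h1 := mul_nonneg hcd0.le (hWd (-(a1 * iJ) / cd))
    have h2 : cd * (D + 2 * (-(a1 * iJ) / cd) * Wd + (-(a1 * iJ) / cd) ^ 2 * v) =
        cd * D - 2 * (a1 * iJ) * Wd + a1 ^ 2 * (iJ ^ 2 / cd) * v := by
      field_simp; ring
    linarith
  have h4 : 0 ≤ 19 / 10 * n - 2 * (a1 * iJ) * Wη + a1 ^ 2 * (iJ ^ 2 / (19 / 10)) * v := by
    have h1 := mul_nonneg (by norm_num : (0 : ℝ) ≤ 19 / 10) (hWη (-(a1 * iJ) / (19 / 10)))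
    have h2 : 19 / 10 * (n + 2 * (-(a1 * iJ) / (19 / 10)) * Wη + (-(a1 * iJ) / (19 / 10)) ^ 2 * v) =
        19 / 10 * n - 2 * (a1 * iJ) * Wη + a1 ^ 2 * (iJ ^ 2 / (19 / 10)) * v := by
      ring
    linarith
  -- Positivity of g0 gives only EH ≥ -1 - ω. The damping factor 1 - ω makes the coefficient at
  -- least ω²; it is the reason for the parameter ν in `scalar_reduction`.
  have hγ : 0 ≤ 1 + (1 - ω) * (E * H) := by
    have := mul_le_mul_of_nonneg_left hEH1 (by linarith : 0 ≤ 1 - ω)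
    linarith [sq_nonneg ω]
  have hred := scalar_reduction (K := K) (ω := ω) hE (by linarith : 0 ≤ 1 - ω) hg0 hg1 hg2 hζ1 hζ2 hτ hγ hC1
    hH2' hH1' hE0.le hcd h3 h4 (A2 := A2) (Sη := Sη)
  have hqa : abar - p1 * a1 = q := by rw [habar]; ring
  rw [hqa] at hred
  set h := τ - (α + b) * g0 + b * r0 + abar * (E * H) - r1 with hh
  -- The slack of the main estimate dominates a fixed multiple of Ω, while all errors are at most a
  -- constant times Bd³ωΩ.
  set Ω := τ ^ 2 / g0 + g0 * (α + b - q) ^ 2 + n + A2 with hΩ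
  have hζh : E * ζ1 = h + E * H * b := by
    rw [hh, hτ, hg1, hg0]; ring
  obtain ⟨hb2, hh2⟩ := scalar_direction_bound hg0p hg0 (by linarith) hBd hE0.le hEB hωB3 hω.le
    (by linarith) hr0 hr1 hn hA0 hαB habar2 hq2 hζ1b hh hζh hΩ
  have hij1 : 1 / j ≤ 1 := by rw [div_le_one (by linarith)]; exact hj
  have hnΩ : n + A2 ≤ Ω := by
    have h1 : 0 ≤ τ ^ 2 / g0 := by positivity
    have h2 : 0 ≤ g0 * (α + b - q) ^ 2 := by positivity
    linarith
  have herr := scalar_error_bound hBd hE0.le hEB hω (by linarith) hr0 hr1 hr2 hn hA0 hq2 ha1 hζ2b hS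
    (by positivity : 0 ≤ 1 / j) hij1 hiJ0.le hiJ1 hh hb2 hh2 hnΩ
  have hHβ : H = -(-(E * H) * p1) := by linear_combination (-H) * hE
  have hdef := defect_bound (a1 := a1) (β := -(E * H)) (v := v) hE hp1 hp1' hω.le (by linarith)
    (by linarith : 2 ≤ j + 1) hiJ hs1
    (by linear_combination hH + (j + 1) * H * hE) hv hcd
  have hmx0 := le_max_right (-(E * H)) 0
  have hmx := le_max_left (-(E * H)) 0
  -- The weight β = -EH can be slightly negative. Its positive part is used instead, at a cost of
  -- order ωBd.
  have hmx2 : max (-(E * H)) 0 ≤ -(E * H) + ω * Bd := max_le (by linarith [mul_nonneg hω.le (by linarith : 0 ≤ Bd)]) (by linarith)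
  set B := max (-(E * H)) 0
  have hmain := main_lower_bound L a p (τ := τ) (b := b) hj hk hp1 hp hsum hg0p hmx0 hK
    (by linarith : 1 / 2 ≤ g0 + B) hA hq rfl rfl
  rw [← hα, ← hm2, ← habar] at hmain
  have hX : |2 * m2 - 2 * abar * q| ≤ 4 * A2 := by
    have h5 : 0 ≤ m2 := by
      have h6 := mul_nonneg hp1.le (sq_nonneg a1)
      linarith [sq_nonneg q]
    rw [abs_le]
    constructor
    · linarith [sq_nonneg (abar - q)]
    · linarith [sq_nonneg (abar + q)]
  have hBX : B * (2 * m2 - 2 * abar * q) ≤ -(E * H) * (2 * m2 - 2 * abar * q) + ω * Bd * (4 * A2) := by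
    have h5 : (B - -(E * H)) * (2 * m2 - 2 * abar * q) ≤ ω * Bd * (4 * A2) :=
      (mul_le_mul_of_nonneg_left (abs_le.1 hX).2 (by linarith)).trans
        (mul_le_mul_of_nonneg_right (by linarith) (by linarith))
    linarith
  have hδ : 1 / (8 * (k + 1)) ≤ 1 / 8 := one_div_le_one_div_of_le (by norm_num) (by linarith)
  have hδ0 : 0 < 1 / (8 * (k + 1)) := by positivity
  have htgt : (1 + 1 / (8 * (k + 1))) * a1 ^ 2 * (1 + (E - 1) * H + rh) ≤
      (1 + 1 / (8 * (k + 1))) * a1 ^ 2 * (g0 + B * p1) + 9 / 4 * (ω * A2) := by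
    have h5 : 1 + (E - 1) * H + rh ≤ g0 + B * p1 + 2 * ω := by
      have := mul_le_mul_of_nonneg_right hmx hp1.le
      linarith
    have h6 := mul_le_mul_of_nonneg_left h5
      (by positivity : 0 ≤ (1 + 1 / (8 * (k + 1))) * a1 ^ 2)
    have h7 : (1 + 1 / (8 * (k + 1))) * a1 ^ 2 ≤ 9 / 8 * A2 :=
      mul_le_mul (by linarith) ha1 (sq_nonneg _) (by norm_num)
    have h8 := mul_le_mul_of_nonneg_right h7 (by linarith : 0 ≤ 2 * ω)
    linarith
  have hΩ0 : 0 ≤ Ω := by linarith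
  have hτ0 : 0 ≤ τ ^ 2 / g0 := by positivity
  have hz0 : 0 ≤ g0 * (α + b - q) ^ 2 := by positivity
  have hB0 : 0 < Bd := by linarith
  have hpB : 1 / Bd ^ 2 ≤ p1 ^ 2 := by
    rw [div_le_iff₀ (by positivity), ← mul_pow]
    refine one_le_pow₀ ?_
    rw [← hE, mul_comm E]
    exact mul_le_mul_of_nonneg_left hEB hp1.le
  set c := 1 / Bd ^ 2 / (32 * (k + 1)) with hc
  have hc0 : 0 < c := by positivity
  have hc1 : c ≤ 1 / 32 := by
    rw [hc, div_div]
    apply one_div_le_one_div_of_le (by norm_num)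
    have := mul_le_mul (one_le_pow₀ hBd : 1 ≤ Bd ^ 2) (by linarith : 32 ≤ 32 * (k + 1))
      (by norm_num) (by positivity)
    linarith
  have hcp : c ≤ p1 ^ 2 / (32 * (k + 1)) := by
    rw [hc]; exact div_le_div_of_nonneg_right hpB (by positivity)
  have hcΩ : c * Ω ≤ p1 ^ 2 / (32 * (k + 1)) * A2 + τ ^ 2 / g0 +
      1 / 6 * (g0 * (α + b - q) ^ 2) + n / 10 := by
    have h5 := mul_le_mul_of_nonneg_right hcp hA0
    have h6 := mul_le_mul_of_nonneg_right hc1 hτ0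
    have h7 := mul_le_mul_of_nonneg_right hc1 hz0
    have h8 := mul_le_mul_of_nonneg_right hc1 hn
    rw [hΩ]
    linarith
  have hsl := mul_le_mul_of_nonneg_right hslack hΩ0
  have hB3 : Bd ≤ Bd ^ 3 := le_self_pow₀ hBd (by norm_num)
  have e1 : ω * Bd * A2 ≤ Bd ^ 3 * ω * Ω := by
    have h5 : Bd * A2 ≤ Bd ^ 3 * Ω := mul_le_mul hB3 (by linarith) hA0 (by positivity)
    have := mul_le_mul_of_nonneg_left h5 hω.le
    linarith
  have e0 : 0 ≤ Bd ^ 3 * ω * Ω := by positivity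
  have e2 : ω * A2 ≤ ω * Bd * A2 := by
    have := mul_le_mul_of_nonneg_right hBd (mul_nonneg hω.le hA0)
    linarith
  have e3 : ω * a1 ^ 2 ≤ ω * A2 := mul_le_mul_of_nonneg_left ha1 hω.le
  refine htgt.trans (le_trans ?_ hred)
  clear_value Ω c B h cd iJ
  rw [← hh] at herr
  have e4 : g0 * ((α + b - q) ^ 2 + 1 / j * b ^ 2 + A2 - q ^ 2) - 2 * τ * (α + b - q) =
      g0 * ((α + b) ^ 2 + 1 / j * b ^ 2 + A2 - 2 * (α + b) * q) + 2 * τ * (q - (α + b)) := by ring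
  linarith

end ScalarCore

/-! ### Size estimates for second-order jets. -/

section JetBounds

open PowerSeries

/-- The `i`-th coefficient of `f` is at most `C * s ^ i` for `i ≤ 2`. -/
def JetBound (f : ℝ⟦X⟧) (C s : ℝ) : Prop :=
  |coeff 0 f| ≤ C ∧ |coeff 1 f| ≤ C * s ∧ |coeff 2 f| ≤ C * s ^ 2

theorem JetBound.nonneg {f : ℝ⟦X⟧} {C s : ℝ} (h : JetBound f C s) : 0 ≤ C :=
  (abs_nonneg _).trans h.1

theorem JetBound.mono {f : ℝ⟦X⟧} {C C' s s' : ℝ} (h : JetBound f C s) (hC : C ≤ C') (hs : 0 ≤ s)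
    (hs' : s ≤ s') : JetBound f C' s' := by
  have h0 := h.nonneg
  refine ⟨h.1.trans hC, h.2.1.trans ?_, h.2.2.trans ?_⟩
  · exact mul_le_mul hC hs' hs (h0.trans hC)
  · exact mul_le_mul hC (pow_le_pow_left₀ hs hs' 2) (by positivity) (h0.trans hC)

theorem JetBound.add {f g : ℝ⟦X⟧} {C C' s : ℝ} (h : JetBound f C s) (h' : JetBound g C' s) :
    JetBound (f + g) (C + C') s := by
  refine ⟨?_, ?_, ?_⟩ <;> rw [map_add, ] <;> refine (abs_add_le _ _).trans ?_
  · linarith [h.1, h'.1]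
  · linarith [h.2.1, h'.2.1]
  · linarith [h.2.2, h'.2.2]

theorem JetBound.zero {s : ℝ} : JetBound 0 0 s := by
  simp [JetBound]

theorem JetBound.one {s : ℝ} (hs : 0 ≤ s) : JetBound 1 1 s := by
  simp [JetBound, coeff_one, hs]

theorem JetBound.mul {f g : ℝ⟦X⟧} {C C' s : ℝ} (h : JetBound f C s) (h' : JetBound g C' s)
    (hs : 0 ≤ s) : JetBound (f * g) (3 * C * C') s := by
  have hC := h.nonneg
  have hC' := h'.nonneg
  have hCC : 0 ≤ C * C' := mul_nonneg hC hC'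
  have m00 := mul_le_mul h.1 h'.1 (abs_nonneg _) hC
  have m01 := mul_le_mul h.1 h'.2.1 (abs_nonneg _) hC
  have m02 := mul_le_mul h.1 h'.2.2 (abs_nonneg _) hC
  have m10 := mul_le_mul h.2.1 h'.1 (abs_nonneg _) (by positivity)
  have m11 := mul_le_mul h.2.1 h'.2.1 (abs_nonneg _) (by positivity)
  have m20 := mul_le_mul h.2.2 h'.1 (abs_nonneg _) (by positivity)
  have hCs : 0 ≤ C * C' * s := by positivity
  refine ⟨?_, ?_, ?_⟩
  · rw [coeff_zero_mul', abs_mul]; linarith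
  · rw [coeff_one_mul']
    refine (abs_add_le _ _).trans ?_
    rw [abs_mul, abs_mul]; linarith
  · rw [coeff_two_mul]
    refine (abs_add_three _ _ _).trans ?_
    rw [abs_mul, abs_mul, abs_mul]; linarith

theorem JetBound.sum {κ : Type*} {S : Finset κ} {f : κ → ℝ⟦X⟧} {C s : ℝ}
    (h : ∀ i ∈ S, JetBound (f i) C s) : JetBound (∑ i ∈ S, f i) (S.card * C) s := by
  classical
  induction S using Finset.induction_on with
  | empty => simpa using JetBound.zero
  | insert a S ha ih =>
    rw [Finset.sum_insert ha, Finset.card_insert_of_notMem ha]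
    have h1 := (h a (Finset.mem_insert_self a S)).add
      (ih fun i hi => h i (Finset.mem_insert_of_mem hi))
    have : C + S.card * C = ((S.card + 1 : ℕ) : ℝ) * C := by push_cast; ring
    rwa [this] at h1

variable {ι : Type*}

theorem coeff_zero_inv_line (x ξ : ι → ℝ) (i : ι) : coeff 0 (line x ξ i)⁻¹ = (x i)⁻¹ := by
  rw [coeff_zero_eq_constantCoeff, constantCoeff_inv, ← coeff_zero_eq_constantCoeff,
    coeff_zero_line]

theorem line_mul_inv {x ξ : ι → ℝ} {i : ι} (h : x i ≠ 0) : line x ξ i * (line x ξ i)⁻¹ = 1 := by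
  refine PowerSeries.mul_inv_cancel _ ?_
  rwa [← coeff_zero_eq_constantCoeff, coeff_zero_line]

variable [DecidableEq ι]

theorem JetBound.esum {S : Finset ι} {f : ι → ℝ⟦X⟧} {C s : ℝ} (hC : 0 ≤ C) (hs : 0 ≤ s)
    (h : ∀ i ∈ S, JetBound (f i) C s) (m : ℕ) :
    JetBound (esum f S m) ((3 * C + 1) ^ S.card) s := by
  have hC1 : 1 ≤ 3 * C + 1 := by linarith
  induction S using Finset.induction_on generalizing m with
  | empty =>
    cases m with
    | zero => simpa using JetBound.one hs
    | succ m => simpa using (JetBound.zero (s := s)).mono zero_le_one hs le_rfl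
  | insert a S ha ih =>
    cases m with
    | zero => simpa using (JetBound.one hs).mono (one_le_pow₀ hC1) hs le_rfl
    | succ m =>
      have ih := ih fun i hi => h i (Finset.mem_insert_of_mem hi)
      rw [esum_insert f ha, Finset.card_insert_of_notMem ha]
      have h1 := ((h a (Finset.mem_insert_self a S)).mul (ih m) hs).add (ih (m + 1))
      have : 3 * C * (3 * C + 1) ^ S.card + (3 * C + 1) ^ S.card =
          (3 * C + 1) ^ (S.card + 1) := by ring
      rwa [this] at h1

theorem coeff_one_inv_line {x ξ : ι → ℝ} {i : ι} (h : x i ≠ 0) :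
    coeff 1 (line x ξ i)⁻¹ = -(ξ i / x i) * (x i)⁻¹ := by
  have h1 := congrArg (coeff 1) (line_mul_inv (ξ := ξ) h)
  rw [coeff_one_mul', coeff_zero_line, coeff_one_line, coeff_zero_inv_line] at h1
  simp only [coeff_one, one_ne_zero, if_false] at h1
  field_simp
  field_simp at h1
  linarith

theorem coeff_two_inv_line {x ξ : ι → ℝ} {i : ι} (h : x i ≠ 0) :
    coeff 2 (line x ξ i)⁻¹ = (ξ i / x i) ^ 2 * (x i)⁻¹ := by
  have h1 := congrArg (coeff 2) (line_mul_inv (ξ := ξ) h)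
  rw [coeff_two_mul, coeff_zero_line, coeff_one_line, coeff_zero_inv_line, coeff_one_inv_line h,
    coeff_two_line] at h1
  simp only [coeff_one, OfNat.ofNat_ne_zero, if_false] at h1
  field_simp
  field_simp at h1
  linarith

theorem JetBound.inv_line {x ξ : ι → ℝ} {i : ι} {ρ s : ℝ} (hρ : 0 < ρ) (h : ρ ≤ x i)
    (hs : |ξ i / x i| ≤ s) : JetBound (line x ξ i)⁻¹ ρ⁻¹ s := by
  have hx : 0 < x i := hρ.trans_le h
  have hi : |(x i)⁻¹| ≤ ρ⁻¹ := by
    rw [abs_of_pos (inv_pos.2 hx)]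
    exact inv_anti₀ hρ h
  refine ⟨?_, ?_, ?_⟩
  · rwa [coeff_zero_inv_line]
  · rw [coeff_one_inv_line hx.ne', abs_mul, abs_neg, mul_comm]
    exact mul_le_mul hi hs (abs_nonneg _) (inv_nonneg.2 hρ.le)
  · rw [coeff_two_inv_line hx.ne', abs_mul, abs_pow, mul_comm]
    exact mul_le_mul hi (pow_le_pow_left₀ (abs_nonneg _) hs 2) (by positivity)
      (inv_nonneg.2 hρ.le)

theorem coeff_prod_line {x ξ : ι → ℝ} {S : Finset ι} (h : ∀ i ∈ S, x i ≠ 0) :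
    coeff 0 (∏ i ∈ S, line x ξ i) = ∏ i ∈ S, x i ∧
    coeff 1 (∏ i ∈ S, line x ξ i) = (∏ i ∈ S, x i) * ∑ i ∈ S, ξ i / x i ∧
    2 * coeff 2 (∏ i ∈ S, line x ξ i) =
      (∏ i ∈ S, x i) * ((∑ i ∈ S, ξ i / x i) ^ 2 - ∑ i ∈ S, (ξ i / x i) ^ 2) := by
  induction S using Finset.induction_on with
  | empty => simp [coeff_one]
  | insert a S ha ih =>
    obtain ⟨h0, h1, h2⟩ := ih fun i hi => h i (Finset.mem_insert_of_mem hi)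
    have hx := h a (Finset.mem_insert_self a S)
    simp only [Finset.prod_insert ha, Finset.sum_insert ha]
    have hξ : ξ a = x a * (ξ a / x a) := by field_simp
    generalize ξ a / x a = t at hξ ⊢
    refine ⟨?_, ?_, ?_⟩
    · rw [coeff_zero_mul', h0, coeff_zero_line]
    · rw [coeff_one_mul', h0, h1, coeff_zero_line, coeff_one_line, hξ]; ring
    · rw [coeff_two_mul, coeff_zero_line, coeff_one_line, coeff_two_line, h1, hξ]
      linear_combination x a * h2

end JetBounds

/-! ### Expansion of e_k over the two clusters, with its tail. -/

section Expansion

open PowerSeries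

variable {ι : Type*} [DecidableEq ι]

/-- The tail is padded with vanishing terms to a length N independent of `L`, so one estimate serves
both `L` and `L` with the distinguished index removed. -/
theorem esum_union_expansion {R : Type*} [CommRing R] (x y : ι → R) {L M : Finset ι}
    (hLM : Disjoint L M) (hxy : ∀ i ∈ L, x i * y i = 1) {N : ℕ} (hN : L.card ≤ N + 1) (d : ℕ) :
    esum x (L ∪ M) (L.card + (d + 1)) = (∏ i ∈ L, x i) *
      (esum x M (d + 1) + (∑ i ∈ L, y i) * esum x M (d + 2) +
        ∑ r ∈ Finset.range N, esum y L (r + 2) * esum x M (d + (r + 1) + 2)) := by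
  rw [esum_union_of_inverse x y L M hLM hxy]
  congr 1
  have h1 : ∑ r ∈ Finset.range (L.card + 1), esum y L r * esum x M (d + 1 + r) =
      ∑ r ∈ Finset.range (N + 2), esum y L r * esum x M (d + 1 + r) := by
    refine Finset.sum_subset (Finset.range_subset_range.2 (by omega)) fun r _ hr => ?_
    rw [Finset.mem_range, not_lt] at hr
    rw [esum_eq_zero y (by omega), zero_mul]
  rw [h1, Finset.sum_range_succ', Finset.sum_range_succ', esum_zero, esum_one]
  have h2 : ∀ r, d + 1 + (r + 1 + 1) = d + (r + 1) + 2 := fun r => by omega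
  simp only [h2, zero_add, add_zero, one_mul, show d + 1 + 1 = d + 2 by rfl]
  ring

theorem IsGarding.right {x : ι → ℝ} {L M : Finset ι} {k : ℕ} (hLM : Disjoint L M)
    (h : IsGarding x (L ∪ M) (L.card + k)) : IsGarding x M k := by
  induction L using Finset.induction_on generalizing k with
  | empty => simpa using h
  | insert a L ha ih =>
    have hd : Disjoint L M := hLM.mono_left (Finset.subset_insert a L)
    have haM : a ∉ M := Finset.disjoint_left.1 hLM (Finset.mem_insert_self a L)
    refine ih hd ?_
    rw [Finset.insert_union, Finset.card_insert_of_notMem ha,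
      show L.card + 1 + k = L.card + k + 1 by omega] at h
    have := h.erase (Finset.mem_insert_self a (L ∪ M))
    rwa [Finset.erase_insert (by simp [ha, haM])] at this

theorem jetBound_esum_line {x ξ : ι → ℝ} {S : Finset ι} {d r : ℕ} {B P v s : ℝ}
    (h : IsGarding x S (d + 1)) (hB : 0 ≤ B)
    (hb : ∀ p ∈ S, ∀ q ∈ S.erase p, |esum x ((S.erase p).erase q) (d + r)| ≤
        B * (√(esum x (S.erase p) d) * √(esum x (S.erase q) d)))
    (hP : 0 ≤ P) (hv : 1 ≤ v) (hs : 0 ≤ s)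
    (hV : ∑ i ∈ S, esum x (S.erase i) d * x i ^ 2 ≤ P * v)
    (hN : ∑ i ∈ S, esum x (S.erase i) d * ξ i ^ 2 ≤ P * s ^ 2) :
    JetBound (esum (line x ξ) S (d + r + 2)) (B * S.card * (P * v)) s := by
  obtain ⟨h0, h1, h2⟩ := abs_coeff_esum_line_le (ξ := ξ) h hB hb
  have hBS : 0 ≤ B * S.card := by positivity
  refine ⟨?_, h1.trans ?_, h2.trans ?_⟩
  · rw [coeff_zero_esum_line]
    exact h0.trans (mul_le_mul_of_nonneg_left hV hBS)
  · have h3 : √(∑ i ∈ S, esum x (S.erase i) d * x i ^ 2) *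
        √(∑ i ∈ S, esum x (S.erase i) d * ξ i ^ 2) ≤ √(P * v) * √(P * s ^ 2) :=
      mul_le_mul (Real.sqrt_le_sqrt hV) (Real.sqrt_le_sqrt hN) (Real.sqrt_nonneg _)
        (Real.sqrt_nonneg _)
    have h4 : √(P * v) * √(P * s ^ 2) ≤ P * v * s := by
      rw [← Real.sqrt_mul (by positivity)]
      refine Real.sqrt_le_iff.2 ⟨by positivity, ?_⟩
      have h5 : v ≤ v ^ 2 := le_self_pow₀ hv (by norm_num)
      have := mul_le_mul_of_nonneg_left h5 (by positivity : 0 ≤ P ^ 2 * s ^ 2)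
      linarith
    rw [mul_assoc (B * S.card)]
    exact mul_le_mul_of_nonneg_left (h3.trans h4) hBS
  · rw [mul_assoc (B * S.card)]
    refine mul_le_mul_of_nonneg_left (hN.trans ?_) hBS
    exact mul_le_mul_of_nonneg_right (le_mul_of_one_le_right hP hv) (sq_nonneg s)

/-- Every tail term contains a sum of degree at least d + 3 in the small variables, one more than Z,
and hence at least one factor κ. -/
theorem jetBound_tail {x ξ : ι → ℝ} {L M : Finset ι} {d N : ℕ} {C P v s ρ κ : ℝ}
    (h : IsGarding x M (d + 1)) (hC : 0 ≤ C) (hκ : 0 ≤ κ) (hκ1 : κ ≤ 1)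
    (hb : ∀ r ≤ N, ∀ p ∈ M, ∀ q ∈ M.erase p, |esum x ((M.erase p).erase q) (d + r)| ≤
        C * κ ^ r * (√(esum x (M.erase p) d) * √(esum x (M.erase q) d)))
    (hP : 0 ≤ P) (hv : 1 ≤ v) (hs : 0 ≤ s)
    (hV : ∑ i ∈ M, esum x (M.erase i) d * x i ^ 2 ≤ P * v)
    (hN : ∑ i ∈ M, esum x (M.erase i) d * ξ i ^ 2 ≤ P * s ^ 2)
    (hρ : 0 < ρ) (hx : ∀ i ∈ L, ρ ≤ x i) (ha : ∀ i ∈ L, |ξ i / x i| ≤ s)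
    (hL : L.card ≤ N) (hM : M.card ≤ N) :
    JetBound (∑ r ∈ Finset.range N, esum (fun i => (line x ξ i)⁻¹) L (r + 2) *
        esum (line x ξ) M (d + (r + 1) + 2))
      (3 * N ^ 2 * (3 * ρ⁻¹ + 1) ^ N * C * κ * (P * v)) s := by
  have hρ' : 0 ≤ ρ⁻¹ := inv_nonneg.2 hρ.le
  have h1 : 1 ≤ 3 * ρ⁻¹ + 1 := by linarith
  have hM' : (M.card : ℝ) ≤ N := by exact_mod_cast hM
  have hPv : 0 ≤ P * v := by positivity
  have key : ∀ r ∈ Finset.range N, JetBound (esum (fun i => (line x ξ i)⁻¹) L (r + 2) *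
      esum (line x ξ) M (d + (r + 1) + 2))
      (3 * (3 * ρ⁻¹ + 1) ^ N * (C * κ * N * (P * v))) s := by
    intro r hr
    have e1 := (JetBound.esum hρ' hs (fun i hi => JetBound.inv_line hρ (hx i hi) (ha i hi))
      (r + 2)).mono (pow_le_pow_right₀ h1 hL) hs le_rfl
    have e2 := jetBound_esum_line (ξ := ξ) h (by positivity : 0 ≤ C * κ ^ (r + 1))
      (hb (r + 1) (Finset.mem_range.1 hr)) hP hv hs hV hN
    have e3 : C * κ ^ (r + 1) * M.card * (P * v) ≤ C * κ * N * (P * v) := by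
      refine mul_le_mul_of_nonneg_right (mul_le_mul ?_ hM' (by positivity) (by positivity)) hPv
      exact mul_le_mul_of_nonneg_left (pow_le_of_le_one hκ hκ1 (Nat.succ_ne_zero r)) hC
    exact e1.mul (e2.mono e3 hs le_rfl) hs
  have := JetBound.sum key
  rw [Finset.card_range] at this
  exact this.mono (le_of_eq (by ring)) hs le_rfl

end Expansion

/-! ### Normalized jets of the small cluster. -/

section Cluster

open PowerSeries

variable {ι : Type*}

theorem sum_weight_mul_add_sq_nonneg {S : Finset ι} {w : ι → ℝ} (hw : ∀ i ∈ S, 0 ≤ w i)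
    (f g : ι → ℝ) (t : ℝ) :
    0 ≤ ∑ i ∈ S, w i * f i ^ 2 + 2 * t * ∑ i ∈ S, w i * (g i * f i) +
      t ^ 2 * ∑ i ∈ S, w i * g i ^ 2 := by
  have h : ∑ i ∈ S, w i * f i ^ 2 + 2 * t * ∑ i ∈ S, w i * (g i * f i) +
      t ^ 2 * ∑ i ∈ S, w i * g i ^ 2 = ∑ i ∈ S, w i * (f i + t * g i) ^ 2 := by
    rw [Finset.mul_sum, Finset.mul_sum, ← Finset.sum_add_distrib, ← Finset.sum_add_distrib]
    exact Finset.sum_congr rfl fun i _ => by ring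
  rw [h]
  exact Finset.sum_nonneg fun i hi => mul_nonneg (hw i hi) (sq_nonneg _)

variable [DecidableEq ι]

/-- Normalized jets of `e_{d+1}` and of the quotient `e_{d+2} / e_{d+1}` along a line. -/
theorem quotient_jet_facts {x ξ : ι → ℝ} {S : Finset ι} {d : ℕ} (h : IsGarding x S (d + 1))
    {w : ι → ℝ} (hw : ∀ i, w i = esum x (S.erase i) d / esum x S (d + 1)) {P b π2 : ℝ}
    (hP : P = esum x S (d + 1)) (hb : b = coeff 1 (esum (line x ξ) S (d + 1)) / P)
    (hπ : π2 = coeff 2 (esum (line x ξ) S (d + 1)) / P) :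
    ∃ H H1 H2 Wη Wd D : ℝ,
      esum x S (d + 2) = P * H ∧
      coeff 1 (esum (line x ξ) S (d + 2)) = P * (H1 + H * b) ∧
      coeff 2 (esum (line x ξ) S (d + 2)) = P * (H2 + H1 * b + H * π2) ∧
      2 * π2 ≤ (1 - 1 / ((d : ℝ) + 1)) * b ^ 2 ∧
      ((d : ℝ) + 1 + 1) * H = ∑ i ∈ S, x i - ∑ i ∈ S, w i * x i ^ 2 ∧
      ((d : ℝ) + 1 + 1) * H1 = ∑ i ∈ S, ξ i - Wη - Wd ∧
      ((d : ℝ) + 1 + 1) * H2 ≤ -D ∧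
      (∀ t : ℝ, 0 ≤ D + 2 * t * Wd + t ^ 2 * ∑ i ∈ S, w i * x i ^ 2) ∧
      (∀ t : ℝ, 0 ≤ ∑ i ∈ S, w i * ξ i ^ 2 + 2 * t * Wη + t ^ 2 * ∑ i ∈ S, w i * x i ^ 2) := by
  have hP0 : 0 < esum x S (d + 1) := h _ le_rfl
  have hwn : ∀ i ∈ S, 0 ≤ w i := fun i hi => by
    rw [hw]; exact div_nonneg (h.erase hi _ le_rfl).le hP0.le
  have hZ : esum (line x ξ) S (d + 2) = esum (line x ξ) S (d + 1) * quotLine x ξ S (d + 1) := by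
    rw [quotLine, mul_left_comm, esum_line_mul_inv hP0, mul_one]
  have eb : coeff 1 (esum (line x ξ) S (d + 1)) = P * b := by
    rw [hb, hP]; field_simp
  have eπ : coeff 2 (esum (line x ξ) S (d + 1)) = P * π2 := by
    rw [hπ, hP]; field_simp
  have eP : coeff 0 (esum (line x ξ) S (d + 1)) = P := by rw [coeff_zero_esum_line, hP]
  have eH : esum x S (d + 2) = P * coeff 0 (quotLine x ξ S (d + 1)) := by
    rw [← coeff_zero_esum_line x ξ, hZ, coeff_zero_mul', eP]
  have h1 := coeff_one_quotLine (ξ := ξ) h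
  have h2 := coeff_two_quotLine_le (ξ := ξ) h
  refine ⟨coeff 0 (quotLine x ξ S (d + 1)), coeff 1 (quotLine x ξ S (d + 1)),
    coeff 2 (quotLine x ξ S (d + 1)), ∑ i ∈ S, w i * (x i * ξ i),
    ∑ i ∈ S, w i * (x i * (ξ i - x i * logQuotErase x ξ S d i)),
    ∑ i ∈ S, w i * (ξ i - x i * logQuotErase x ξ S d i) ^ 2, eH, ?_, ?_, ?_, ?_, ?_, ?_,
    sum_weight_mul_add_sq_nonneg hwn _ _, sum_weight_mul_add_sq_nonneg hwn _ _⟩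
  · rw [hZ, coeff_one_mul', eP, eb]; ring
  · rw [hZ, coeff_two_mul, eP, eb, eπ]; ring
  · have h3 := esum_line_garding (ξ := ξ) h
    rw [eb, eπ, ← hP] at h3
    rw [← hP] at hP0
    have h4 : P ^ 2 * (2 * (d + 1) * π2) ≤ P ^ 2 * (d * b ^ 2) := by linarith
    have h5 := le_of_mul_le_mul_left h4 (by positivity)
    have hd : (0 : ℝ) < d + 1 := by positivity
    have h6 : (1 - 1 / ((d : ℝ) + 1)) * b ^ 2 = d * b ^ 2 / (d + 1) := by field_simp; ring
    rw [h6, le_div_iff₀ hd]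
    linarith
  · have h3 := sum_sq_mul_esum_erase x S d
    rw [esum_one, eH, ← hP] at h3
    have h4 : ∑ i ∈ S, w i * x i ^ 2 = (∑ i ∈ S, x i ^ 2 * esum x (S.erase i) d) / P := by
      rw [Finset.sum_div]
      exact Finset.sum_congr rfl fun i _ => by rw [hw, hP]; ring
    rw [h4, h3]
    rw [← hP] at hP0
    field_simp
    ring
  · rw [show (d : ℝ) + 1 + 1 = d + 2 by ring, h1, sub_sub, ← Finset.sum_add_distrib]
    congr 1
    exact Finset.sum_congr rfl fun i _ => by rw [hw]; ring
  · rw [show (d : ℝ) + 1 + 1 = d + 2 by ring]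
    refine h2.trans (le_of_eq ?_)
    simp only [hw]

/-- The jet of a product whose first factor has logarithmic jet given by `α` and `A`. -/
theorem jet_product {Λ G : ℝ⟦X⟧} {l P α A g0 g1 g2 : ℝ} (h0 : coeff 0 Λ = l)
    (h1 : coeff 1 Λ = l * α) (h2 : 2 * coeff 2 Λ = l * (α ^ 2 - A)) (e0 : coeff 0 G = P * g0)
    (e1 : coeff 1 G = P * g1) (e2 : coeff 2 G = P * g2) :
    coeff 0 (Λ * G) = l * P * g0 ∧ coeff 1 (Λ * G) = l * P * (g1 + α * g0) ∧
      -2 * coeff 2 (Λ * G) = l * P * (-2 * g2 - 2 * α * g1 - (α ^ 2 - A) * g0) := by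
  refine ⟨?_, ?_, ?_⟩
  · rw [coeff_zero_mul', h0, e0]; ring
  · rw [coeff_one_mul', h0, e0, e1, h1]; ring
  · rw [coeff_two_mul, h0, e0, e1, e2, h1]
    linear_combination (-P * g0) * h2

theorem coeff_zero_esum_inv_line (x ξ : ι → ℝ) (S : Finset ι) (m : ℕ) :
    coeff 0 (esum (fun i => (line x ξ i)⁻¹) S m) = esum (fun i => (x i)⁻¹) S m := by
  rw [coeff_zero_eq_constantCoeff, map_esum]
  congr 1
  funext i
  rw [← coeff_zero_eq_constantCoeff, coeff_zero_inv_line]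

/-- Lower bound for the derivative of `e_k` in a small direction. -/
theorem weight_le_esum_erase {x : ι → ℝ} {L M : Finset ι} (hLM : Disjoint L M) {d N : ℕ}
    {C ρ κ : ℝ} (hρ : 0 < ρ) (hx : ∀ i ∈ L, ρ ≤ x i) (hC : 0 ≤ C) (hκ : 0 ≤ κ) (hκ1 : κ ≤ 1)
    (hL : L.card ≤ N) {i : ι} (hi : i ∈ M) (hw : 0 ≤ esum x (M.erase i) d)
    (hb : ∀ r ≤ N, |esum x (M.erase i) (d + r)| ≤ C * κ ^ r * esum x (M.erase i) d) :
    (∏ i ∈ L, x i) * ((1 - N * (3 * ρ⁻¹ + 1) ^ N * C * κ) * esum x (M.erase i) d) ≤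
      esum x ((L ∪ M).erase i) (L.card + d) := by
  have hiL : i ∉ L := Finset.disjoint_right.1 hLM hi
  have hxp : ∀ i ∈ L, 0 < x i := fun i hi => hρ.trans_le (hx i hi)
  have hρ' : 0 ≤ ρ⁻¹ := inv_nonneg.2 hρ.le
  have h1 : 1 ≤ 3 * ρ⁻¹ + 1 := by linarith
  rw [Finset.erase_union_distrib, Finset.erase_eq_of_notMem hiL,
    esum_union_of_inverse x (fun i => (x i)⁻¹) L _
      (hLM.mono_right (Finset.erase_subset i M)) (fun i hi => mul_inv_cancel₀ (hxp i hi).ne')]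
  refine mul_le_mul_of_nonneg_left ?_ (Finset.prod_nonneg fun i hi => (hxp i hi).le)
  -- The term r = 0 is the weight itself; each later term is smaller by a factor of order κ.
  rw [Finset.sum_range_succ', esum_zero, one_mul, add_zero]
  have key : ∀ r ∈ Finset.range L.card,
      -((3 * ρ⁻¹ + 1) ^ N * (C * κ * esum x (M.erase i) d)) ≤
      esum (fun i => (x i)⁻¹) L (r + 1) * esum x (M.erase i) (d + (r + 1)) := by
    intro r hr
    have e1 := (JetBound.esum hρ' le_rfl (fun i hi => JetBound.inv_line (ξ := fun _ => 0) hρ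
      (hx i hi) (by simp)) (r + 1)).1
    rw [coeff_zero_esum_inv_line] at e1
    have e2 := e1.trans (pow_le_pow_right₀ h1 hL)
    have e3 := hb (r + 1) (by rw [Finset.mem_range] at hr; omega)
    have e4 : C * κ ^ (r + 1) * esum x (M.erase i) d ≤ C * κ * esum x (M.erase i) d :=
      mul_le_mul_of_nonneg_right
        (mul_le_mul_of_nonneg_left (pow_le_of_le_one hκ hκ1 (Nat.succ_ne_zero r)) hC) hw
    have e5 := mul_le_mul e2 (e3.trans e4) (abs_nonneg _) (by positivity)
    rw [← abs_mul] at e5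
    exact (abs_le.1 e5).1
  have h2 := Finset.sum_le_sum key
  rw [Finset.sum_const, Finset.card_range, nsmul_eq_mul] at h2
  have h3 : (L.card : ℝ) * ((3 * ρ⁻¹ + 1) ^ N * (C * κ * esum x (M.erase i) d)) ≤
      N * ((3 * ρ⁻¹ + 1) ^ N * (C * κ * esum x (M.erase i) d)) :=
    mul_le_mul_of_nonneg_right (by exact_mod_cast hL) (by positivity)
  linarith

end Cluster

/-! ### The inequality for a vector split into a large and a small cluster. -/

section Normalized

open PowerSeries

variable {ι : Type*}

/-- The cluster `S` has normalized weights bounded below. -/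
theorem sq_sum_le_of_weight {S : Finset ι} {w ξ : ι → ℝ} {N κ : ℝ} (hN : (S.card : ℝ) ≤ N)
    (hw : ∀ i ∈ S, 1 ≤ (N + 1) * κ * w i) (hw0 : ∀ i ∈ S, 0 ≤ w i) :
    (∑ i ∈ S, ξ i) ^ 2 ≤ (N + 1) ^ 2 * κ * ∑ i ∈ S, w i * ξ i ^ 2 := by
  have hN0 : 0 ≤ N := (Nat.cast_nonneg _).trans hN
  have h1 : (∑ i ∈ S, ξ i) ^ 2 ≤ S.card * ∑ i ∈ S, ξ i ^ 2 := sq_sum_le_card_mul_sum_sq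
  have h2 : ∑ i ∈ S, ξ i ^ 2 ≤ (N + 1) * κ * ∑ i ∈ S, w i * ξ i ^ 2 := by
    rw [Finset.mul_sum]
    refine Finset.sum_le_sum fun i hi => ?_
    have := mul_le_mul_of_nonneg_right (hw i hi) (sq_nonneg (ξ i))
    linarith
  have h0 : 0 ≤ ∑ i ∈ S, w i * ξ i ^ 2 :=
    Finset.sum_nonneg fun i hi => mul_nonneg (hw0 i hi) (sq_nonneg _)
  have h3 := mul_le_mul (hN.trans (by linarith : N ≤ N + 1)) h2
    (Finset.sum_nonneg fun i _ => sq_nonneg (ξ i)) (by linarith)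
  linarith

variable [DecidableEq ι]

/-- The jet of `∑ 1 / (x i + ξ i X)`. -/
theorem coeff_sum_inv_line {x ξ : ι → ℝ} {S : Finset ι} (h : ∀ i ∈ S, x i ≠ 0) :
    coeff 0 (∑ i ∈ S, (line x ξ i)⁻¹) = ∑ i ∈ S, (x i)⁻¹ ∧
    coeff 1 (∑ i ∈ S, (line x ξ i)⁻¹) = -∑ i ∈ S, (x i)⁻¹ * (ξ i / x i) ∧
    coeff 2 (∑ i ∈ S, (line x ξ i)⁻¹) = ∑ i ∈ S, (x i)⁻¹ * (ξ i / x i) ^ 2 := by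
  refine ⟨?_, ?_, ?_⟩
  · rw [map_sum]
    exact Finset.sum_congr rfl fun i _ => coeff_zero_inv_line x ξ i
  · rw [map_sum, ← Finset.sum_neg_distrib]
    exact Finset.sum_congr rfl fun i hi => by rw [coeff_one_inv_line (h i hi)]; ring
  · rw [map_sum]
    exact Finset.sum_congr rfl fun i hi => by rw [coeff_two_inv_line (h i hi)]; ring

/-- A priori bound for the second moment `v` of a small cluster. -/
theorem cluster_moment_bound {E H r0 v s1 J T : ℝ} (hE : 1 ≤ E) (hJ : 1 ≤ J)
    (hg : 0 < 1 + E * H + r0) (hH : J * H = s1 - v) (hs1 : s1 ≤ 1) (hr0 : |r0| ≤ T * max 1 v)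
    (hT : J * T ≤ 1 / 2) : max 1 v ≤ 2 * (J + 1) := by
  refine max_le (by linarith) ?_
  have hr := (abs_le.1 hr0).2
  have h1 : -H ≤ 1 + T * max 1 v := by
    rcases le_or_gt 0 H with h | h
    · have : 0 ≤ T * max 1 v := (abs_nonneg _).trans hr0
      linarith
    · have : E * H ≤ 1 * H := mul_le_mul_of_nonpos_right hE h.le
      linarith
  have h2 := mul_le_mul_of_nonneg_left h1 (by linarith : 0 ≤ J)
  have h3 : J * T * max 1 v ≤ 1 / 2 * max 1 v :=
    mul_le_mul_of_nonneg_right hT (le_max_of_le_left zero_le_one)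
  -- Positivity of the bracket keeps H above about -1, hence v = s1 - JH bounded. The tail bound
  -- itself involves v, and JT ≤ 1/2 lets it be absorbed.
  rcases max_cases 1 v with ⟨h, _⟩ | ⟨h, _⟩ <;> rw [h] at h3 h2 <;> linarith

set_option maxHeartbeats 2000000 in
-- Divides by Λ P and supplies the hypotheses of `scalar_core` with j = d + 1. The weights are p_i =
-- x_i⁻¹/E, so p at the distinguished index is 1/E.
theorem normalized_inequality_of_bounds {x ξ : ι → ℝ} {L M : Finset ι} {i₀ : ι} {d N : ℕ}
    {C ρ κ ω Bd T W K k : ℝ} (hLM : Disjoint L M) (hcard : L.card + M.card ≤ N) (hi₀ : i₀ ∈ L)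
    (hx0 : x i₀ = 1) (hρ : 0 < ρ) (hxρ : ∀ i ∈ L, ρ ≤ x i) (hx1 : ∀ i ∈ L, x i ≤ 1)
    (hκ : 0 ≤ κ) (hκ1 : κ ≤ 1) (hxκ : ∀ i ∈ M, |x i| ≤ κ)
    (hG : IsGarding x (L ∪ M) (L.card + (d + 1))) (hC : 1 ≤ C)
    (hb : ∀ r ≤ N, ∀ p ∈ M, ∀ q ∈ M.erase p, |esum x ((M.erase p).erase q) (d + r)| ≤
        C * κ ^ r * (√(esum x (M.erase p) d) * √(esum x (M.erase q) d)))
    (hb' : ∀ r ≤ N, ∀ i ∈ M, |esum x (M.erase i) (d + r)| ≤ C * κ ^ r * esum x (M.erase i) d)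
    (hT : T = 3 * N ^ 2 * (3 * ρ⁻¹ + 1) ^ N * C) (hW : W = 2 * d + 6)
    (hBd : (N + 1) * (ρ⁻¹ + 1) + (C * N * W) ^ 2 + C * N * W ≤ Bd) (hω : 0 < ω)
    (hω1 : ω ≤ 1 / 4) (hk : k = L.card + (d + 1)) (hωB : ω * (10000000 * (k + 1) * Bd ^ 6) ≤ 1)
    (hTκ : T * κ * W ≤ ω) (hNκ : N * κ ≤ ω) (hNκ2 : (N + 1) ^ 2 * κ ≤ ω ^ 2) (hκω : κ ≤ ω / 2)
    (hK : 4 ≤ K) :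
    (1 + 1 / (8 * (k + 1))) * (esum x ((L ∪ M).erase i₀) (L.card + d) * ξ i₀ ^ 2) ≤
      -2 * coeff 2 (esum (line x ξ) (L ∪ M) (L.card + (d + 1))) +
        K * (coeff 1 (esum (line x ξ) (L ∪ M) (L.card + (d + 1))) ^ 2 /
          esum x (L ∪ M) (L.card + (d + 1))) +
        (2 - κ) * ∑ i ∈ M, esum x ((L ∪ M).erase i) (L.card + d) * ξ i ^ 2 := by
  have hgM : IsGarding x M (d + 1) := hG.right hLM
  set P := esum x M (d + 1) with hP
  have hP0 : 0 < P := hgM _ le_rfl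
  have hxp : ∀ i ∈ L, 0 < x i := fun i hi => hρ.trans_le (hxρ i hi)
  have hxne : ∀ i ∈ L, x i ≠ 0 := fun i hi => (hxp i hi).ne'
  have hLN : L.card ≤ N := by omega
  have hMN : M.card ≤ N := by omega
  have hMN' : (M.card : ℝ) ≤ N := by exact_mod_cast hMN
  have hLN' : (L.card : ℝ) ≤ N := by exact_mod_cast hLN
  have hL1 : 1 ≤ L.card := Finset.card_pos.2 ⟨i₀, hi₀⟩
  have hN1 : (1 : ℝ) ≤ N := by exact_mod_cast hL1.trans hLN
  have hρ' : 0 < ρ⁻¹ := inv_pos.2 hρ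
  obtain ⟨w, hw⟩ : ∃ w : ι → ℝ, ∀ i, w i = esum x (M.erase i) d / P := ⟨_, fun i => rfl⟩
  have hwP : ∀ i, esum x (M.erase i) d = P * w i := fun i => by rw [hw]; field_simp
  have hw0 : ∀ i ∈ M, 0 ≤ w i := fun i hi => by
    rw [hw]; exact div_nonneg (hgM.erase hi _ le_rfl).le hP0.le
  obtain ⟨b, hbdef⟩ : ∃ b, b = coeff 1 (esum (line x ξ) M (d + 1)) / P := ⟨_, rfl⟩
  obtain ⟨π2, hπdef⟩ : ∃ b, b = coeff 2 (esum (line x ξ) M (d + 1)) / P := ⟨_, rfl⟩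
  obtain ⟨H, H1, H2, Wη, Wd, D, hZ0, hZ1, hZ2, hπ, hJH, hJH1, hJH2, hWd, hWη⟩ :=
    quotient_jet_facts hgM hw hP hbdef hπdef
  have hP1 : coeff 1 (esum (line x ξ) M (d + 1)) = P * b := by rw [hbdef]; field_simp
  have hP2 : coeff 2 (esum (line x ξ) M (d + 1)) = P * π2 := by rw [hπdef]; field_simp
  obtain ⟨v, hv⟩ : ∃ v, v = ∑ i ∈ M, w i * x i ^ 2 := ⟨_, rfl⟩
  obtain ⟨n, hn⟩ : ∃ n, n = ∑ i ∈ M, w i * ξ i ^ 2 := ⟨_, rfl⟩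
  have hn0 : 0 ≤ n := by rw [hn]; exact Finset.sum_nonneg fun i hi => mul_nonneg (hw0 i hi) (sq_nonneg _)
  have hv0 : 0 ≤ v := by rw [hv]; exact Finset.sum_nonneg fun i hi => mul_nonneg (hw0 i hi) (sq_nonneg _)
  have hV : ∑ i ∈ M, esum x (M.erase i) d * x i ^ 2 = P * v := by
    rw [hv, Finset.mul_sum]; exact Finset.sum_congr rfl fun i _ => by rw [hwP]; ring
  have hNn : ∑ i ∈ M, esum x (M.erase i) d * ξ i ^ 2 = P * n := by
    rw [hn, Finset.mul_sum]; exact Finset.sum_congr rfl fun i _ => by rw [hwP]; ring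
  rw [← hv] at hJH hWd hWη
  rw [← hn] at hWη
  obtain ⟨a, ha⟩ : ∃ a : ι → ℝ, ∀ i, a i = ξ i / x i := ⟨_, fun _ => rfl⟩
  obtain ⟨A2, hA2⟩ : ∃ A2, A2 = ∑ i ∈ L, a i ^ 2 := ⟨_, rfl⟩
  have hA0 : 0 ≤ A2 := by rw [hA2]; exact Finset.sum_nonneg fun i _ => sq_nonneg _
  have hs2 : √(n + A2) ^ 2 = n + A2 := Real.sq_sqrt (by linarith)
  have hs0 := Real.sqrt_nonneg (n + A2)
  have has : ∀ i ∈ L, |ξ i / x i| ≤ √(n + A2) := fun i hi => by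
    rw [← ha]
    refine Real.abs_le_sqrt ?_
    have := Finset.single_le_sum (f := fun i => a i ^ 2) (fun i _ => sq_nonneg (a i)) hi
    rw [← hA2] at this
    linarith
  have hT0 : 0 ≤ T := by rw [hT]; positivity
  have hTbound : ∀ S ⊆ L, JetBound (∑ r ∈ Finset.range N, esum (fun i => (line x ξ i)⁻¹) S (r + 2) *
        esum (line x ξ) M (d + (r + 1) + 2)) (T * κ * (P * max 1 v)) √(n + A2) := by
    intro S hS
    rw [hT]
    refine jetBound_tail hgM (by linarith) hκ hκ1 hb hP0.le (le_max_left _ _) hs0 ?_ ?_ hρ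
      (fun i hi => hxρ i (hS hi)) (fun i hi => has i (hS hi))
      ((Finset.card_le_card hS).trans hLN) hMN
    · rw [hV]; exact mul_le_mul_of_nonneg_left (le_max_right _ _) hP0.le
    · rw [hNn, hs2]; exact mul_le_mul_of_nonneg_left (by linarith) hP0.le
  -- coefficients of the tail
  obtain ⟨R, hR⟩ : ∃ R, R = ∑ r ∈ Finset.range N, esum (fun i => (line x ξ i)⁻¹) L (r + 2) *
      esum (line x ξ) M (d + (r + 1) + 2) := ⟨_, rfl⟩
  have hRb := hTbound L subset_rfl
  rw [← hR] at hRb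
  obtain ⟨r0, hr0⟩ : ∃ r, r = coeff 0 R / P := ⟨_, rfl⟩
  obtain ⟨r1, hr1⟩ : ∃ r, r = coeff 1 R / P := ⟨_, rfl⟩
  obtain ⟨r2, hr2⟩ : ∃ r, r = coeff 2 R / P := ⟨_, rfl⟩
  have eR0 : coeff 0 R = P * r0 := by rw [hr0]; field_simp
  have eR1 : coeff 1 R = P * r1 := by rw [hr1]; field_simp
  have eR2 : coeff 2 R = P * r2 := by rw [hr2]; field_simp
  -- the large cluster
  obtain ⟨E, hE⟩ : ∃ E, E = ∑ i ∈ L, (x i)⁻¹ := ⟨_, rfl⟩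
  have hE1 : 1 ≤ E := by
    have := Finset.single_le_sum (f := fun i => (x i)⁻¹)
      (fun i hi => (inv_pos.2 (hxp i hi)).le) hi₀
    simp only [hx0, inv_one] at this
    rwa [hE]
  have hE0 : 0 < E := by linarith
  obtain ⟨p, hp⟩ : ∃ p : ι → ℝ, ∀ i, p i = (x i)⁻¹ / E := ⟨_, fun _ => rfl⟩
  have hxE : ∀ i, (x i)⁻¹ = E * p i := fun i => by rw [hp]; field_simp
  have hp1 : p i₀ = 1 / E := by rw [hp, hx0, inv_one]
  have ha1 : a i₀ = ξ i₀ := by rw [ha, hx0, div_one]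
  obtain ⟨q, hq⟩ : ∃ q, q = ∑ i ∈ L.erase i₀, p i * a i := ⟨_, rfl⟩
  obtain ⟨jE0, jE1, jE2⟩ := coeff_sum_inv_line (ξ := ξ) hxne
  have jE1' : coeff 1 (∑ i ∈ L, (line x ξ i)⁻¹) = -(E * (p i₀ * a i₀ + q)) := by
    rw [jE1, hq, Finset.add_sum_erase L (fun i => p i * a i) hi₀, Finset.mul_sum]
    congr 1
    exact Finset.sum_congr rfl fun i _ => by rw [hxE, ha]; ring
  obtain ⟨m2, hm2⟩ : ∃ m, m = p i₀ * a i₀ ^ 2 + ∑ i ∈ L.erase i₀, p i * a i ^ 2 := ⟨_, rfl⟩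
  have jE2' : coeff 2 (∑ i ∈ L, (line x ξ i)⁻¹) = E * m2 := by
    rw [jE2, hm2, Finset.add_sum_erase L (fun i => p i * a i ^ 2) hi₀, Finset.mul_sum]
    exact Finset.sum_congr rfl fun i _ => by rw [hxE, ha]; ring
  rw [← hE] at jE0
  obtain ⟨α, hα⟩ : ∃ α, α = a i₀ + ∑ i ∈ L.erase i₀, a i := ⟨_, rfl⟩
  obtain ⟨Λ, hΛ⟩ : ∃ Λ, Λ = ∏ i ∈ L, x i := ⟨_, rfl⟩
  have hΛ0 : 0 < Λ := by rw [hΛ]; exact Finset.prod_pos hxp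
  obtain ⟨jΛ0, jΛ1, jΛ2⟩ := coeff_prod_line (ξ := ξ) hxne
  simp only [← ha] at jΛ1 jΛ2
  rw [← hΛ] at jΛ0 jΛ1 jΛ2
  rw [← hA2] at jΛ2
  rw [← Finset.add_sum_erase L a hi₀, ← hα] at jΛ1 jΛ2
  obtain ⟨g0, hg0⟩ : ∃ g, g = 1 + E * H + r0 := ⟨_, rfl⟩
  obtain ⟨g1, hg1⟩ : ∃ g, g = b + E * (H1 + H * b) - E * (p i₀ * a i₀ + q) * H + r1 := ⟨_, rfl⟩
  obtain ⟨g2, hg2⟩ : ∃ g, g = π2 + E * (H2 + H1 * b + H * π2) -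
    E * (p i₀ * a i₀ + q) * (H1 + H * b) + E * m2 * H + r2 := ⟨_, rfl⟩
  have hexp := esum_union_expansion (line x ξ) (fun i => (line x ξ i)⁻¹) hLM
    (fun i hi => line_mul_inv (hxne i hi)) (by omega : L.card ≤ N + 1) d
  rw [← hR] at hexp
  obtain ⟨f0, f1, f2⟩ := jet_product
    (G := esum (line x ξ) M (d + 1) + (∑ i ∈ L, (line x ξ i)⁻¹) * esum (line x ξ) M (d + 2) + R)
    (g0 := g0) (g1 := g1) (g2 := g2) (P := P) jΛ0 jΛ1 jΛ2
    (by rw [map_add, map_add, coeff_zero_mul', coeff_zero_esum_line, coeff_zero_esum_line, ← hP,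
      jE0, hZ0, eR0, hg0]; ring)
    (by rw [map_add, map_add, coeff_one_mul', coeff_zero_esum_line, jE0, jE1', hZ0, hZ1, hP1, eR1,
      hg1]; ring)
    (by rw [map_add, map_add, coeff_two_mul, coeff_zero_esum_line, jE0, jE1', jE2', hZ0, hZ1, hZ2,
      hP2, eR2, hg2]; ring)
  rw [← hexp] at f0 f1 f2
  rw [coeff_zero_esum_line] at f0
  have hg0p : 0 < g0 := by
    have h1 : 0 < Λ * P * g0 := by rw [← f0]; exact hG _ le_rfl
    exact (mul_pos_iff_of_pos_left (by positivity)).1 h1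
  -- bounds on the tail
  have hW6 : 6 ≤ W := by rw [hW]; have : (0 : ℝ) ≤ d := by positivity
                         linarith
  have hTκ0 : 0 ≤ T * κ := by positivity
  have hTκ6 : T * κ * 6 ≤ ω := (mul_le_mul_of_nonneg_left hW6 hTκ0).trans hTκ
  have hs1 : |∑ i ∈ M, x i| ≤ ω := by
    refine (Finset.abs_sum_le_sum_abs _ _).trans ((Finset.sum_le_card_nsmul _ _ κ hxκ).trans ?_)
    rw [nsmul_eq_mul]
    exact (mul_le_mul_of_nonneg_right hMN' hκ).trans hNκ
  have hdivP : ∀ {y B : ℝ}, |y| ≤ B → |y / P| ≤ B / P := fun h => by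
    rw [abs_div, abs_of_pos hP0]; exact div_le_div_of_nonneg_right h hP0.le
  have hr0v : |r0| ≤ T * κ * max 1 v := by
    rw [hr0]
    refine (hdivP hRb.1).trans (le_of_eq ?_)
    field_simp
  -- W = 2d + 6 is the bound 2(J + 1) at J = d + 2. Only now can the tail estimates be replaced by
  -- multiples of ω free of v.
  have hvW : max 1 v ≤ W := by
    refine (cluster_moment_bound (J := (d : ℝ) + 1 + 1) hE1 ?_ (by rw [← hg0]; exact hg0p) hJH ?_
      hr0v ?_).trans (by rw [hW]; linarith)
    · have : (0 : ℝ) ≤ d := by positivity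
      linarith
    · linarith [(abs_le.1 hs1).2]
    · have h1 : ((d : ℝ) + 1 + 1) * (T * κ) ≤ W * (T * κ) := by
        refine mul_le_mul_of_nonneg_right ?_ hTκ0
        rw [hW]
        have : (0 : ℝ) ≤ d := by positivity
        linarith
      linarith
  have hTκv : T * κ * (P * max 1 v) ≤ P * ω := by
    have h1 := (mul_le_mul_of_nonneg_left hvW hTκ0).trans hTκ
    have := mul_le_mul_of_nonneg_left h1 hP0.le
    linarith
  have hRω : ∀ S ⊆ L, JetBound (∑ r ∈ Finset.range N, esum (fun i => (line x ξ i)⁻¹) S (r + 2) *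
        esum (line x ξ) M (d + (r + 1) + 2)) (P * ω) √(n + A2) := fun S hS =>
    (hTbound S hS).mono hTκv hs0 le_rfl
  obtain ⟨b0, b1, b2⟩ := hRω L subset_rfl
  rw [← hR] at b0 b1 b2
  have hr0ω : |r0| ≤ ω := by
    rw [hr0]; refine (hdivP b0).trans (le_of_eq ?_); field_simp
  have hr1ω : r1 ^ 2 ≤ ω ^ 2 * (n + A2) := by
    have h1 : |r1| ≤ ω * √(n + A2) := by
      rw [hr1]; refine (hdivP b1).trans (le_of_eq ?_); field_simp
    have h2 := pow_le_pow_left₀ (abs_nonneg _) h1 2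
    rwa [sq_abs, mul_pow, hs2] at h2
  have hr2ω : |r2| ≤ ω * (n + A2) := by
    rw [hr2]; refine (hdivP b2).trans (le_of_eq ?_); rw [hs2]; field_simp
  obtain ⟨rh, hrh⟩ : ∃ r, r = (∑ r ∈ Finset.range N,
    esum (fun i => (x i)⁻¹) (L.erase i₀) (r + 2) * esum x M (d + (r + 1) + 2)) / P := ⟨_, rfl⟩
  have hrhω : |rh| ≤ ω := by
    have h1 := (hRω (L.erase i₀) (Finset.erase_subset _ _)).1
    rw [map_sum] at h1
    simp only [coeff_zero_mul', coeff_zero_esum_inv_line, coeff_zero_esum_line] at h1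
    rw [hrh]; refine (hdivP h1).trans (le_of_eq ?_); field_simp
  -- the quotient jets
  have hBdpos : (0 : ℝ) ≤ C * N * W := by positivity
  have hρN : 0 ≤ (N + 1) * (ρ⁻¹ + 1) := by positivity
  have hZb : JetBound (esum (line x ξ) M (d + 2)) (P * (C * N * W)) √n := by
    have h1 := jetBound_esum_line (ξ := ξ) (r := 0) (B := C) (P := P) (s := √n) (v := max 1 v)
      hgM (by linarith) (fun p hp q hq => by simpa using hb 0 (Nat.zero_le _) p hp q hq) hP0.le
      (le_max_left _ _) (Real.sqrt_nonneg _)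
      (by rw [hV]; exact mul_le_mul_of_nonneg_left (le_max_right _ _) hP0.le)
      (by rw [hNn, Real.sq_sqrt hn0])
    refine h1.mono ?_ (Real.sqrt_nonneg _) le_rfl
    have h2 : C * M.card * (P * max 1 v) ≤ C * N * (P * W) :=
      mul_le_mul (mul_le_mul_of_nonneg_left hMN' (by linarith))
        (mul_le_mul_of_nonneg_left hvW hP0.le) (by positivity) (by positivity)
    linarith
  have hζ1 : (H1 + H * b) ^ 2 ≤ Bd * n := by
    have h1 := hZb.2.1
    rw [hZ1, abs_mul, abs_of_pos hP0, mul_assoc P] at h1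
    have h2 := pow_le_pow_left₀ (abs_nonneg _) (le_of_mul_le_mul_left h1 hP0) 2
    rw [sq_abs, mul_pow (C * N * W), Real.sq_sqrt hn0] at h2
    exact h2.trans (mul_le_mul_of_nonneg_right (by linarith) hn0)
  have hζ2 : |H2 + H1 * b + H * π2| ≤ Bd * n := by
    have h1 := hZb.2.2
    rw [hZ2, abs_mul, abs_of_pos hP0, mul_assoc P, Real.sq_sqrt hn0] at h1
    have h2 := le_of_mul_le_mul_left h1 hP0
    exact h2.trans (mul_le_mul_of_nonneg_right (by linarith [sq_nonneg (C * N * W)]) hn0)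
  have hEB : E ≤ Bd := by
    have h1 : E ≤ L.card • ρ⁻¹ := by
      rw [hE]
      exact Finset.sum_le_card_nsmul _ _ _ fun i hi => inv_anti₀ hρ (hxρ i hi)
    rw [nsmul_eq_mul] at h1
    have h2 := mul_le_mul_of_nonneg_right hLN' hρ'.le
    linarith [sq_nonneg (C * N * W)]
  have hLc : ((L.erase i₀).card : ℝ) + 1 = L.card := by
    exact_mod_cast Finset.card_erase_add_one hi₀
  have hLB : ((L.erase i₀).card : ℝ) + 1 ≤ Bd := by
    have : 0 ≤ N * ρ⁻¹ := by positivity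
    rw [hLc]
    linarith [sq_nonneg (C * N * W)]
  -- The normalized weights on the small cluster are at least 1/((N + 1)κ), so n dominates ∑ξ_i²
  -- strongly.
  have hSη : (∑ i ∈ M, ξ i) ^ 2 ≤ ω ^ 2 * n := by
    have h1 := sq_sum_le_of_weight (ξ := ξ) (w := w) hMN' (κ := κ) (fun i hi => ?_) hw0
    · rw [← hn] at h1
      exact h1.trans (mul_le_mul_of_nonneg_right hNκ2 hn0)
    · have h2 := hgM.esum_le_weight hκ hxκ hi
      rw [← hP, hwP] at h2
      have h3 : P * 1 ≤ P * ((M.card + 1) * κ * w i) := by linarith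
      refine (le_of_mul_le_mul_left h3 hP0).trans ?_
      exact mul_le_mul_of_nonneg_right (mul_le_mul_of_nonneg_right (by linarith) hκ) (hw0 i hi)
  have hsump : p i₀ + ∑ i ∈ L.erase i₀, p i = 1 := by
    rw [Finset.add_sum_erase L p hi₀]
    simp only [hp]
    rw [← Finset.sum_div, ← hE, div_self hE0.ne']
  have hpge : ∀ i ∈ L.erase i₀, p i₀ ≤ p i := fun i hi => by
    rw [hp1, hp]
    have hiL := Finset.mem_of_mem_erase hi
    refine div_le_div_of_nonneg_right ?_ hE0.le
    exact (one_le_inv₀ (hxp i hiL)).2 (hx1 i hiL)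
  have hcore := scalar_core (L.erase i₀) a p (a1 := a i₀) (p1 := p i₀)
    (abar := p i₀ * a i₀ + q) (q := q) (m2 := m2) (A2 := A2) (α := α) (b := b) (g0 := g0)
    (g1 := g1) (g2 := g2) (τ := g1 + α * g0) (ω := ω) (K := K) (E := E) (H := H) (H1 := H1)
    (H2 := H2) (ζ1 := H1 + H * b) (ζ2 := H2 + H1 * b + H * π2) (π2 := π2) (r0 := r0) (r1 := r1)
    (r2 := r2) (rh := rh) (n := n) (v := v) (s1 := ∑ i ∈ M, x i) (Sη := ∑ i ∈ M, ξ i) (Wη := Wη)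
    (Wd := Wd) (D := D) (j := (d : ℝ) + 1) (k := k) (Bd := Bd) (by simp) (by rw [hk, hLc])
    (by rw [hp1]; positivity) hpge hsump hK
    (by rw [hA2, Finset.add_sum_erase L (fun i => a i ^ 2) hi₀]) hq rfl hm2 hα
    (by rw [hp1]; field_simp) hEB hLB hω hωB hg0p hg0 hg1 hg2 rfl rfl rfl hπ hJH hJH1 hJH2 hv0 hn0
    hs1 hr0ω hr1ω hr2ω hrhω hζ1 hζ2 hSη hWd hWη
  -- the derivatives
  have hS1 : esum x ((L ∪ M).erase i₀) (L.card + d) = Λ * P * (1 + (E - 1) * H + rh) := by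
    have hiM : i₀ ∉ M := Finset.disjoint_left.1 hLM hi₀
    have hc : L.card + d = (L.erase i₀).card + (d + 1) := by
      have := Finset.card_erase_add_one hi₀
      omega
    have hce : (L.erase i₀).card ≤ L.card := Finset.card_le_card (Finset.erase_subset _ _)
    rw [Finset.erase_union_distrib, Finset.erase_eq_of_notMem hiM, hc,
      esum_union_expansion x (fun i => (x i)⁻¹) (hLM.mono_left (Finset.erase_subset i₀ L))
        (fun i hi => mul_inv_cancel₀ (hxne i (Finset.mem_of_mem_erase hi)))
        (by omega : (L.erase i₀).card ≤ N + 1) d]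
    have e1 : ∏ i ∈ L.erase i₀, x i = Λ := by
      rw [hΛ, ← Finset.mul_prod_erase L x hi₀, hx0, one_mul]
    have e2 : ∑ i ∈ L.erase i₀, (x i)⁻¹ = E - 1 := by
      have := Finset.add_sum_erase L (fun i => (x i)⁻¹) hi₀
      rw [← hE, hx0, inv_one] at this
      linarith
    have e3 : ∑ r ∈ Finset.range N, esum (fun i => (x i)⁻¹) (L.erase i₀) (r + 2) *
        esum x M (d + (r + 1) + 2) = P * rh := by rw [hrh]; field_simp
    rw [e1, e2, e3, hZ0, ← hP]
    ring
  have hSM : Λ * P * ((2 - ω) * n) ≤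
      (2 - κ) * ∑ i ∈ M, esum x ((L ∪ M).erase i) (L.card + d) * ξ i ^ 2 := by
    have h1 : ∀ i ∈ M, Λ * P * ((1 - ω / 4) * (w i * ξ i ^ 2)) ≤
        esum x ((L ∪ M).erase i) (L.card + d) * ξ i ^ 2 := by
      intro i hi
      have h2 := weight_le_esum_erase hLM hρ hxρ (by linarith : 0 ≤ C) hκ hκ1 hLN hi
        (hgM.erase hi _ le_rfl).le (fun r hr => hb' r hr i hi)
      rw [← hΛ, hwP] at h2
      have h3 : N * (3 * ρ⁻¹ + 1) ^ N * C * κ ≤ ω / 4 := by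
        have h4 : (N : ℝ) ≤ 3 * N ^ 2 := by
          have := mul_le_mul_of_nonneg_right hN1 (by linarith : (0 : ℝ) ≤ N)
          linarith
        have h5 : N * (3 * ρ⁻¹ + 1) ^ N * C * κ ≤ T * κ := by
          rw [hT]
          refine mul_le_mul_of_nonneg_right (mul_le_mul_of_nonneg_right
            (mul_le_mul_of_nonneg_right h4 (by positivity)) (by linarith)) hκ
        linarith
      have h6 := mul_le_mul_of_nonneg_right h3 (mul_nonneg (mul_nonneg hΛ0.le hP0.le) (hw0 i hi))
      have h7 : Λ * P * (1 - ω / 4) * w i ≤ esum x ((L ∪ M).erase i) (L.card + d) := by linarith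
      have h8 := mul_le_mul_of_nonneg_right h7 (sq_nonneg (ξ i))
      linarith
    have h2 := Finset.sum_le_sum h1
    rw [← Finset.mul_sum, ← Finset.mul_sum, ← hn] at h2
    have h3 := mul_le_mul_of_nonneg_left h2 (by linarith : 0 ≤ 2 - κ)
    have h4 : (2 - ω) ≤ (2 - κ) * (1 - ω / 4) := by
      have : 0 ≤ κ * ω := by positivity
      linarith
    have h5 := mul_le_mul_of_nonneg_right h4 (mul_nonneg (mul_nonneg hΛ0.le hP0.le) hn0)
    linarith
  have hfin := mul_le_mul_of_nonneg_left hcore (mul_nonneg hΛ0.le hP0.le)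
  rw [hS1, f0, f1, f2, ← ha1]
  have e4 : K * ((Λ * P * (g1 + α * g0)) ^ 2 / (Λ * P * g0)) =
      Λ * P * (K * ((g1 + α * g0) ^ 2 / g0)) := by
    field_simp
  rw [e4]
  clear_value P
  clear hcore f0 f1 f2
  linarith

end Normalized

/-! ### Choice of the small parameters, and tools for finding the gap. -/

section Selection

open PowerSeries

variable {ι : Type*} [DecidableEq ι]

theorem exists_normalized_inequality (ι : Type*) [DecidableEq ι] (l d N : ℕ) {ρ : ℝ} (hρ : 0 < ρ) :
    ∃ ε : ℝ, 0 < ε ∧ ∀ (L M : Finset ι) (x ξ : ι → ℝ) (i₀ : ι), Disjoint L M →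
      L.card = l → L.card + M.card ≤ N → i₀ ∈ L → x i₀ = 1 → (∀ i ∈ L, ρ ≤ x i) →
      (∀ i ∈ L, x i ≤ 1) → (∀ i ∈ M, |x i| ≤ ε) → IsGarding x (L ∪ M) (l + (d + 1)) →
      ∀ K : ℝ, 4 ≤ K →
      (1 + 1 / (8 * ((l + (d + 1) : ℕ) + 1 : ℝ))) *
          (esum x ((L ∪ M).erase i₀) (l + d) * ξ i₀ ^ 2) ≤
        -2 * coeff 2 (esum (line x ξ) (L ∪ M) (l + (d + 1))) +
          K * (coeff 1 (esum (line x ξ) (L ∪ M) (l + (d + 1))) ^ 2 /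
            esum x (L ∪ M) (l + (d + 1))) +
          (2 - ε) * ∑ i ∈ M, esum x ((L ∪ M).erase i) (l + d) * ξ i ^ 2 := by
  obtain ⟨C, hC, hCb⟩ := exists_weight_bound (ι := ι) d N
  have hρ' : 0 < ρ⁻¹ := inv_pos.2 hρ
  obtain ⟨T, hT⟩ : ∃ T : ℝ, T = 3 * N ^ 2 * (3 * ρ⁻¹ + 1) ^ N * C := ⟨_, rfl⟩
  obtain ⟨W, hW⟩ : ∃ W : ℝ, W = 2 * d + 6 := ⟨_, rfl⟩
  obtain ⟨k, hk⟩ : ∃ k : ℝ, k = l + (d + 1) := ⟨_, rfl⟩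
  have hT0 : 0 ≤ T := by rw [hT]; positivity
  have hW0 : 0 < W := by rw [hW]; positivity
  have hk0 : 0 ≤ k := by rw [hk]; positivity
  obtain ⟨Bd, hBd⟩ : ∃ B : ℝ, B = (N + 1) * (ρ⁻¹ + 1) + (C * N * W) ^ 2 + C * N * W := ⟨_, rfl⟩
  have hBd1 : 1 ≤ Bd := by
    have h1 : 0 ≤ (C * N * W) ^ 2 + C * N * W := by positivity
    have h2 : 0 ≤ (N : ℝ) * ρ⁻¹ := by positivity
    have h3 : (0 : ℝ) ≤ N := Nat.cast_nonneg _
    linarith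
  have hQ : 10000000 ≤ 10000000 * (k + 1) * Bd ^ 6 := by
    have h1 : 1 ≤ (k + 1) * Bd ^ 6 := one_le_mul_of_one_le_of_one_le (by linarith) (one_le_pow₀ hBd1)
    linarith
  obtain ⟨ω, hω⟩ : ∃ ω : ℝ, ω = 1 / (10000000 * (k + 1) * Bd ^ 6) := ⟨_, rfl⟩
  have hω0 : 0 < ω := by rw [hω]; positivity
  have hω1 : ω ≤ 1 / 10000000 := by rw [hω]; exact one_div_le_one_div_of_le (by norm_num) hQ
  have hωB : ω * (10000000 * (k + 1) * Bd ^ 6) ≤ 1 := by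
    rw [hω]; exact (one_div_mul_cancel (by linarith)).le
  have hden : 0 < ((N : ℝ) + 1) ^ 2 + T * W := by positivity
  -- With this choice (N + 1)²ε + TεW = ω², so each smallness requirement on ε follows from ω² ≤
  -- ω/2.
  obtain ⟨ε, hε⟩ : ∃ ε : ℝ, ε = ω ^ 2 / (((N : ℝ) + 1) ^ 2 + T * W) := ⟨_, rfl⟩
  have hε0 : 0 < ε := by rw [hε]; positivity
  have hεd : ((N : ℝ) + 1) ^ 2 * ε + T * ε * W = ω ^ 2 := by
    have h : ε * (((N : ℝ) + 1) ^ 2 + T * W) = ω ^ 2 := by rw [hε]; exact div_mul_cancel₀ _ hden.ne'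
    linarith
  have hTε : 0 ≤ T * ε * W := by positivity
  have hNε : 0 ≤ ((N : ℝ) + 1) ^ 2 * ε := by positivity
  have hωω : ω ^ 2 ≤ ω / 2 := by
    have := mul_le_mul_of_nonneg_left hω1 hω0.le
    linarith
  have hN : (0 : ℝ) ≤ N * ε := by positivity
  have hN2 : (0 : ℝ) ≤ N ^ 2 * ε := by positivity
  have hεω : ε ≤ ω / 2 := by linarith
  refine ⟨ε, hε0, fun L M x ξ i₀ hLM hl hcard hi₀ hx0 hxρ hx1 hxε hG K hK => ?_⟩
  subst hl
  have hgM : IsGarding x M (d + 1) := hG.right hLM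
  have hb := hCb x M ε (by omega) hε0.le hxε hgM
  have hk' : ((L.card + (d + 1) : ℕ) : ℝ) = k := by rw [hk]; push_cast; ring
  rw [hk']
  exact normalized_inequality_of_bounds hLM hcard hi₀ hx0 hρ hxρ hx1 hε0.le (by linarith) hxε hG hC
    (fun r hr => (hb r hr).2) (fun r hr => (hb r hr).1) hT hW hBd.ge hω0 (by linarith) hk hωB
    (by linarith) (by linarith) (by linarith) hεω hK

/-- A finite sequence crossing a threshold sequence has a crossing step. -/
theorem exists_crossing {P : ℕ → Prop} {m : ℕ} (h0 : P 0) (hm : ¬ P m) :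
    ∃ t < m, P t ∧ ¬ P (t + 1) := by
  by_contra! h
  have : ∀ t ≤ m, P t := fun t => by
    induction t with
    | zero => exact fun _ => h0
    | succ t ih => exact fun ht => h t ht (ih (Nat.le_of_succ_le ht))
  exact hm (this m le_rfl)

/-- If all coordinates lie in `[-κ, 1]` and those in `T` are at least `c`, then `e_{#T}` is almost
at least `c ^ #T`. -/
theorem le_esum_of_le {x : ι → ℝ} {S T : Finset ι} {c κ : ℝ} (hTS : T ⊆ S) (hc : 0 ≤ c)
    (hκ : 0 ≤ κ) (hκ1 : κ ≤ 1) (hx1 : ∀ i ∈ S, x i ≤ 1) (hxκ : ∀ i ∈ S, -κ ≤ x i)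
    (hT : ∀ i ∈ T, c ≤ x i) : c ^ T.card - 2 ^ S.card * κ ≤ esum x S T.card := by
  have key : ∀ U ⊆ S, -κ ≤ ∏ i ∈ U, x i := by
    intro U hU
    by_cases h : ∀ i ∈ U, 0 ≤ x i
    · have := Finset.prod_nonneg h
      linarith
    · push Not at h
      obtain ⟨i, hi, hneg⟩ := h
      rw [← Finset.mul_prod_erase U x hi]
      have h1 : |x i| ≤ κ := by
        rw [abs_of_neg hneg]; linarith [hxκ i (hU hi)]
      have h2 : |∏ j ∈ U.erase i, x j| ≤ 1 := by
        rw [Finset.abs_prod]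
        refine Finset.prod_le_one (fun _ _ => abs_nonneg _) fun j hj => ?_
        have hjS := hU (Finset.mem_of_mem_erase hj)
        exact abs_le.2 ⟨by linarith [hxκ j hjS], hx1 j hjS⟩
      have h3 := mul_le_mul h1 h2 (abs_nonneg _) hκ
      rw [← abs_mul, mul_one] at h3
      exact (abs_le.1 h3).1
  have hmem : T ∈ S.powersetCard T.card := Finset.mem_powersetCard.2 ⟨hTS, rfl⟩
  rw [esum, ← Finset.add_sum_erase _ _ hmem]
  have h1 : c ^ T.card ≤ ∏ i ∈ T, x i := by
    rw [← Finset.prod_const]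
    exact Finset.prod_le_prod (fun _ _ => hc) hT
  have h2 : ((S.powersetCard T.card).erase T).card • (-κ) ≤
      ∑ U ∈ (S.powersetCard T.card).erase T, ∏ i ∈ U, x i :=
    Finset.card_nsmul_le_sum _ _ _ fun U hU =>
      key U (Finset.mem_powersetCard.1 (Finset.mem_of_mem_erase hU)).1
  have h3 : ((S.powersetCard T.card).erase T).card ≤ 2 ^ S.card := by
    rw [← Finset.card_powerset]
    refine Finset.card_le_card fun U hU => ?_
    exact Finset.mem_powerset.2 (Finset.mem_powersetCard.1 (Finset.mem_of_mem_erase hU)).1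
  have h4 : (((S.powersetCard T.card).erase T).card : ℝ) ≤ 2 ^ S.card := by exact_mod_cast h3
  have h5 := mul_le_mul_of_nonneg_right h4 hκ
  rw [nsmul_eq_mul] at h2
  linarith

end Selection

/-! ### Translation from `MvPolynomial` derivatives to sums over erased index sets. -/

section Sigma

variable {n : ℕ}

theorem sigma_eq_esum (k : ℕ) (lam : Fin n → ℝ) : sigma k lam = esum lam Finset.univ k := by
  have h : MvPolynomial.esymm (Fin n) ℝ k = esum MvPolynomial.X Finset.univ k := rfl
  rw [sigma, h, map_esum]
  simp

theorem pderiv_esum_X (p : Fin n) {S : Finset (Fin n)} (hp : p ∈ S) (m : ℕ) :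
    MvPolynomial.pderiv p (esum (MvPolynomial.X : Fin n → MvPolynomial (Fin n) ℝ) S (m + 1)) =
      esum MvPolynomial.X (S.erase p) m := by
  rw [derivation_esum, Finset.sum_eq_single p]
  · simp
  · intro i _ hi
    rw [MvPolynomial.pderiv_X_of_ne hi, zero_mul]
  · exact fun h => absurd hp h

theorem sigmaD_eq_esum (k : ℕ) (p : Fin n) (lam : Fin n → ℝ) :
    sigmaD (k + 1) p lam = esum lam (Finset.univ.erase p) k := by
  have h : MvPolynomial.esymm (Fin n) ℝ (k + 1) = esum MvPolynomial.X Finset.univ (k + 1) := rfl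
  rw [sigmaD, h, pderiv_esum_X p (Finset.mem_univ p), map_esum]
  simp

theorem sigmaDD_eq_esum (k : ℕ) {p q : Fin n} (hpq : p ≠ q) (lam : Fin n → ℝ) :
    sigmaDD (k + 2) p q lam = esum lam ((Finset.univ.erase p).erase q) k := by
  have h : MvPolynomial.esymm (Fin n) ℝ (k + 2) = esum MvPolynomial.X Finset.univ (k + 1 + 1) := rfl
  rw [sigmaDD, h, pderiv_esum_X q (Finset.mem_univ q),
    pderiv_esum_X p (Finset.mem_erase.2 ⟨hpq, Finset.mem_univ p⟩), map_esum,
    Finset.erase_right_comm]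
  simp

theorem esum_eq_pow_mul {lam x : Fin n → ℝ} {t : ℝ} (h : ∀ i, lam i = t * x i)
    (S : Finset (Fin n)) (m : ℕ) : esum lam S m = t ^ m * esum x S m := by
  rw [← esum_smul]
  exact esum_congr (fun i _ => h i) m

end Sigma

/-! ### Undoing the scaling, and the final theorem. -/

section Final

open PowerSeries

variable {n : ℕ}

theorem inequality_of_normalized [NeZero n] {m : ℕ} {lam x : Fin n → ℝ} {t A ε K δ : ℝ}
    {M : Finset (Fin n)} (hlam : ∀ i, lam i = t * x i) (ht : 0 < t) (hA : 0 < A) (hx0 : x 0 = 1)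
    (hG : IsGarding x Finset.univ (m + 2)) (hM : M ⊆ Finset.Ioi 0) (hε : (A + 1) / t ≤ ε / 2)
    (ξ : Fin n → ℝ)
    (h : (1 + δ) * (esum x (Finset.univ.erase 0) (m + 1) * ξ 0 ^ 2) ≤
      -2 * coeff 2 (esum (line x ξ) Finset.univ (m + 2)) +
        K * (coeff 1 (esum (line x ξ) Finset.univ (m + 2)) ^ 2 / esum x Finset.univ (m + 2)) +
        (2 - ε) * ∑ i ∈ M, esum x (Finset.univ.erase i) (m + 1) * ξ i ^ 2) :
    (1 + δ) * (sigmaD (m + 2) 0 lam * ξ 0 ^ 2 / (lam 0 * sigma (m + 2) lam)) ≤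
      -(∑ p : Fin n, ∑ q ∈ Finset.univ.erase p,
          sigmaDD (m + 2) p q lam * ξ p * ξ q / sigma (m + 2) lam) +
        K * ((∑ i : Fin n, sigmaD (m + 2) i lam * ξ i) ^ 2 / sigma (m + 2) lam ^ 2) +
        2 * ∑ i ∈ Finset.Ioi (0 : Fin n),
          sigmaD (m + 2) i lam * ξ i ^ 2 / ((lam 0 + A + 1) * sigma (m + 2) lam) := by
  obtain ⟨F, hF⟩ : ∃ F, F = esum x Finset.univ (m + 2) := ⟨_, rfl⟩
  have hF0 : 0 < F := by rw [hF]; exact hG _ le_rfl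
  have hσ : sigma (m + 2) lam = t ^ (m + 2) * F := by
    rw [sigma_eq_esum, esum_eq_pow_mul hlam, hF]
  have hD : ∀ i, sigmaD (m + 2) i lam = t ^ (m + 1) * esum x (Finset.univ.erase i) (m + 1) :=
    fun i => by rw [sigmaD_eq_esum, esum_eq_pow_mul hlam]
  have ht0 : lam 0 = t := by rw [hlam, hx0, mul_one]
  have hS : ∀ i, 0 ≤ esum x (Finset.univ.erase i) (m + 1) := fun i =>
    (hG.erase (Finset.mem_univ i) _ le_rfl).le
  have h2 : ∑ p : Fin n, ∑ q ∈ Finset.univ.erase p,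
      sigmaDD (m + 2) p q lam * ξ p * ξ q / sigma (m + 2) lam =
      2 * coeff 2 (esum (line x ξ) Finset.univ (m + 2)) / (t ^ 2 * F) := by
    rw [coeff_two_esum_line, Finset.sum_div]
    refine Finset.sum_congr rfl fun p _ => ?_
    rw [Finset.sum_div]
    refine Finset.sum_congr rfl fun q hq => ?_
    rw [sigmaDD_eq_esum m (Finset.ne_of_mem_erase hq).symm, esum_eq_pow_mul hlam, hσ]
    field_simp
    ring
  have h1 : ∑ i : Fin n, sigmaD (m + 2) i lam * ξ i =
      t ^ (m + 1) * coeff 1 (esum (line x ξ) Finset.univ (m + 2)) := by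
    rw [coeff_one_esum_line, Finset.mul_sum]
    exact Finset.sum_congr rfl fun i _ => by rw [hD]; ring
  have h3 : (2 - ε) * (∑ i ∈ M, esum x (Finset.univ.erase i) (m + 1) * ξ i ^ 2) / (t ^ 2 * F) ≤
      2 * ∑ i ∈ Finset.Ioi (0 : Fin n),
        sigmaD (m + 2) i lam * ξ i ^ 2 / ((lam 0 + A + 1) * sigma (m + 2) lam) := by
    have e1 : ∑ i ∈ Finset.Ioi (0 : Fin n),
        sigmaD (m + 2) i lam * ξ i ^ 2 / ((lam 0 + A + 1) * sigma (m + 2) lam) =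
        (∑ i ∈ Finset.Ioi (0 : Fin n), esum x (Finset.univ.erase i) (m + 1) * ξ i ^ 2) /
          ((t + A + 1) * t * F) := by
      rw [Finset.sum_div]
      refine Finset.sum_congr rfl fun i _ => ?_
      rw [hD, hσ, ht0]
      field_simp
      ring
    have e2 : ∑ i ∈ M, esum x (Finset.univ.erase i) (m + 1) * ξ i ^ 2 ≤
        ∑ i ∈ Finset.Ioi (0 : Fin n), esum x (Finset.univ.erase i) (m + 1) * ξ i ^ 2 :=
      Finset.sum_le_sum_of_subset_of_nonneg hM fun i _ _ => mul_nonneg (hS i) (sq_nonneg _)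
    have e3 : 0 ≤ ∑ i ∈ M, esum x (Finset.univ.erase i) (m + 1) * ξ i ^ 2 :=
      Finset.sum_nonneg fun i _ => mul_nonneg (hS i) (sq_nonneg _)
    rw [e1]
    -- The ε spared in the normalized inequality pays for the denominator λ₁ + A + 1 in place of λ₁.
    have hAt : (2 - ε) * (t + A + 1) ≤ 2 * t := by
      have e4 : A + 1 ≤ ε / 2 * t := (div_le_iff₀ ht).1 hε
      rcases le_or_gt ε 2 with h' | h'
      · have := mul_le_mul_of_nonneg_left e4 (by linarith : 0 ≤ 2 - ε)
        have : 0 ≤ ε ^ 2 * t := by positivity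
        linarith
      · have := mul_nonneg (by linarith : 0 ≤ ε - 2) (by linarith : 0 ≤ t + A + 1)
        linarith
    rw [mul_div_assoc', div_le_div_iff₀ (by positivity) (by positivity)]
    have e5 := mul_le_mul_of_nonneg_right hAt (mul_nonneg e3 (by positivity : 0 ≤ t * F))
    have e6 := mul_le_mul_of_nonneg_left e2 (by positivity : 0 ≤ 2 * t * (t * F))
    linarith
  rw [h2, h1]
  refine le_trans ?_ (add_le_add_right h3 _)
  rw [hD, hσ, ht0]
  rw [← hF] at h
  have h4 := div_le_div_of_nonneg_right h (by positivity : 0 ≤ t ^ 2 * F)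
  refine (le_of_eq ?_).trans (h4.trans (le_of_eq ?_))
  · field_simp
    ring
  · field_simp
    ring

end Final

theorem lemma1p4 (k : ℕ) (hk : 1 ≤ k) :
    ∃ δ₀ : ℝ, 0 < δ₀ ∧ ∃ K₀ : ℝ, 0 < K₀ ∧
      ∀ (n : ℕ) [NeZero n], k ≤ n →
      ∀ A : ℝ, 0 < A → ∀ m M : ℝ, 0 < m → m ≤ M →
      ∃ C : ℝ, 0 < C ∧
        ∀ lam : Fin n → ℝ, lam ∈ gardingCone n k → Antitone lam → (∀ i, -A < lam i) →
          m ≤ sigma k lam → sigma k lam ≤ M → C ≤ lam 0 →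
          ∀ K : ℝ, K₀ ≤ K → ∀ ξ : Fin n → ℝ,
            (1 + δ₀) * (sigmaD k 0 lam * ξ 0 ^ 2 / (lam 0 * sigma k lam)) ≤
              -(∑ p : Fin n, ∑ q ∈ Finset.univ.erase p,
                  sigmaDD k p q lam * ξ p * ξ q / sigma k lam)
                + K * ((∑ i : Fin n, sigmaD k i lam * ξ i) ^ 2 / sigma k lam ^ 2)
                + 2 * ∑ i ∈ Finset.Ioi (0 : Fin n),
                    sigmaD k i lam * ξ i ^ 2 / ((lam 0 + A + 1) * sigma k lam) := by
  refine ⟨1 / (8 * (k + 1)), by positivity, 4, by norm_num, ?_⟩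
  intro n _ hkn A hA m M hm hmM
  choose ε hε0 hε using fun (l d : ℕ) (ρ : {r : ℝ // 0 < r}) =>
    exists_normalized_inequality (Fin n) l d n ρ.2
  -- Thresholds for the entries: c (t + 1) is small enough for a large cluster of t + 1 entries
  -- bounded below by c t. The degree k - 2 - t is the d with (t + 1) + (d + 1) = k.
  obtain ⟨c, hc0, hcs⟩ : ∃ c : ℕ → {r : ℝ // 0 < r}, (c 0 : ℝ) = 1 ∧
      ∀ t, (c (t + 1) : ℝ) = min (c t : ℝ) (ε (t + 1) (k - 2 - t) (c t)) :=
    ⟨fun t => Nat.rec ⟨1, one_pos⟩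
      (fun t r => ⟨min r (ε (t + 1) (k - 2 - t) r), lt_min r.2 (hε0 _ _ _)⟩) t, rfl, fun _ => rfl⟩
  have hcanti : Antitone fun t => (c t : ℝ) :=
    antitone_nat_of_succ_le fun t => by rw [hcs]; exact min_le_left _ _
  obtain ⟨c', hc'⟩ : ∃ c' : ℝ, c' = c (k - 1) := ⟨_, rfl⟩
  have hc'0 : 0 < c' := by rw [hc']; exact (c (k - 1)).2
  have hc'1 : c' ≤ 1 := by rw [hc', ← hc0]; exact hcanti (Nat.zero_le _)
  have hck : c' ^ k ≤ c' := pow_le_of_le_one hc'0.le hc'1 (by omega)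
  have hM0 : 0 < M := hm.trans_le hmM
  have h2n : (1 : ℝ) ≤ 2 ^ n := one_le_pow₀ one_le_two
  -- Chosen so that (A + 1)/λ₁ ≤ c'/2, 2^n A/λ₁ ≤ c'^k/2 and λ₁c'^k/2 > M.
  refine ⟨2 * 2 ^ n * (A + 1) * (M + 1) / c' ^ k, by positivity, ?_⟩
  intro lam hlam hanti hlow hσm hσM hC K hK ξ
  obtain ⟨t, ht⟩ : ∃ t, t = lam 0 := ⟨_, rfl⟩
  rw [← ht, div_le_iff₀ (by positivity)] at hC
  have hp1 : 1 ≤ 2 ^ n * (M + 1) := one_le_mul_of_one_le_of_one_le h2n (by linarith)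
  have hp2 : 2 * ((A + 1) * 1) ≤ t * c' ^ k := by
    refine le_trans ?_ hC
    have := mul_le_mul_of_nonneg_left hp1 (by positivity : 0 ≤ 2 * (A + 1))
    linarith
  have htpos : 0 < t := by
    have h1 : 0 < t * c' ^ k := by linarith
    exact (mul_pos_iff_of_pos_right (by positivity)).1 h1
  have ht1 : 1 ≤ t := by
    have := mul_le_mul_of_nonneg_left (hck.trans hc'1) htpos.le
    linarith
  obtain ⟨x, hx⟩ : ∃ x : Fin n → ℝ, ∀ i, x i = lam i / t := ⟨_, fun _ => rfl⟩
  have hlx : ∀ i, lam i = t * x i := fun i => by rw [hx]; field_simp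
  have hx0 : x 0 = 1 := by rw [hx, ht, div_self (by rw [← ht]; exact htpos.ne')]
  have hxanti : ∀ i j, i ≤ j → x j ≤ x i := fun i j hij => by
    rw [hx, hx]; exact div_le_div_of_nonneg_right (hanti hij) htpos.le
  have hx1 : ∀ i, x i ≤ 1 := fun i => by rw [← hx0]; exact hxanti 0 i (Fin.zero_le i)
  have hxA : ∀ i, -(A / t) ≤ x i := fun i => by
    rw [hx, ← neg_div]; exact div_le_div_of_nonneg_right (hlow i).le htpos.le
  have hA1 : (A + 1) / t ≤ c' / 2 := by
    rw [div_le_iff₀ htpos]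
    have := mul_le_mul_of_nonneg_left hck htpos.le
    linarith
  have hAt : A / t ≤ c' := by
    have : A / t ≤ (A + 1) / t := div_le_div_of_nonneg_right (by linarith) htpos.le
    linarith
  have hG : IsGarding x Finset.univ k := by
    intro j hj
    rcases Nat.eq_zero_or_pos j with rfl | hj0
    · simp
    · have h1 := hlam j hj0 hj
      rw [sigma_eq_esum, esum_eq_pow_mul hlx] at h1
      exact (mul_pos_iff_of_pos_left (by positivity)).1 h1
  -- Otherwise the first k entries are at least c', so e_k(x) ≥ c'^k/2 and σ_k ≥ λ₁c'^k/2 > M. For k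
  -- = 1 the threshold is 1 = x 0, so this is already a contradiction and nothing remains to prove.
  have hlast : ¬ (c' ≤ x ⟨k - 1, by omega⟩) := by
    intro hge
    have hcardT : (Finset.univ.filter fun i : Fin n => i.val < k).card = k := by
      rw [Fin.card_filter_val_lt, min_eq_right hkn]
    have h1 := le_esum_of_le (x := x) (κ := A / t)
      (Finset.filter_subset (fun i : Fin n => i.val < k) Finset.univ)
      hc'0.le (by positivity) (hAt.trans hc'1) (fun i _ => hx1 i) (fun i _ => hxA i)
      (fun i hi => hge.trans (hxanti _ _ (by
        rw [Fin.le_def]; have := (Finset.mem_filter.1 hi).2; simp only; omega)))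
    rw [hcardT, Finset.card_univ, Fintype.card_fin] at h1
    have h2 : 2 ^ n * (A / t) ≤ c' ^ k / 2 := by
      rw [mul_div_assoc', div_le_iff₀ htpos]
      have h3 : 2 ^ n * A * 1 ≤ 2 ^ n * (A + 1) * (M + 1) :=
        mul_le_mul (mul_le_mul_of_nonneg_left (by linarith) (by positivity)) (by linarith)
          (by norm_num) (by positivity)
      linarith
    have h4 : t ^ k * (c' ^ k / 2) ≤ sigma k lam := by
      rw [sigma_eq_esum, esum_eq_pow_mul hlx]
      exact mul_le_mul_of_nonneg_left (by linarith) (by positivity)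
    have h5 : t * (c' ^ k / 2) ≤ t ^ k * (c' ^ k / 2) :=
      mul_le_mul_of_nonneg_right (le_self_pow₀ ht1 (by omega)) (by positivity)
    have h6 : 1 * (M + 1) ≤ 2 ^ n * (A + 1) * (M + 1) :=
      mul_le_mul_of_nonneg_right (one_le_mul_of_one_le_of_one_le h2n (by linarith)) (by linarith)
    linarith
  obtain ⟨s, hsk, hs, hs'⟩ := exists_crossing (m := k - 1)
    (P := fun s => ∀ h : s < n, (c s : ℝ) ≤ x ⟨s, h⟩)
    (fun h => by rw [hc0]; exact hx0.ge) (fun h => hlast (by rw [hc']; exact h _))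
  have hsn : s + 1 < n := (Nat.succ_lt_succ hsk).trans_le (by clear hs hs'; omega)
  obtain ⟨i₁, hi₁, hs''⟩ : ∃ i₁ : Fin n, i₁.val = s + 1 ∧ x i₁ < c (s + 1) := by
    refine ⟨⟨s + 1, hsn⟩, rfl, ?_⟩
    by_contra hcon
    exact hs' fun _ => not_lt.1 hcon
  obtain ⟨i₂, hi₂, hs₂⟩ : ∃ i₂ : Fin n, i₂.val = s ∧ (c s : ℝ) ≤ x i₂ :=
    ⟨⟨s, (Nat.lt_succ_self s).trans hsn⟩, rfl, hs _⟩
  clear hs hs' hlast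
  obtain ⟨d, rfl⟩ : ∃ d, k = s + 1 + (d + 1) := ⟨k - 2 - s, by omega⟩
  have hd : s + 1 + (d + 1) - 2 - s = d := by omega
  have hcε : (c (s + 1) : ℝ) ≤ ε (s + 1) d (c s) := by
    rw [hcs, hd]; exact min_le_right _ _
  have hc'c : c' ≤ c (s + 1) := by rw [hc']; exact hcanti (by omega)
  obtain ⟨L, hL⟩ : ∃ L, L = Finset.univ.filter fun i : Fin n => i.val < s + 1 := ⟨_, rfl⟩
  obtain ⟨S, hS⟩ : ∃ S, S = Finset.univ.filter fun i : Fin n => ¬ i.val < s + 1 := ⟨_, rfl⟩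
  have hdisj : Disjoint L S := by rw [hL, hS]; exact Finset.disjoint_filter_filter_not _ _ _
  have hun : L ∪ S = Finset.univ := by rw [hL, hS]; exact Finset.filter_union_filter_not_eq _ _
  have hLc : L.card = s + 1 := by rw [hL, Fin.card_filter_val_lt, min_eq_right (by omega)]
  have hcards : L.card + S.card ≤ n := by
    rw [← Finset.card_union_of_disjoint hdisj, hun, Finset.card_univ, Fintype.card_fin]
  have hmain := hε (s + 1) d (c s) L S x ξ 0 hdisj hLc hcards
    (by rw [hL]; simp) hx0
    (fun i hi => hs₂.trans (hxanti _ _ (by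
      rw [hL] at hi; have := (Finset.mem_filter.1 hi).2; rw [Fin.le_def]; omega)))
    (fun i _ => hx1 i)
    (fun i hi => abs_le.2 ⟨by linarith [hxA i], by
      have h1 : x i ≤ x i₁ := hxanti _ _ (by
        rw [hS] at hi; have := (Finset.mem_filter.1 hi).2; rw [Fin.le_def]; omega)
      linarith⟩)
    (by rw [hun]; exact hG) K hK
  rw [hun] at hmain
  have e1 : s + 1 + (d + 1) = s + d + 2 := by omega
  have e2 : s + 1 + d = s + d + 1 := by omega
  rw [e2, e1] at hmain
  rw [e1] at hG ⊢
  refine inequality_of_normalized hlx htpos hA hx0 hG (fun i hi => ?_) (by linarith) ξ hmain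
  rw [hS] at hi
  have := (Finset.mem_filter.1 hi).2
  rw [Finset.mem_Ioi, Fin.lt_def]
  simp only [Fin.val_zero]
  omega
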